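/- **Conventions.** Manifolds are smooth Banach manifolds (Hausdorff, without boundary, modelled on real Banach spaces). A *weak Riemannian metric* on $M$ is a smooth family $g$ of continuous, symmetric, positive definite bilinear forms on the tangent spaces (the topology induced by $g$ on $T_mM$ may be weaker than the given one); $|v|=\sqrt{g(v,v)}$. A *weak hyperkähler Banach manifold* $(M,g,I_1,I_2,I_3)$ consists of a weak Riemannian metric $g$ that has a smooth Levi-Civita connection $\nabla$, and smooth anti-commuting almost complex structures $I_1,I_2,I_3$ which are fibrewise isometries, satisfy $I_1I_2I_3=-1$ and commute with $\nabla$. The sectional curvature of the plane spanned by $u,v$ is $K(u,v)=\dfrac{g(R(u,v)v,u)}{|u|^2|v|^2-g(u,v)^2}$, where $R(X,Y)Z=\nabla_X\nabla_YZ-\nabla_Y\nabla_XZ-\nabla_{[X,Y]}Z$. Let a Banach Lie group $G$ with Lie algebra $\mathfrak g$ act smoothly on a weak hyperkähler Banach manifold $(M,g,I_1,I_2,I_3)$. For $\rho\in\mathfrak g$ let $\check\rho$ be its fundamental vector field, and let $\check{\mathfrak g}_m=\{\check\rho_m:\rho\in\mathfrak g\}\subset T_mM$. Suppose the action is *tri-Hamiltonian*: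 there are smooth $G$-equivariant maps $\mu_1,\mu_2,\mu_3:M\to\mathfrak g^*$ with $\langle d\mu_i(v),\rho\rangle=g(v,I_i\check\rho)$ for all tangent vectors $v$ and all $\rho\in\mathfrak g$. Let $c=(c_1,c_2,c_3)\in(\mathfrak g^*)^3$ be fixed by the coadjoint action, and let $M_c=\{m:\mu_i(m)=c_i,\ i=1,2,3\}$. Assume that * $M_c$ is a (split, embedded) submanifold of $M$ with $T_mM_c=\bigcap_i\ker (d\mu_i)_m$ for all $m\in M_c$; * the action of $G$ on $M_c$ is free, proper (the map $(h,m)\mapsto(hm,m)$ is proper) and isometric (for the metric induced by $g$), and it is *elliptic* at every $m\in M_c$, i.e. $\Lambda_m(T_mM)=\Lambda_m(\check{\mathfrak g}_m)$, where $\Lambda_m(v)\in\mathfrak g^*$ is given by $\Lambda_m(v)(\rho)=g(v,\check\rho_m)$. Let $Q=M_c/G$ be the hyperkähler quotient: the orbit space, with the smooth structure for which the projection $M_c\to Q$ is a submersion, the weak Riemannian metric for which $d(\text{projection})$ preserves scalar products of vectors of $T_mM_c$ orthogonal to $\check{\mathfrak g}_m$, and the smooth Levi-Civita connection of this metric. For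 $m\in M_c$ let $H_m\subset T_mM$ be the $g$-orthogonal complement of $\check{\mathfrak g}_m+I_1\check{\mathfrak g}_m+I_2\check{\mathfrak g}_m+I_3\check{\mathfrak g}_m$. For $X,Y\in H_m$ let $A(X,Y)\in\check{\mathfrak g}_m$ be the $\check{\mathfrak g}_m$-part of $(\nabla_X\tilde Y)_m$ (that is, $(\nabla_X\tilde Y)_m-A(X,Y)\perp\check{\mathfrak g}_m$), where $\tilde Y$ is any smooth vector field near $m$ extending $Y$ with $\tilde Y_x\perp\check{\mathfrak g}_x$ for all $x\in M_c$ near $m$; this does not depend on $\tilde Y$. Put $$V(m)=\sup\Big\{\tfrac{|A(X,Y)|}{|X||Y|}\;:\;X,Y\in H_m\setminus\{0\}\Big\}\in[0,+\infty].$$ **Proposition.** For every $p\in Q$, every $m\in M_c$ projecting to $p$ and every plane $\pi\subset T_pQ$ with horizontal lift $\tilde\pi\subset T_mM_c$ (the plane orthogonal to $\check{\mathfrak g}_m$ which projects onto $\pi$), $$|K_Q(\pi)-K_M(\tilde\pi)|\le 9\,V(m)^2 .$$ -/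

import Mathlib

open Bundle Set Filter
open scoped Manifold ContDiff Topology ENNReal

namespace HKQuot

noncomputable section

/-! ## Weak Riemannian Banach manifolds

All manifolds are smooth manifolds without boundary, modelled on a real Banach space through
`𝓘(ℝ, E)`. -/

section Riemannian

variable {E : Type*} [NormedAddCommGroup E] [NormedSpace ℝ E]
  {M : Type*} [TopologicalSpace M] [ChartedSpace E M] [IsManifold 𝓘(ℝ, E) ∞ M]

variable (E M) in
/-- Families of continuous bilinear forms on the tangent spaces of `M`. -/
abbrev BilinField : Type _ :=
  (x : M) → TangentSpace 𝓘(ℝ, E) x →L[ℝ] TangentSpace 𝓘(ℝ, E) x →L[ℝ] ℝ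

variable (E M) in
/-- Families of continuous endomorphisms of the tangent spaces of `M`. -/
abbrev EndoField : Type _ :=
  (x : M) → TangentSpace 𝓘(ℝ, E) x →L[ℝ] TangentSpace 𝓘(ℝ, E) x

variable (E M) in
/-- Covariant derivatives on the tangent bundle of `M`; `D Y x v` is `(∇_v Y)(x)`. -/
abbrev Connection : Type _ :=
  CovariantDerivative 𝓘(ℝ, E) E (fun x : M ↦ TangentSpace 𝓘(ℝ, E) x)

/-- The vector field `Y` is differentiable at `x`. -/
def DiffFieldAt (Y : (x : M) → TangentSpace 𝓘(ℝ, E) x) (x : M) : Prop :=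
  MDifferentiableAt 𝓘(ℝ, E) 𝓘(ℝ, E).tangent
    (fun y ↦ (⟨y, Y y⟩ : TangentBundle 𝓘(ℝ, E) M)) x

/-- The vector field `Y` is smooth at `x`. -/
def SmoothFieldAt
    (Y : (x : M) → TangentSpace 𝓘(ℝ, E) x) (x : M) : Prop :=
  ContMDiffAt 𝓘(ℝ, E) 𝓘(ℝ, E).tangent ∞
    (fun y ↦ (⟨y, Y y⟩ : TangentBundle 𝓘(ℝ, E) M)) x

/-- A weak Riemannian metric: a smooth family of continuous symmetric positive definite bilinear
forms on the tangent spaces. The topology it induces on a tangent space may be weaker than the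
given one. -/
structure IsWeakMetric (g : BilinField E M) : Prop where
  symm : ∀ (x : M) (v w : TangentSpace 𝓘(ℝ, E) x), g x v w = g x w v
  pos : ∀ (x : M) (v : TangentSpace 𝓘(ℝ, E) x), v ≠ 0 → 0 < g x v v
  smooth : ContMDiff 𝓘(ℝ, E) (𝓘(ℝ, E).prod 𝓘(ℝ, E →L[ℝ] E →L[ℝ] ℝ)) ∞
    (fun x : M ↦ TotalSpace.mk' (E →L[ℝ] E →L[ℝ] ℝ)
      (E := fun x : M ↦ TangentSpace 𝓘(ℝ, E) x →L[ℝ] TangentSpace 𝓘(ℝ, E) x →L[ℝ] ℝ) x (g x))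

/-- The length of a tangent vector. -/
def len (g : BilinField E M) {x : M} (v : TangentSpace 𝓘(ℝ, E) x) : ℝ := √(g x v v)

/-- `D` is a smooth Levi-Civita connection of `g`. Smoothness is required on every open set, since
there may be few globally smooth vector fields. -/
structure IsLeviCivita (g : BilinField E M) (D : Connection E M) :
    Prop where
  metric : ∀ (x : M) (Y Z : (x : M) → TangentSpace 𝓘(ℝ, E) x) (v : TangentSpace 𝓘(ℝ, E) x),
    DiffFieldAt Y x → DiffFieldAt Z x →
      mvfderiv 𝓘(ℝ, E) (fun y ↦ g y (Y y) (Z y)) x v =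
        g x (D Y x v) (Z x) + g x (Y x) (D Z x v)
  torsionFree : ∀ (x : M) (X Y : (x : M) → TangentSpace 𝓘(ℝ, E) x),
    DiffFieldAt X x → DiffFieldAt Y x →
      D Y x (X x) - D X x (Y x) = VectorField.mlieBracket 𝓘(ℝ, E) X Y x
  smooth : ∀ U : Set M, IsOpen U → ContMDiffCovariantDerivativeOn E ∞ D.toFun U

/-- The curvature expression `∇_X ∇_Y Z - ∇_Y ∇_X Z - ∇_{[X,Y]} Z`. -/
def curvatureField (D : Connection E M) (X Y Z : (x : M) → TangentSpace 𝓘(ℝ, E) x) (x : M) :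
    TangentSpace 𝓘(ℝ, E) x :=
  D (fun y ↦ D Z y (Y y)) x (X x) - D (fun y ↦ D Z y (X y)) x (Y x)
    - D Z x (VectorField.mlieBracket 𝓘(ℝ, E) X Y x)

/-- The curvature `R(u, v) w` at a point, computed with the extensions of `u`, `v`, `w` that are
constant in the preferred chart at the point. -/
def curvature (D : Connection E M) {x : M}
    (u v w : TangentSpace 𝓘(ℝ, E) x) : TangentSpace 𝓘(ℝ, E) x :=
  curvatureField D (FiberBundle.extend E u) (FiberBundle.extend E v) (FiberBundle.extend E w) x

/-- The sectional curvature of the plane spanned by two linearly independent vectors `u`, `v`. -/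
def sectionalCurvature (g : BilinField E M) (D : Connection E M) {x : M}
    (u v : TangentSpace 𝓘(ℝ, E) x) : ℝ :=
  g x (curvature D u v v) u / (g x u u * g x v v - g x u v ^ 2)

/-- `(g, D, J)` is a weak hyperkähler structure: `g` is a weak Riemannian metric with smooth
Levi-Civita connection `D`, and `J 0, J 1, J 2` are smooth anti-commuting almost complex
structures that are fibrewise isometries, satisfy `J 0 ∘ J 1 ∘ J 2 = -1` and commute
with `D`. -/
structure IsWeakHyperkahler (g : BilinField E M) (D : Connection E M)
    (J : Fin 3 → EndoField E M) : Prop where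
  isWeakMetric : IsWeakMetric g
  isLeviCivita : IsLeviCivita g D
  smooth : ∀ i, ContMDiff 𝓘(ℝ, E) (𝓘(ℝ, E).prod 𝓘(ℝ, E →L[ℝ] E)) ∞
    (fun x : M ↦ TotalSpace.mk' (E →L[ℝ] E)
      (E := fun x : M ↦ TangentSpace 𝓘(ℝ, E) x →L[ℝ] TangentSpace 𝓘(ℝ, E) x) x (J i x))
  square : ∀ i (x : M) (v : TangentSpace 𝓘(ℝ, E) x), J i x (J i x v) = -v
  anticomm : ∀ i j, i ≠ j → ∀ (x : M) (v : TangentSpace 𝓘(ℝ, E) x),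
    J i x (J j x v) = -J j x (J i x v)
  triple : ∀ (x : M) (v : TangentSpace 𝓘(ℝ, E) x), J 0 x (J 1 x (J 2 x v)) = -v
  isometry : ∀ i (x : M) (v w : TangentSpace 𝓘(ℝ, E) x), g x (J i x v) (J i x w) = g x v w
  parallel : ∀ i (x : M) (Y : (x : M) → TangentSpace 𝓘(ℝ, E) x) (v : TangentSpace 𝓘(ℝ, E) x),
    DiffFieldAt Y x → D (fun y ↦ J i y (Y y)) x v = J i x (D Y x v)

end Riemannian

/-! ## Actions of Banach Lie groups

`G` is a Banach Lie group modelled on `L`; its Lie algebra `T_1 G` is, by definition of the tangent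
space, the Banach space `L`, and the dual of the Lie algebra is `L →L[ℝ] ℝ`. -/

section Action

variable {L : Type*} [NormedAddCommGroup L] [NormedSpace ℝ L]
  {G : Type*} [TopologicalSpace G] [ChartedSpace L G] [Group G]
  {E : Type*} [NormedAddCommGroup E] [NormedSpace ℝ E]
  {M : Type*} [TopologicalSpace M] [ChartedSpace E M] [MulAction G M]

variable (L G E) in
/-- The map `ρ ↦ ρ̌ₘ`, the value at `m` of the fundamental vector field of `ρ`: the derivative at
`1` of the orbit map `h ↦ h • m`. -/
def fund (m : M) : L →L[ℝ] TangentSpace 𝓘(ℝ, E) m :=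
  mfderiv 𝓘(ℝ, L) 𝓘(ℝ, E) (fun h : G ↦ h • m) 1

variable (L) in
/-- The adjoint action: the derivative at `1` of `x ↦ h * x * h⁻¹`. -/
def Ad (h : G) : L →L[ℝ] L :=
  mfderiv 𝓘(ℝ, L) 𝓘(ℝ, L) (fun x : G ↦ h * x * h⁻¹) 1

/-- The coadjoint action. -/
def coAd (h : G) (ℓ : L →L[ℝ] ℝ) : L →L[ℝ] ℝ := ℓ.comp (Ad L h⁻¹)

variable (L G) in
/-- The dual-valued form `Λ(v)(ρ) = g(v, ρ̌)`. -/
def Lam (g : BilinField E M) (m : M) (v : TangentSpace 𝓘(ℝ, E) m) : L →L[ℝ] ℝ :=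
  (g m v).comp (fund L G E m)

variable (L G) in
/-- The action is elliptic at `m`: `Λ(T_m M)` equals the image under `Λ` of the tangent directions
of the orbit. -/
def IsEllipticAt (g : BilinField E M) (m : M) : Prop :=
  Set.range (Lam L G g m) = Lam L G g m '' Set.range (fund L G E m)

variable (G) in
/-- `μ 0, μ 1, μ 2` are moment maps for the action with respect to `(g, J)`: they are smooth,
equivariant, and `⟨dμᵢ(v), ρ⟩ = g(v, Jᵢ ρ̌)`. -/
structure IsHyperkahlerMomentMap (g : BilinField E M) (J : Fin 3 → EndoField E M)
    (μ : Fin 3 → M → (L →L[ℝ] ℝ)) : Prop where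
  smooth : ∀ i, ContMDiff 𝓘(ℝ, E) 𝓘(ℝ, L →L[ℝ] ℝ) ∞ (μ i)
  equivariant : ∀ i (h : G) (m : M), μ i (h • m) = coAd h (μ i m)
  deriv_eq : ∀ i (m : M) (v : TangentSpace 𝓘(ℝ, E) m) (ρ : L),
    mvfderiv 𝓘(ℝ, E) (μ i) m v ρ = g m v (J i m (fund L G E m ρ))

/-- The level set `M_c = μ⁻¹(c)`. -/
def levelSet (μ : Fin 3 → M → (L →L[ℝ] ℝ)) (c : Fin 3 → (L →L[ℝ] ℝ)) : Set M :=
  {m | ∀ i, μ i m = c i}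

/-- The action of `G` on `M_c` is free, proper, isometric (for the metric induced on `M_c`, whose
tangent spaces are the joint kernels of the `dμᵢ`) and elliptic at the points of `M_c`.
Properness is that of `(h, m) ↦ (h • m, m)` on `G × M_c`; its target is taken to be `M × M`
since `M_c` is closed in `M`. -/
structure IsGoodOnLevel (G : Type*) [TopologicalSpace G] [ChartedSpace L G] [Group G]
    [MulAction G M] (g : BilinField E M) (μ : Fin 3 → M → (L →L[ℝ] ℝ))
    (c : Fin 3 → (L →L[ℝ] ℝ)) : Prop where
  free : ∀ (h : G), ∀ m ∈ levelSet μ c, h • m = m → h = 1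
  proper : IsProperMap (fun p : G × levelSet μ c ↦ ((p.1 • (p.2 : M), (p.2 : M)) : M × M))
  isometric : ∀ (h : G), ∀ m ∈ levelSet μ c, ∀ v w : TangentSpace 𝓘(ℝ, E) m,
    (∀ i, mvfderiv 𝓘(ℝ, E) (μ i) m v = 0) → (∀ i, mvfderiv 𝓘(ℝ, E) (μ i) m w = 0) →
      g (h • m) (mfderiv 𝓘(ℝ, E) 𝓘(ℝ, E) (fun y : M ↦ h • y) m v)
        (mfderiv 𝓘(ℝ, E) 𝓘(ℝ, E) (fun y : M ↦ h • y) m w) = g m v w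
  elliptic : ∀ m ∈ levelSet μ c, IsEllipticAt L G g m

/-- With its given manifold structure, `M_c` is a (split) embedded submanifold of `M`
with `T_m M_c = ker dμ_m` at each of its points `m`. -/
structure IsLevelSubmanifold {Ec : Type*} [NormedAddCommGroup Ec] [NormedSpace ℝ Ec]
    (μ : Fin 3 → M → (L →L[ℝ] ℝ)) (c : Fin 3 → (L →L[ℝ] ℝ))
    [ChartedSpace Ec (levelSet μ c)] : Prop where
  embedding : Manifold.IsSmoothEmbedding 𝓘(ℝ, Ec) 𝓘(ℝ, E) ∞ (Subtype.val : levelSet μ c → M)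
  tangent : ∀ (x : levelSet μ c) (v : TangentSpace 𝓘(ℝ, E) (x : M)),
    (∃ u : TangentSpace 𝓘(ℝ, Ec) x,
      mfderiv 𝓘(ℝ, Ec) 𝓘(ℝ, E) (Subtype.val : levelSet μ c → M) x u = v) ↔
    ∀ i, mvfderiv 𝓘(ℝ, E) (μ i) (x : M) v = 0

/-! ## The quotient -/

variable (G) in
/-- The space of orbits `μ⁻¹(c) / G` (with the quotient topology). -/
abbrev Quo (μ : Fin 3 → M → (L →L[ℝ] ℝ)) (c : Fin 3 → (L →L[ℝ] ℝ)) : Type _ :=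
  Quotient ((MulAction.orbitRel G M).comap (Subtype.val : levelSet μ c → M))

variable (G) in
/-- The projection `μ⁻¹(c) → μ⁻¹(c) / G`. -/
def proj (μ : Fin 3 → M → (L →L[ℝ] ℝ)) (c : Fin 3 → (L →L[ℝ] ℝ)) (x : levelSet μ c) :
    Quo G μ c :=
  Quotient.mk _ x

variable (L G) in
/-- `v` is orthogonal to the directions `ρ̌ₘ`. -/
def IsHorizontal (g : BilinField E M) {m : M} (v : TangentSpace 𝓘(ℝ, E) m) : Prop :=
  ∀ ρ : L, g m v (fund L G E m ρ) = 0

variable (L G) in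
/-- `v` is orthogonal to the quaternionic span of the directions `ρ̌ₘ`. -/
def IsQuatHorizontal (g : BilinField E M) (J : Fin 3 → EndoField E M) {m : M}
    (v : TangentSpace 𝓘(ℝ, E) m) : Prop :=
  (∀ ρ : L, g m v (fund L G E m ρ) = 0) ∧
    ∀ (i : Fin 3) (ρ : L), g m v (J i m (fund L G E m ρ)) = 0

/-- The manifold structure and the metric `gQ` of the quotient `Q = μ⁻¹(c) / G` are the quotient
ones: the projection `μ⁻¹(c) → Q` is a smooth submersion and a Riemannian submersion, i.e. its
derivative preserves scalar products of vectors of `T_m M_c` that are orthogonal to the orbit. -/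
structure IsQuotientStructure {Ec : Type*} [NormedAddCommGroup Ec] [NormedSpace ℝ Ec]
    {EQ : Type*} [NormedAddCommGroup EQ] [NormedSpace ℝ EQ]
    (G : Type*) [TopologicalSpace G] [ChartedSpace L G] [Group G] [MulAction G M]
    (g : BilinField E M) (μ : Fin 3 → M → (L →L[ℝ] ℝ)) (c : Fin 3 → (L →L[ℝ] ℝ))
    [ChartedSpace Ec (levelSet μ c)] [ChartedSpace EQ (Quo G μ c)]
    [IsManifold 𝓘(ℝ, EQ) ∞ (Quo G μ c)]
    (gQ : BilinField EQ (Quo G μ c)) : Prop where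
  submersion : Manifold.IsSubmersion 𝓘(ℝ, Ec) 𝓘(ℝ, EQ) ∞ (proj G μ c)
  isWeakMetric : IsWeakMetric gQ
  riemannian : ∀ (x : levelSet μ c) (u v : TangentSpace 𝓘(ℝ, Ec) x),
    IsHorizontal L G g (mfderiv 𝓘(ℝ, Ec) 𝓘(ℝ, E) (Subtype.val : levelSet μ c → M) x u) →
    IsHorizontal L G g (mfderiv 𝓘(ℝ, Ec) 𝓘(ℝ, E) (Subtype.val : levelSet μ c → M) x v) →
      gQ (proj G μ c x) (mfderiv 𝓘(ℝ, Ec) 𝓘(ℝ, EQ) (proj G μ c) x u)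
          (mfderiv 𝓘(ℝ, Ec) 𝓘(ℝ, EQ) (proj G μ c) x v) =
        g x (mfderiv 𝓘(ℝ, Ec) 𝓘(ℝ, E) (Subtype.val : levelSet μ c → M) x u)
          (mfderiv 𝓘(ℝ, Ec) 𝓘(ℝ, E) (Subtype.val : levelSet μ c → M) x v)

/-! ## The O'Neill tensor -/

variable (L G) in
/-- `A(X, Y) = Z` at `m ∈ S`, where `S` is the level set: `Z` is the part of `∇_X Ỹ` tangent to the
orbit, for a local extension `Ỹ` of `Y` that is horizontal along `S`. -/
def IsONeill [IsManifold 𝓘(ℝ, E) ∞ M] (g : BilinField E M) (D : Connection E M) (S : Set M) (m : M)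
    (X Y Z : TangentSpace 𝓘(ℝ, E) m) : Prop :=
  ∃ Yt : (x : M) → TangentSpace 𝓘(ℝ, E) x,
    SmoothFieldAt Yt m ∧ Yt m = Y ∧ (∀ᶠ x in 𝓝[S] m, IsHorizontal L G g (Yt x)) ∧
    Z ∈ Set.range (fund L G E m) ∧ IsHorizontal L G g (D Yt m X - Z)

variable (L G) in
/-- `V(m)`: the (possibly infinite) norm of the tensor `A` on the orthogonal complement of the
quaternionic span of the orbit directions. -/
def oneillNorm [IsManifold 𝓘(ℝ, E) ∞ M] (g : BilinField E M) (D : Connection E M)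
    (J : Fin 3 → EndoField E M) (S : Set M) (m : M) : ℝ≥0∞ :=
  ⨆ (X : TangentSpace 𝓘(ℝ, E) m) (Y : TangentSpace 𝓘(ℝ, E) m) (Z : TangentSpace 𝓘(ℝ, E) m)
    (_ : IsQuatHorizontal L G g J X ∧ X ≠ 0) (_ : IsQuatHorizontal L G g J Y ∧ Y ≠ 0)
    (_ : IsONeill L G g D S m X Y Z), ENNReal.ofReal (len g Z / (len g X * len g Y))

end Action

end

end HKQuot

/-! Vectors of `T_p Q` lift to `H_m`, the part of `T_m M_c` orthogonal to the orbit. For horizontal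
lifts of fields `X`, `Y` of the quotient, the derivative `∇_X Y` upstairs is the lift of the
derivative on `Q`, plus a vector `z` tangent to the orbit, minus a sum `∑ J i (y i)` with `y i`
tangent to the orbit. Here `z = A(X, Y)`, and since `J i` is parallel and preserves `H_m`,
`y i = A(X, J i Y)`; so all four vectors have length at most `V(m) |X| |Y|`. The O'Neill equation
for `M_c → Q` and the Gauss equation for `M_c ⊂ M` express the difference of the two sectional
curvatures, on an orthonormal pair, as
`3 |z(X, Y)|² + ∑ i, (⟨y i (X, X), y i (Y, Y)⟩ - |y i (X, Y)|²)`,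
which is at most `3 V² + 3 * 2 V² = 9 V²`.

A weak metric is not an isomorphism of the tangent space with its dual, so orthogonal projections
need not exist in general. They do exist here: ellipticity splits the tangent space along the orbit,
and the differentials of the moment maps split off its images under the `J i`. Only the
lowered tensor `g(R(X, Y) Y, X)` enters, so that in charts Christoffel symbols of the first kind are
the ones to differentiate. -/

namespace HKQuot

namespace MultilinearInstances

/-! Without these shortcuts, the instances on spaces of multilinear maps are too slow to find. -/

variable {E : Type*} [NormedAddCommGroup E] [NormedSpace ℝ E]

noncomputable scoped instance : NormedAddCommGroup (E →L[ℝ] ℝ) := inferInstance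
noncomputable scoped instance : NormedSpace ℝ (E →L[ℝ] ℝ) := inferInstance
noncomputable scoped instance : NormedAddCommGroup (E →L[ℝ] E →L[ℝ] ℝ) := inferInstance
noncomputable scoped instance : NormedSpace ℝ (E →L[ℝ] E →L[ℝ] ℝ) := inferInstance
noncomputable scoped instance : NormedAddCommGroup (E →L[ℝ] E →L[ℝ] E →L[ℝ] ℝ) := inferInstance
noncomputable scoped instance : NormedSpace ℝ (E →L[ℝ] E →L[ℝ] E →L[ℝ] ℝ) := inferInstance

end MultilinearInstances

section LocalCalculus

open scoped MultilinearInstances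

variable {E : Type*} [NormedAddCommGroup E] [NormedSpace ℝ E]
  {W : Type*} [NormedAddCommGroup W] [NormedSpace ℝ W]

theorem fderiv_bilinear_comp {g : E → E →L[ℝ] E →L[ℝ] ℝ} {f σ τ : W → E} {x : W}
    (hg : DifferentiableAt ℝ g (f x)) (hf : DifferentiableAt ℝ f x)
    (hσ : DifferentiableAt ℝ σ x) (hτ : DifferentiableAt ℝ τ x) (a : W) :
    fderiv ℝ (fun y ↦ g (f y) (σ y) (τ y)) x a =
      fderiv ℝ g (f x) (fderiv ℝ f x a) (σ x) (τ x) + g (f x) (fderiv ℝ σ x a) (τ x)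
        + g (f x) (σ x) (fderiv ℝ τ x a) := by
  have h : HasFDerivAt (fun y ↦ g (f y) (σ y) (τ y)) _ x :=
    ((hg.hasFDerivAt.comp x hf.hasFDerivAt).clm_apply hσ.hasFDerivAt).clm_apply hτ.hasFDerivAt
  rw [h.fderiv]
  simp only [Function.comp_apply, add_apply, ContinuousLinearMap.comp_apply,
    ContinuousLinearMap.flip_apply]
  ring

theorem fderiv_trilinear_comp {T : E → E →L[ℝ] E →L[ℝ] E →L[ℝ] ℝ} {f ρ σ τ : W → E} {x : W}
    (hT : DifferentiableAt ℝ T (f x)) (hf : DifferentiableAt ℝ f x)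
    (hρ : DifferentiableAt ℝ ρ x) (hσ : DifferentiableAt ℝ σ x) (hτ : DifferentiableAt ℝ τ x)
    (a : W) :
    fderiv ℝ (fun y ↦ T (f y) (ρ y) (σ y) (τ y)) x a =
      fderiv ℝ T (f x) (fderiv ℝ f x a) (ρ x) (σ x) (τ x) + T (f x) (fderiv ℝ ρ x a) (σ x) (τ x)
        + T (f x) (ρ x) (fderiv ℝ σ x a) (τ x) + T (f x) (ρ x) (σ x) (fderiv ℝ τ x a) := by
  have h : HasFDerivAt (fun y ↦ T (f y) (ρ y) (σ y) (τ y)) _ x :=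
    (((hT.hasFDerivAt.comp x hf.hasFDerivAt).clm_apply hρ.hasFDerivAt).clm_apply
      hσ.hasFDerivAt).clm_apply hτ.hasFDerivAt
  rw [h.fderiv]
  simp only [Function.comp_apply, add_apply, ContinuousLinearMap.comp_apply,
    ContinuousLinearMap.flip_apply]
  ring

theorem fderiv_symm_of_eventually {g : E → E →L[ℝ] E →L[ℝ] ℝ} {y : E}
    (hg : DifferentiableAt ℝ g y) (hs : ∀ᶠ z in 𝓝 y, ∀ v w, g z v w = g z w v) (a v w : E) :
    fderiv ℝ g y a v w = fderiv ℝ g y a w v := by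
  have apply_fderiv (v w : E) : fderiv ℝ (fun z ↦ g z v w) y a = fderiv ℝ g y a v w := by
    simp [fderiv_bilinear_comp (f := fun z : E ↦ z) (σ := fun _ ↦ v) (τ := fun _ ↦ w) hg]
  rw [← apply_fderiv v w, ← apply_fderiv w v,
    EventuallyEq.fderiv_eq (hs.mono fun z hz ↦ hz v w)]

variable (E) in
/-- The combination `(v, w, z) ↦ (T v w z + T w v z - T z v w) / 2` of the arguments of a trilinear
form that appears in the Koszul formula, as an operator on trilinear forms. -/
noncomputable def koszulOperator :
    (E →L[ℝ] E →L[ℝ] E →L[ℝ] ℝ) →L[ℝ] (E →L[ℝ] E →L[ℝ] E →L[ℝ] ℝ) :=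
  let swap₁₂ :=
    (ContinuousLinearMap.flipₗᵢ ℝ E E (E →L[ℝ] ℝ)).toContinuousLinearEquiv.toContinuousLinearMap
  let swap₂₃ := ContinuousLinearMap.compL ℝ E (E →L[ℝ] E →L[ℝ] ℝ) (E →L[ℝ] E →L[ℝ] ℝ)
    (ContinuousLinearMap.flipₗᵢ ℝ E E ℝ).toContinuousLinearEquiv.toContinuousLinearMap
  (2⁻¹ : ℝ) • (ContinuousLinearMap.id ℝ _ + swap₁₂ - swap₂₃ ∘L swap₁₂)

/-- The Christoffel symbols of the first kind of `g` at `y`: the trilinear form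
`(v, w, z) ↦ g (Γ v w) z`, where `Γ` are the Christoffel symbols. -/
noncomputable def christoffelFirst (g : E → E →L[ℝ] E →L[ℝ] ℝ) (y : E) :
    E →L[ℝ] E →L[ℝ] E →L[ℝ] ℝ :=
  koszulOperator E (fderiv ℝ g y)

theorem christoffelFirst_apply (g : E → E →L[ℝ] E →L[ℝ] ℝ) (y v w z : E) :
    christoffelFirst g y v w z =
      (fderiv ℝ g y v w z + fderiv ℝ g y w v z - fderiv ℝ g y z v w) / 2 := by
  simp [christoffelFirst, koszulOperator]
  ring

theorem differentiableAt_christoffelFirst {g : E → E →L[ℝ] E →L[ℝ] ℝ} {y : E}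
    (hg : ContDiffAt ℝ 2 g y) : DifferentiableAt ℝ (christoffelFirst g) y :=
  (koszulOperator E).differentiableAt.comp y
    ((hg.fderiv_right (m := 1) (by norm_num)).differentiableAt (by norm_num))

theorem christoffelFirst_comm {g : E → E →L[ℝ] E →L[ℝ] ℝ} {y : E}
    (hs : ∀ a v w, fderiv ℝ g y a v w = fderiv ℝ g y a w v) (v w z : E) :
    christoffelFirst g y v w z = christoffelFirst g y w v z := by
  simp only [christoffelFirst_apply, hs z v w]; ring

theorem christoffelFirst_add_swap {g : E → E →L[ℝ] E →L[ℝ] ℝ} {y : E}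
    (hs : ∀ a v w, fderiv ℝ g y a v w = fderiv ℝ g y a w v) (v w z : E) :
    christoffelFirst g y v w z + christoffelFirst g y v z w = fderiv ℝ g y v w z := by
  simp only [christoffelFirst_apply, hs w v z, hs z v w, hs v z w]; ring

/-- `Γ` are Christoffel symbols (of the second kind) of `g` at `y`. For a weak metric `g` they
need not exist. -/
def IsChristoffelAt (g : E → E →L[ℝ] E →L[ℝ] ℝ) (y : E) (Γ : E → E → E) : Prop :=
  ∀ v w z, g y (Γ v w) z = christoffelFirst g y v w z

/-- The curvature form `g (R(a, b) c, d)` at `y`, where `Γ` are the Christoffel symbols of `g`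
at `y`. -/
noncomputable def curvatureForm (g : E → E →L[ℝ] E →L[ℝ] ℝ) (y : E) (Γ : E → E → E)
    (a b c d : E) : ℝ :=
  fderiv ℝ (christoffelFirst g) y a b c d - fderiv ℝ (christoffelFirst g) y b a c d
    - g y (Γ b c) (Γ a d) + g y (Γ a c) (Γ b d)

/-- The covariant derivative along a map `f : W → E` of a field `σ` along `f`, where `Γ` are the
Christoffel symbols at `f x`. -/
noncomputable def covDerivAlong (f : W → E) (Γ : E → E → E) (σ : W → E) (x a : W) : E :=
  fderiv ℝ σ x a + Γ (fderiv ℝ f x a) (σ x)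

/-- The form `(a, z) ↦ g (∇_a σ) z` for a field `σ` along a map `f : W → E`. Unlike
`covDerivAlong`, it does not involve a choice of Christoffel symbols of the second kind. -/
noncomputable def covPairing (g : E → E →L[ℝ] E →L[ℝ] ℝ) (f σ : W → E) (x : W) :
    W →L[ℝ] E →L[ℝ] ℝ :=
  g (f x) ∘L fderiv ℝ σ x + (christoffelFirst g (f x)).flip (σ x) ∘L fderiv ℝ f x

theorem covPairing_apply (g : E → E →L[ℝ] E →L[ℝ] ℝ) (f σ : W → E) (x a : W) (z : E) :
    covPairing g f σ x a z =
      g (f x) (fderiv ℝ σ x a) z + christoffelFirst g (f x) (fderiv ℝ f x a) (σ x) z := rfl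

theorem IsChristoffelAt.apply_covDerivAlong {g : E → E →L[ℝ] E →L[ℝ] ℝ} {f : W → E} {x : W}
    {Γ : E → E → E} (hΓ : IsChristoffelAt g (f x) Γ) (σ : W → E) (a : W) (z : E) :
    g (f x) (covDerivAlong f Γ σ x a) z = covPairing g f σ x a z := by
  rw [covDerivAlong, map_add, add_apply, hΓ, covPairing_apply]

theorem fderiv_metric_along {g : E → E →L[ℝ] E →L[ℝ] ℝ} {f σ τ : W → E} {x : W}
    (hg : DifferentiableAt ℝ g (f x)) (hs : ∀ᶠ y in 𝓝 (f x), ∀ v w, g y v w = g y w v)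
    (hf : DifferentiableAt ℝ f x) (hσ : DifferentiableAt ℝ σ x) (hτ : DifferentiableAt ℝ τ x)
    (a : W) :
    fderiv ℝ (fun y ↦ g (f y) (σ y) (τ y)) x a =
      covPairing g f σ x a (τ x) + covPairing g f τ x a (σ x) := by
  rw [fderiv_bilinear_comp hg hf hσ hτ, covPairing_apply, covPairing_apply,
    hs.self_of_nhds (fderiv ℝ τ x a),
    ← christoffelFirst_add_swap (fderiv_symm_of_eventually hg hs)]
  ring

theorem covPairing_congr {g : E → E →L[ℝ] E →L[ℝ] ℝ} {f σ τ : W → E} {x : W}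
    (h : σ =ᶠ[𝓝 x] τ) : covPairing g f σ x = covPairing g f τ x := by
  rw [covPairing, covPairing, h.fderiv_eq, h.eq_of_nhds]

theorem covPairing_const (g : E → E →L[ℝ] E →L[ℝ] ℝ) (f : W → E) (v : E) (x a : W) (z : E) :
    covPairing g f (fun _ ↦ v) x a z = christoffelFirst g (f x) (fderiv ℝ f x a) v z := by
  simp [covPairing_apply]

theorem fderiv_lieBracket {f : W → E} {a b : W → W} {x : W} (hf : ContDiffAt ℝ 2 f x)
    (ha : DifferentiableAt ℝ a x) (hb : DifferentiableAt ℝ b x) :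
    fderiv ℝ f x (VectorField.lieBracket ℝ a b x) =
      fderiv ℝ (fun y ↦ fderiv ℝ f y (b y)) x (a x)
        - fderiv ℝ (fun y ↦ fderiv ℝ f y (a y)) x (b x) := by
  have hf' : DifferentiableAt ℝ (fderiv ℝ f) x :=
    (hf.fderiv_right (m := 1) (by norm_num)).differentiableAt (by norm_num)
  rw [(hf'.hasFDerivAt.clm_apply hb.hasFDerivAt).fderiv,
    (hf'.hasFDerivAt.clm_apply ha.hasFDerivAt).fderiv, VectorField.lieBracket, map_sub]
  simp only [add_apply, ContinuousLinearMap.comp_apply, ContinuousLinearMap.flip_apply,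
    (hf.isSymmSndFDerivAt (by simp)) (a x) (b x)]
  abel

theorem covPairing_torsionFree {g : E → E →L[ℝ] E →L[ℝ] ℝ} {f : W → E} {a b : W → W} {x : W}
    (hg : DifferentiableAt ℝ g (f x)) (hs : ∀ᶠ y in 𝓝 (f x), ∀ v w, g y v w = g y w v)
    (hf : ContDiffAt ℝ 2 f x) (ha : DifferentiableAt ℝ a x) (hb : DifferentiableAt ℝ b x)
    (z : E) :
    covPairing g f (fun y ↦ fderiv ℝ f y (b y)) x (a x) z
        - covPairing g f (fun y ↦ fderiv ℝ f y (a y)) x (b x) z =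
      g (f x) (fderiv ℝ f x (VectorField.lieBracket ℝ a b x)) z := by
  rw [fderiv_lieBracket hf ha hb, covPairing_apply, covPairing_apply, map_sub, sub_apply,
    christoffelFirst_comm (fderiv_symm_of_eventually hg hs) (fderiv ℝ f x (a x))]
  ring

theorem fderiv_covPairing {g : E → E →L[ℝ] E →L[ℝ] ℝ} {f σ τ : W → E} {b : W → W} {x : W}
    (hg : ContDiffAt ℝ 2 g (f x)) (hf : ContDiffAt ℝ 2 f x) (hσ : ContDiffAt ℝ 2 σ x)
    (hτ : DifferentiableAt ℝ τ x) (hb : DifferentiableAt ℝ b x) (a : W) :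
    fderiv ℝ (fun y ↦ covPairing g f σ y (b y) (τ y)) x a =
      covPairing g f σ x (fderiv ℝ b x a) (τ x) + covPairing g f σ x (b x) (fderiv ℝ τ x a)
      + (fderiv ℝ g (f x) (fderiv ℝ f x a) (fderiv ℝ σ x (b x)) (τ x)
        + g (f x) (fderiv ℝ (fderiv ℝ σ) x a (b x)) (τ x))
      + (fderiv ℝ (christoffelFirst g) (f x) (fderiv ℝ f x a) (fderiv ℝ f x (b x)) (σ x) (τ x)
        + christoffelFirst g (f x) (fderiv ℝ (fderiv ℝ f) x a (b x)) (σ x) (τ x)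
        + christoffelFirst g (f x) (fderiv ℝ f x (b x)) (fderiv ℝ σ x a) (τ x)) := by
  have hgd : DifferentiableAt ℝ g (f x) := hg.differentiableAt (by norm_num)
  have hfd : DifferentiableAt ℝ f x := hf.differentiableAt (by norm_num)
  have hσd : DifferentiableAt ℝ σ x := hσ.differentiableAt (by norm_num)
  have hf' : DifferentiableAt ℝ (fderiv ℝ f) x :=
    (hf.fderiv_right (m := 1) (by norm_num)).differentiableAt (by norm_num)
  have hσ' : DifferentiableAt ℝ (fderiv ℝ σ) x :=
    (hσ.fderiv_right (m := 1) (by norm_num)).differentiableAt (by norm_num)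
  have hΓ := differentiableAt_christoffelFirst hg
  have hσb := hσ'.hasFDerivAt.clm_apply hb.hasFDerivAt
  have hfb := hf'.hasFDerivAt.clm_apply hb.hasFDerivAt
  have metric_part := fderiv_bilinear_comp hgd hfd hσb.differentiableAt hτ a
  have christoffel_part := fderiv_trilinear_comp hΓ hfd hfb.differentiableAt hσd hτ a
  have metric_diff : DifferentiableAt ℝ (fun y ↦ g (f y) (fderiv ℝ σ y (b y)) (τ y)) x := by
    have := hgd.comp x hfd
    fun_prop
  have christoffel_diff : DifferentiableAt ℝ
      (fun y ↦ christoffelFirst g (f y) (fderiv ℝ f y (b y)) (σ y) (τ y)) x := by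
    have := hΓ.comp x hfd
    fun_prop
  simp only [covPairing_apply]
  rw [fderiv_fun_add metric_diff christoffel_diff, add_apply, metric_part, christoffel_part,
    hσb.fderiv, hfb.fderiv]
  simp only [add_apply, ContinuousLinearMap.comp_apply, ContinuousLinearMap.flip_apply, map_add]
  ring

theorem curvatureForm_along {g : E → E →L[ℝ] E →L[ℝ] ℝ} {f σ τ : W → E} {a b : W → W} {x : W}
    {Γ : E → E → E} (hg : ContDiffAt ℝ 2 g (f x))
    (hs : ∀ᶠ y in 𝓝 (f x), ∀ v w, g y v w = g y w v) (hΓ : IsChristoffelAt g (f x) Γ)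
    (hf : ContDiffAt ℝ 2 f x) (hσ : ContDiffAt ℝ 2 σ x) (hτ : DifferentiableAt ℝ τ x)
    (ha : DifferentiableAt ℝ a x) (hb : DifferentiableAt ℝ b x) :
    curvatureForm g (f x) Γ (fderiv ℝ f x (a x)) (fderiv ℝ f x (b x)) (σ x) (τ x) =
      fderiv ℝ (fun y ↦ covPairing g f σ y (b y) (τ y)) x (a x)
      - fderiv ℝ (fun y ↦ covPairing g f σ y (a y) (τ y)) x (b x)
      - g (f x) (covDerivAlong f Γ σ x (b x)) (covDerivAlong f Γ τ x (a x))
      + g (f x) (covDerivAlong f Γ σ x (a x)) (covDerivAlong f Γ τ x (b x))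
      - covPairing g f σ x (VectorField.lieBracket ℝ a b x) (τ x) := by
  have hD := fderiv_symm_of_eventually (hg.differentiableAt (by norm_num)) hs
  have expand (c d : W) : g (f x) (covDerivAlong f Γ σ x c) (covDerivAlong f Γ τ x d) =
      covPairing g f σ x c (fderiv ℝ τ x d)
        + christoffelFirst g (f x) (fderiv ℝ f x d) (τ x) (fderiv ℝ σ x c)
        + g (f x) (Γ (fderiv ℝ f x c) (σ x)) (Γ (fderiv ℝ f x d) (τ x)) := by
    rw [← hΓ, hs.self_of_nhds (Γ (fderiv ℝ f x d) (τ x)), covDerivAlong, covDerivAlong,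
      covPairing_apply, ← hΓ]
    simp only [map_add, add_apply]
    ring
  rw [fderiv_covPairing hg hf hσ hτ hb, fderiv_covPairing hg hf hσ hτ ha, expand, expand,
    (hf.isSymmSndFDerivAt (by simp)) (a x) (b x), (hσ.isSymmSndFDerivAt (by simp)) (a x) (b x),
    VectorField.lieBracket, map_sub, sub_apply, curvatureForm,
    ← christoffelFirst_add_swap hD (fderiv ℝ f x (a x)) (fderiv ℝ σ x (b x)),
    ← christoffelFirst_add_swap hD (fderiv ℝ f x (b x)) (fderiv ℝ σ x (a x))]
  ring

theorem curvatureForm_self_left (g : E → E →L[ℝ] E →L[ℝ] ℝ) (y : E) (Γ : E → E → E) (a c d : E) :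
    curvatureForm g y Γ a a c d = 0 := by
  simp [curvatureForm]

end LocalCalculus

section LocalQuotient

open scoped MultilinearInstances

variable {E : Type*} [NormedAddCommGroup E] [NormedSpace ℝ E]
  {W : Type*} [NormedAddCommGroup W] [NormedSpace ℝ W]
  {B : Type*} [NormedAddCommGroup B] [NormedSpace ℝ B]

theorem eq_zero_of_symm_of_skew {α : Type*} {T : α → α → α → ℝ}
    (symm : ∀ x y z, T x y z = T y x z) (skew : ∀ x y z, T x y z = -T x z y) (x y z : α) :
    T x y z = 0 := by
  linarith [symm x y z, skew y x z, symm y z x, skew z y x, symm z x y, skew x z y]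

theorem eq_of_forall_apply_eq {G : E →L[ℝ] E →L[ℝ] ℝ} (hG : ∀ v, v ≠ 0 → 0 < G v v) {v w : E}
    (h : ∀ z, G v z = G w z) : v = w := by
  by_contra hne
  refine (hG (v - w) (sub_ne_zero.2 hne)).ne' ?_
  rw [map_sub G, sub_apply, h, sub_self]

/-- Near `x`, the map `f : W → E` is a submanifold of the space `(E, g)`, `p : W → B` is a
Riemannian submersion onto `(B, q)` for the metric induced on `W`, and `h` is its horizontal
lift. -/
structure IsLocalQuotient (g : E → E →L[ℝ] E →L[ℝ] ℝ) (q : B → B →L[ℝ] B →L[ℝ] ℝ)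
    (f : W → E) (p : W → B) (h : W → B →L[ℝ] W) (x : W) : Prop where
  contDiff_metric : ContDiffAt ℝ 2 g (f x)
  contDiff_base : ContDiffAt ℝ 2 q (p x)
  contDiff_map : ContDiffAt ℝ 3 f x
  contDiff_proj : ContDiffAt ℝ 2 p x
  contDiff_lift : ContDiffAt ℝ 2 h x
  symm_metric : ∀ᶠ y in 𝓝 (f x), ∀ v w, g y v w = g y w v
  symm_base : ∀ᶠ y in 𝓝 (p x), ∀ v w, q y v w = q y w v
  proj_lift : ∀ᶠ y in 𝓝 x, ∀ X, fderiv ℝ p y (h y X) = X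
  metric_lift : ∀ᶠ y in 𝓝 x, ∀ X w,
    g (f y) (fderiv ℝ f y (h y X)) (fderiv ℝ f y w) = q (p y) X (fderiv ℝ p y w)

/-- The horizontal lift of the constant vector field `X`, as a field along `f`. -/
noncomputable def horizontalLift (f : W → E) (h : W → B →L[ℝ] W) (X : B) (y : W) : E :=
  fderiv ℝ f y (h y X)

/-- The covariant derivative `∇_X Y` of horizontal lifts. -/
noncomputable def covDerivLift (f : W → E) (h : W → B →L[ℝ] W) (Γ : E → E → E) (x : W)
    (X Y : B) : E :=
  covDerivAlong f Γ (horizontalLift f h Y) x (h x X)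

namespace IsLocalQuotient

variable {g : E → E →L[ℝ] E →L[ℝ] ℝ} {q : B → B →L[ℝ] B →L[ℝ] ℝ}
  {f : W → E} {p : W → B} {h : W → B →L[ℝ] W} {x : W}

protected theorem eventually (H : IsLocalQuotient g q f p h x) :
    ∀ᶠ y in 𝓝 x, IsLocalQuotient g q f p h y := by
  have cf := H.contDiff_map.continuousAt
  have cp := H.contDiff_proj.continuousAt
  filter_upwards [cf.eventually (H.contDiff_metric.eventually (by simp)),
    cp.eventually (H.contDiff_base.eventually (by simp)), H.contDiff_map.eventually (by simp),
    H.contDiff_proj.eventually (by simp), H.contDiff_lift.eventually (by simp),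
    cf.eventually H.symm_metric.eventually_nhds, cp.eventually H.symm_base.eventually_nhds,
    H.proj_lift.eventually_nhds, H.metric_lift.eventually_nhds] with y h1 h2 h3 h4 h5 h6 h7 h8 h9
  exact ⟨h1, h2, h3, h4, h5, h6, h7, h8, h9⟩

theorem differentiableAt_metric (H : IsLocalQuotient g q f p h x) : DifferentiableAt ℝ g (f x) :=
  H.contDiff_metric.differentiableAt (by norm_num)

theorem differentiableAt_base (H : IsLocalQuotient g q f p h x) : DifferentiableAt ℝ q (p x) :=
  H.contDiff_base.differentiableAt (by norm_num)

theorem differentiableAt_map (H : IsLocalQuotient g q f p h x) : DifferentiableAt ℝ f x :=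
  H.contDiff_map.differentiableAt (by norm_num)

theorem differentiableAt_proj (H : IsLocalQuotient g q f p h x) : DifferentiableAt ℝ p x :=
  H.contDiff_proj.differentiableAt (by norm_num)

theorem contDiffAt_map_two (H : IsLocalQuotient g q f p h x) : ContDiffAt ℝ 2 f x :=
  H.contDiff_map.of_le (by norm_num)

theorem differentiableAt_lift (H : IsLocalQuotient g q f p h x) (X : B) :
    DifferentiableAt ℝ (fun y ↦ h y X) x :=
  (H.contDiff_lift.clm_apply contDiffAt_const).differentiableAt (by norm_num)

theorem contDiffAt_horizontalLift (H : IsLocalQuotient g q f p h x) (X : B) :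
    ContDiffAt ℝ 2 (horizontalLift f h X) x :=
  (H.contDiff_map.fderiv_right (m := 2) (by norm_num)).clm_apply
    (H.contDiff_lift.clm_apply contDiffAt_const)

theorem differentiableAt_horizontalLift (H : IsLocalQuotient g q f p h x) (X : B) :
    DifferentiableAt ℝ (horizontalLift f h X) x :=
  (H.contDiffAt_horizontalLift X).differentiableAt (by norm_num)

theorem metric_horizontalLift (H : IsLocalQuotient g q f p h x) (X Y : B) :
    g (f x) (horizontalLift f h X x) (horizontalLift f h Y x) = q (p x) X Y := by
  rw [horizontalLift, horizontalLift, H.metric_lift.self_of_nhds, H.proj_lift.self_of_nhds]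

theorem metric_horizontalLift_vertical (H : IsLocalQuotient g q f p h x) (X : B) {k : W}
    (hk : fderiv ℝ p x k = 0) : g (f x) (horizontalLift f h X x) (fderiv ℝ f x k) = 0 := by
  rw [horizontalLift, H.metric_lift.self_of_nhds, hk, map_zero]

theorem fderiv_proj_bracket (H : IsLocalQuotient g q f p h x) (X Y : B) :
    fderiv ℝ p x (VectorField.lieBracket ℝ (fun y ↦ h y X) (fun y ↦ h y Y) x) = 0 := by
  have constant (Z : B) : fderiv ℝ (fun y ↦ fderiv ℝ p y (h y Z)) x = 0 := by
    rw [EventuallyEq.fderiv_eq (H.proj_lift.mono fun y hy ↦ hy Z), fderiv_fun_const, Pi.zero_apply]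
  rw [fderiv_lieBracket H.contDiff_proj (H.differentiableAt_lift X) (H.differentiableAt_lift Y),
    constant, constant, zero_apply, zero_apply, sub_zero]

theorem covPairing_lift_add_swap (H : IsLocalQuotient g q f p h x) (X Y : B) (a : W) :
    covPairing g f (horizontalLift f h X) x a (horizontalLift f h Y x)
        + covPairing g f (horizontalLift f h Y) x a (horizontalLift f h X x) =
      christoffelFirst q (p x) (fderiv ℝ p x a) X Y
        + christoffelFirst q (p x) (fderiv ℝ p x a) Y X := by
  rw [← fderiv_metric_along H.differentiableAt_metric H.symm_metric H.differentiableAt_map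
      (H.differentiableAt_horizontalLift X) (H.differentiableAt_horizontalLift Y),
    EventuallyEq.fderiv_eq (H.eventually.mono fun y hy ↦ hy.metric_horizontalLift X Y),
    fderiv_metric_along H.differentiableAt_base H.symm_base H.differentiableAt_proj
      (differentiableAt_const X) (differentiableAt_const Y), covPairing_const, covPairing_const]

theorem covPairing_lift_lift (H : IsLocalQuotient g q f p h x) (X Y Z : B) :
    covPairing g f (horizontalLift f h Y) x (h x X) (horizontalLift f h Z x) =
      christoffelFirst q (p x) X Y Z := by
  refine sub_eq_zero.1 (eq_zero_of_symm_of_skew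
    (T := fun X Y Z ↦ covPairing g f (horizontalLift f h Y) x (h x X) (horizontalLift f h Z x)
      - christoffelFirst q (p x) X Y Z) (fun X Y Z ↦ ?_) (fun X Y Z ↦ ?_) X Y Z)
  · have torsion := covPairing_torsionFree H.differentiableAt_metric H.symm_metric
      H.contDiffAt_map_two (H.differentiableAt_lift X) (H.differentiableAt_lift Y)
      (horizontalLift f h Z x)
    rw [H.symm_metric.self_of_nhds, H.metric_horizontalLift_vertical Z (H.fderiv_proj_bracket X Y),
      sub_eq_zero] at torsion
    congr 1
    exact christoffelFirst_comm
      (fderiv_symm_of_eventually H.differentiableAt_base H.symm_base) X Y Z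
  · have compat := H.covPairing_lift_add_swap Y Z (h x X)
    rw [H.proj_lift.self_of_nhds] at compat
    linarith

theorem covPairing_lift_vertical (H : IsLocalQuotient g q f p h x) (X Y : B) {k : W}
    (hk : fderiv ℝ p x k = 0) :
    covPairing g f (horizontalLift f h X) x (h x Y) (fderiv ℝ f x k) =
      -covPairing g f (horizontalLift f h Y) x k (horizontalLift f h X x) := by
  have dk : DifferentiableAt ℝ (fun _ : W ↦ k) x := differentiableAt_const k
  have df : DifferentiableAt ℝ (fun y ↦ fderiv ℝ f y k) x :=
    ((H.contDiff_map.fderiv_right (m := 2) (by norm_num)).differentiableAt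
      (by norm_num)).clm_apply dk
  have dp : DifferentiableAt ℝ (fun y ↦ fderiv ℝ p y k) x :=
    ((H.contDiff_proj.fderiv_right (m := 1) (by norm_num)).differentiableAt
      (by norm_num)).clm_apply dk
  have compat : fderiv ℝ (fun y ↦ g (f y) (horizontalLift f h X y) (fderiv ℝ f y k)) x (h x Y) =
      fderiv ℝ (fun y ↦ q (p y) X (fderiv ℝ p y k)) x (h x Y) :=
    DFunLike.congr_fun (EventuallyEq.fderiv_eq (H.metric_lift.mono fun y hy ↦ hy X k)) (h x Y)
  rw [fderiv_metric_along H.differentiableAt_metric H.symm_metric H.differentiableAt_map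
      (H.differentiableAt_horizontalLift X) df,
    fderiv_metric_along H.differentiableAt_base H.symm_base H.differentiableAt_proj
      (differentiableAt_const X) dp, hk, map_zero, zero_add] at compat
  have torsion := covPairing_torsionFree H.differentiableAt_metric H.symm_metric
    H.contDiffAt_map_two (H.differentiableAt_lift Y) dk (horizontalLift f h X x)
  have torsion_base := covPairing_torsionFree H.differentiableAt_base H.symm_base
    H.contDiff_proj (H.differentiableAt_lift Y) dk X
  rw [covPairing_congr (σ := fun y ↦ fderiv ℝ p y (h y Y)) (H.proj_lift.mono fun y hy ↦ hy Y),
    covPairing_const, hk, map_zero, zero_apply, zero_apply, sub_zero] at torsion_base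
  rw [H.symm_metric.self_of_nhds, horizontalLift, H.metric_lift.self_of_nhds,
    H.symm_base.self_of_nhds, ← torsion_base, ← compat] at torsion
  unfold horizontalLift at *
  linarith

variable {Γ : E → E → E}

theorem covDerivLift_sub (H : IsLocalQuotient g q f p h x) (hΓ : IsChristoffelAt g (f x) Γ)
    (hpos : ∀ v, v ≠ 0 → 0 < g (f x) v v) (X Y : B) :
    covDerivLift f h Γ x X Y - covDerivLift f h Γ x Y X =
      fderiv ℝ f x (VectorField.lieBracket ℝ (fun y ↦ h y X) (fun y ↦ h y Y) x) := by
  refine eq_of_forall_apply_eq hpos fun z ↦ ?_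
  rw [map_sub, sub_apply, covDerivLift, covDerivLift, hΓ.apply_covDerivAlong,
    hΓ.apply_covDerivAlong]
  exact covPairing_torsionFree H.differentiableAt_metric H.symm_metric H.contDiffAt_map_two
    (H.differentiableAt_lift X) (H.differentiableAt_lift Y) z

theorem covDerivLift_skew_vertical (H : IsLocalQuotient g q f p h x)
    (hΓ : IsChristoffelAt g (f x) Γ) (X Y : B) {k : W} (hk : fderiv ℝ p x k = 0) :
    g (f x) (covDerivLift f h Γ x X Y + covDerivLift f h Γ x Y X) (fderiv ℝ f x k) = 0 := by
  have compat := H.covPairing_lift_add_swap X Y k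
  simp only [hk, map_zero, zero_apply, add_zero] at compat
  rw [map_add, add_apply, covDerivLift, covDerivLift, hΓ.apply_covDerivAlong,
    hΓ.apply_covDerivAlong, H.covPairing_lift_vertical X Y hk, H.covPairing_lift_vertical Y X hk]
  linarith

theorem fderiv_covPairing_lift (H : IsLocalQuotient g q f p h x) (X Y Z T : B) :
    fderiv ℝ (fun y ↦ covPairing g f (horizontalLift f h Y) y (h y X) (horizontalLift f h Z y)) x
      (h x T) = fderiv ℝ (christoffelFirst q) (p x) T X Y Z := by
  rw [EventuallyEq.fderiv_eq (H.eventually.mono fun y hy ↦ hy.covPairing_lift_lift X Y Z),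
    fderiv_trilinear_comp (differentiableAt_christoffelFirst H.contDiff_base)
      H.differentiableAt_proj (differentiableAt_const X) (differentiableAt_const Y)
      (differentiableAt_const Z), H.proj_lift.self_of_nhds]
  simp

theorem curvatureForm_lift (H : IsLocalQuotient g q f p h x) (hΓ : IsChristoffelAt g (f x) Γ)
    (hpos : ∀ v, v ≠ 0 → 0 < g (f x) v v) (X Y : B) :
    curvatureForm g (f x) Γ (horizontalLift f h X x) (horizontalLift f h Y x)
        (horizontalLift f h Y x) (horizontalLift f h X x) =
      fderiv ℝ (christoffelFirst q) (p x) X Y Y X - fderiv ℝ (christoffelFirst q) (p x) Y X Y X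
        - g (f x) (covDerivLift f h Γ x Y Y) (covDerivLift f h Γ x X X)
        + g (f x) (covDerivLift f h Γ x X Y) (covDerivLift f h Γ x Y X)
        + g (f x) (covDerivLift f h Γ x Y X)
            (covDerivLift f h Γ x X Y - covDerivLift f h Γ x Y X) := by
  have structure_eq := curvatureForm_along (a := fun y ↦ h y X) (b := fun y ↦ h y Y)
    H.contDiff_metric H.symm_metric hΓ H.contDiffAt_map_two (H.contDiffAt_horizontalLift Y)
    (H.differentiableAt_horizontalLift X) (H.differentiableAt_lift X) (H.differentiableAt_lift Y)
  rw [H.fderiv_covPairing_lift, H.fderiv_covPairing_lift] at structure_eq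
  have bracket_term := H.covPairing_lift_vertical X Y (H.fderiv_proj_bracket X Y)
  rw [← hΓ.apply_covDerivAlong, ← H.covDerivLift_sub hΓ hpos] at bracket_term
  unfold covDerivLift at bracket_term ⊢
  rw [bracket_term, ← sub_eq_add_neg]
  exact structure_eq

end IsLocalQuotient

end LocalQuotient

section CurvatureAlgebra

open scoped MultilinearInstances

variable {E : Type*} [NormedAddCommGroup E] [NormedSpace ℝ E]
  {g : E → E →L[ℝ] E →L[ℝ] ℝ} {y : E} {Γ : E → E → E}

theorem fderiv_christoffelFirst_apply (hg : ContDiffAt ℝ 2 g y) (a b c d : E) :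
    fderiv ℝ (christoffelFirst g) y a b c d =
      (fderiv ℝ (fderiv ℝ g) y a b c d + fderiv ℝ (fderiv ℝ g) y a c b d
        - fderiv ℝ (fderiv ℝ g) y a d b c) / 2 := by
  have hg' : DifferentiableAt ℝ (fderiv ℝ g) y :=
    (hg.fderiv_right (m := 1) (by norm_num)).differentiableAt (by norm_num)
  have h : HasFDerivAt (christoffelFirst g) (koszulOperator E ∘L fderiv ℝ (fderiv ℝ g) y) y :=
    (koszulOperator E).hasFDerivAt.comp y hg'.hasFDerivAt
  rw [h.fderiv]
  simp [koszulOperator]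
  ring

theorem curvatureForm_sub_smul_second (hs : ∀ v w, g y v w = g y w v)
    (hΓ : IsChristoffelAt g y Γ) (a b c d : E) (t : ℝ) :
    curvatureForm g y Γ a (b - t • a) c d = curvatureForm g y Γ a b c d := by
  have form_linear (b : E) : curvatureForm g y Γ a b c d =
      fderiv ℝ (christoffelFirst g) y a b c d - fderiv ℝ (christoffelFirst g) y b a c d
        - christoffelFirst g y b c (Γ a d) + christoffelFirst g y b d (Γ a c) := by
    rw [curvatureForm, hΓ, hs (Γ a c), hΓ]
  have form_self := curvatureForm_self_left g y Γ a c d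
  rw [form_linear] at form_self
  simp only [form_linear, map_sub, map_smul, sub_apply, smul_apply, smul_eq_mul]
  linear_combination -t * form_self

theorem curvatureForm_self_right (hg : ContDiffAt ℝ 2 g y) (hs : ∀ v w, g y v w = g y w v)
    (a b c : E) : curvatureForm g y Γ a b c c = 0 := by
  have second_symm := (hg.isSymmSndFDerivAt (by simp)) a b
  rw [curvatureForm, fderiv_christoffelFirst_apply hg, fderiv_christoffelFirst_apply hg,
    second_symm, hs (Γ a c)]
  ring

theorem curvatureForm_sub_smul (hg : ContDiffAt ℝ 2 g y) (hs : ∀ v w, g y v w = g y w v)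
    (hΓ : IsChristoffelAt g y Γ) (a b : E) (t : ℝ) :
    curvatureForm g y Γ a (b - t • a) (b - t • a) a = curvatureForm g y Γ a b b a := by
  have form_linear (c d : E) : curvatureForm g y Γ a b c d =
      fderiv ℝ (christoffelFirst g) y a b c d - fderiv ℝ (christoffelFirst g) y b a c d
        - christoffelFirst g y b c (Γ a d) + christoffelFirst g y a c (Γ b d) := by
    rw [curvatureForm, hΓ, hΓ]
  have form_right := curvatureForm_self_right (Γ := Γ) hg hs a b a
  rw [curvatureForm_sub_smul_second hs hΓ]
  rw [form_linear] at form_right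
  simp only [form_linear, map_sub, map_smul, sub_apply, smul_apply, smul_eq_mul]
  linear_combination -t * form_right

end CurvatureAlgebra

section Quaternionic

open scoped MultilinearInstances

variable {E : Type*} [NormedAddCommGroup E] [NormedSpace ℝ E]

theorem apply_self_nonneg {G : E →L[ℝ] E →L[ℝ] ℝ} (hpos : ∀ v, v ≠ 0 → 0 < G v v) (v : E) :
    0 ≤ G v v := by
  rcases eq_or_ne v 0 with rfl | hv
  · simp
  · exact (hpos v hv).le

theorem sq_apply_le {G : E →L[ℝ] E →L[ℝ] ℝ} (hs : ∀ v w, G v w = G w v)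
    (hpos : ∀ v, v ≠ 0 → 0 < G v v) (a b : E) : G a b ^ 2 ≤ G a a * G b b :=
  LinearMap.BilinForm.apply_sq_le_of_symm G.toLinearMap₁₂ (apply_self_nonneg hpos)
    ⟨hs⟩ a b

theorem abs_apply_le {G : E →L[ℝ] E →L[ℝ] ℝ} (hs : ∀ v w, G v w = G w v)
    (hpos : ∀ v, v ≠ 0 → 0 < G v v) {a b : E} {r s : ℝ} (ha : G a a ≤ r ^ 2)
    (hb : G b b ≤ s ^ 2) (hr : 0 ≤ r) (hs₀ : 0 ≤ s) : |G a b| ≤ r * s := by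
  refine abs_le_of_sq_le_sq ?_ (by positivity)
  calc G a b ^ 2 ≤ G a a * G b b := sq_apply_le hs hpos a b
    _ ≤ r ^ 2 * s ^ 2 := by gcongr; exact apply_self_nonneg hpos b
    _ = (r * s) ^ 2 := by ring

theorem exists_mul_eq_smul {V : Type*} [AddCommGroup V] [Module ℝ V] {J : Fin 3 → V → V}
    (neg : ∀ i v, J i (-v) = -J i v) (square : ∀ i v, J i (J i v) = -v)
    (anticomm : ∀ i j, i ≠ j → ∀ v, J i (J j v) = -J j (J i v))
    (triple : ∀ v, J 0 (J 1 (J 2 v)) = -v) {i j : Fin 3} (hij : i ≠ j) :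
    ∃ k, ∃ ε : ℝ, ∀ v, J i (J j v) = ε • J k v := by
  have h01 (v : V) : J 0 (J 1 v) = J 2 v := by
    have := triple (J 2 v)
    rw [square, neg, neg] at this
    exact neg_injective this
  have h12 (v : V) : J 1 (J 2 v) = J 0 v := by
    have := congrArg (J 0) (triple v)
    rw [square, neg] at this
    exact neg_injective this
  have h20 (v : V) : J 2 (J 0 v) = J 1 v := by
    rw [← h01, anticomm 1 0 (by decide), neg, square, neg_neg]
  fin_cases i <;> fin_cases j
  · exact absurd rfl hij
  · exact ⟨2, 1, fun v ↦ by simpa using h01 v⟩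
  · exact ⟨1, -1, fun v ↦ by simpa [h20] using anticomm 0 2 (by decide) v⟩
  · exact ⟨2, -1, fun v ↦ by simpa [h01] using anticomm 1 0 (by decide) v⟩
  · exact absurd rfl hij
  · exact ⟨0, 1, fun v ↦ by simpa using h12 v⟩
  · exact ⟨1, 1, fun v ↦ by simpa using h20 v⟩
  · exact ⟨0, -1, fun v ↦ by simpa [h12] using anticomm 2 1 (by decide) v⟩
  · exact absurd rfl hij

/-- `J 0, J 1, J 2` are isometries of `G` satisfying the quaternion relations, and `V` is a
subspace which has an orthogonal complement and is orthogonal to its images `J i V`. -/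
structure IsQuatSplit (G : E →L[ℝ] E →L[ℝ] ℝ) (J : Fin 3 → E →L[ℝ] E) (V : Submodule ℝ E) :
    Prop where
  symm : ∀ v w, G v w = G w v
  pos : ∀ v, v ≠ 0 → 0 < G v v
  square : ∀ i v, J i (J i v) = -v
  anticomm : ∀ i j, i ≠ j → ∀ v, J i (J j v) = -J j (J i v)
  triple : ∀ v, J 0 (J 1 (J 2 v)) = -v
  isometry : ∀ i v w, G (J i v) (J i w) = G v w
  orthogonal : ∀ i, ∀ v ∈ V, ∀ w ∈ V, G v (J i w) = 0
  split : ∀ v, ∃ z ∈ V, ∀ w ∈ V, G (v - z) w = 0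

namespace IsQuatSplit

variable {G : E →L[ℝ] E →L[ℝ] ℝ} {J : Fin 3 → E →L[ℝ] E} {V : Submodule ℝ E}

theorem skew (H : IsQuatSplit G J V) (i : Fin 3) (v w : E) : G (J i v) w = -G v (J i w) := by
  rw [← H.isometry i v (J i w), H.square, map_neg, neg_neg]

theorem orthogonal_of_ne (H : IsQuatSplit G J V) {i j : Fin 3} (hij : i ≠ j) {v w : E}
    (hv : v ∈ V) (hw : w ∈ V) : G (J i v) (J j w) = 0 := by
  obtain ⟨k, ε, hk⟩ := exists_mul_eq_smul (J := fun i ↦ J i) (fun i v ↦ map_neg (J i) v)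
    H.square H.anticomm H.triple hij
  rw [H.skew, hk, map_smul, H.orthogonal k v hv w hw, smul_zero, neg_zero]

theorem orthogonal_left (H : IsQuatSplit G J V) (i : Fin 3) {v w : E} (hv : v ∈ V) (hw : w ∈ V) :
    G (J i v) w = 0 := by
  rw [H.symm, H.orthogonal i w hw v hv]

theorem eq_zero_of_mem (H : IsQuatSplit G J V) {v : E} (hv : v ∈ V) (h : ∀ w ∈ V, G v w = 0) :
    v = 0 := by
  by_contra hne
  exact (H.pos v hne).ne' (h v hv)

theorem existsUnique_split (H : IsQuatSplit G J V) (v : E) :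
    ∃! z, z ∈ V ∧ ∀ w ∈ V, G z w = G v w := by
  obtain ⟨z, hz, orth⟩ := H.split v
  have hzv (w : E) (hw : w ∈ V) : G z w = G v w := by
    have := orth w hw
    rw [map_sub, sub_apply] at this
    linarith
  refine ⟨z, ⟨hz, hzv⟩, fun z' ⟨hz', hz'v⟩ ↦ sub_eq_zero.1 ?_⟩
  refine H.eq_zero_of_mem (V.sub_mem hz' hz) fun w hw ↦ ?_
  rw [map_sub, sub_apply, hz'v w hw, hzv w hw, sub_self]

/-- The orthogonal projection onto `V`. -/
noncomputable def verticalPart (H : IsQuatSplit G J V) : E →ₗ[ℝ] E where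
  toFun v := (H.existsUnique_split v).choose
  map_add' v w := by
    have hv := (H.existsUnique_split v).choose_spec.1
    have hw := (H.existsUnique_split w).choose_spec.1
    refine ((H.existsUnique_split (v + w)).choose_spec.2 _
      ⟨V.add_mem hv.1 hw.1, fun u hu ↦ ?_⟩).symm
    simp only [map_add, add_apply, hv.2 u hu, hw.2 u hu]
  map_smul' t v := by
    have hv := (H.existsUnique_split v).choose_spec.1
    refine ((H.existsUnique_split (t • v)).choose_spec.2 _
      ⟨V.smul_mem t hv.1, fun u hu ↦ ?_⟩).symm
    simp only [map_smul, smul_apply, hv.2 u hu]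

theorem verticalPart_mem (H : IsQuatSplit G J V) (v : E) : H.verticalPart v ∈ V :=
  (H.existsUnique_split v).choose_spec.1.1

theorem apply_verticalPart (H : IsQuatSplit G J V) (v : E) {w : E} (hw : w ∈ V) :
    G (H.verticalPart v) w = G v w :=
  (H.existsUnique_split v).choose_spec.1.2 w hw

theorem verticalPart_eq (H : IsQuatSplit G J V) {v z : E} (hz : z ∈ V)
    (h : ∀ w ∈ V, G z w = G v w) : H.verticalPart v = z :=
  ((H.existsUnique_split v).choose_spec.2 z ⟨hz, h⟩).symm

theorem verticalPart_of_mem (H : IsQuatSplit G J V) {v : E} (hv : v ∈ V) : H.verticalPart v = v :=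
  H.verticalPart_eq hv fun _ _ ↦ rfl

theorem verticalPart_eq_zero (H : IsQuatSplit G J V) {v : E} (h : ∀ w ∈ V, G v w = 0) :
    H.verticalPart v = 0 :=
  H.verticalPart_eq V.zero_mem fun w hw ↦ by rw [h w hw, map_zero, zero_apply]

/-- The orthogonal projection onto the orthogonal complement of `V + J 0 V + J 1 V + J 2 V`. -/
noncomputable def quatHorizontalPart (H : IsQuatSplit G J V) (v : E) : E :=
  v - H.verticalPart v + ∑ i, J i (H.verticalPart (J i v))

theorem quatHorizontalPart_orthogonal (H : IsQuatSplit G J V) (v : E) {w : E} (hw : w ∈ V) :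
    G (H.quatHorizontalPart v) w = 0 := by
  rw [quatHorizontalPart, map_add, add_apply, map_sub, sub_apply, H.apply_verticalPart v hw,
    map_sum, sum_apply,
    Finset.sum_eq_zero fun i _ ↦ H.orthogonal_left i (H.verticalPart_mem _) hw, sub_self, add_zero]

theorem quatHorizontalPart_orthogonal_image (H : IsQuatSplit G J V) (v : E) (j : Fin 3) {w : E}
    (hw : w ∈ V) : G (H.quatHorizontalPart v) (J j w) = 0 := by
  rw [quatHorizontalPart, map_add, add_apply, map_sub, sub_apply,
    H.orthogonal j _ (H.verticalPart_mem v) w hw, map_sum, sum_apply,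
    Finset.sum_eq_single j (fun i _ hij ↦ H.orthogonal_of_ne hij (H.verticalPart_mem _) hw)
      (by simp),
    H.isometry, H.apply_verticalPart _ hw, H.skew]
  ring

theorem apply_eq_add_sum (H : IsQuatSplit G J V) (v w : E) :
    G v w = G (H.quatHorizontalPart v) (H.quatHorizontalPart w)
      + G (H.verticalPart v) (H.verticalPart w)
      + ∑ i, G (H.verticalPart (J i v)) (H.verticalPart (J i w)) := by
  have horizontal_right : G (H.quatHorizontalPart v) w =
      G (H.quatHorizontalPart v) (H.quatHorizontalPart w) := by
    simp [quatHorizontalPart.eq_def H w, H.quatHorizontalPart_orthogonal v (H.verticalPart_mem w),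
      H.quatHorizontalPart_orthogonal_image v _ (H.verticalPart_mem _)]
  have vertical_right (i : Fin 3) : G (J i (H.verticalPart (J i v))) w =
      -G (H.verticalPart (J i v)) (H.verticalPart (J i w)) := by
    rw [H.skew, H.symm, H.symm _ (H.verticalPart (J i w)),
      H.apply_verticalPart _ (H.verticalPart_mem _)]
  have decomposition : v = H.quatHorizontalPart v + H.verticalPart v
      - ∑ i, J i (H.verticalPart (J i v)) := by
    rw [quatHorizontalPart]; abel
  conv_lhs => rw [decomposition]
  rw [map_sub, map_add, sub_apply, add_apply, horizontal_right, H.symm (H.verticalPart v),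
    H.symm (H.verticalPart v), H.apply_verticalPart w (H.verticalPart_mem v), map_sum, sum_apply,
    Finset.sum_congr rfl fun i _ ↦ vertical_right i, Finset.sum_neg_distrib, sub_neg_eq_add]

end IsQuatSplit

end Quaternionic

section LinearReduction

open scoped MultilinearInstances

variable {E : Type*} [NormedAddCommGroup E] [NormedSpace ℝ E]
  {W : Type*} [NormedAddCommGroup W] [NormedSpace ℝ W]
  {B : Type*} [NormedAddCommGroup B] [NormedSpace ℝ B]

/-- The vertical directions: the image under the inclusion `F` of a submanifold of the kernel of
the projection `P` to its quotient. -/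
def vert (F : W →L[ℝ] E) (P : W →L[ℝ] B) : Submodule ℝ E :=
  (LinearMap.ker (P : W →ₗ[ℝ] B)).map (F : W →ₗ[ℝ] E)

theorem mem_vert {F : W →L[ℝ] E} {P : W →L[ℝ] B} {v : E} :
    v ∈ vert F P ↔ ∃ k, P k = 0 ∧ F k = v := by
  simp [vert]

/-- The linear algebra of hyperkähler reduction: `F` includes the tangent space of a submanifold,
`P` projects it to the tangent space of the quotient, and the image of `F` is the orthogonal
complement of the `J i (vert F P)`, as for a level set of a hyperkähler moment map. -/
structure IsLinearReduction (G : E →L[ℝ] E →L[ℝ] ℝ) (J : Fin 3 → E →L[ℝ] E) (F : W →L[ℝ] E)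
    (P : W →L[ℝ] B) : Prop where
  quatSplit : IsQuatSplit G J (vert F P)
  mem_tangent : ∀ v, (∀ i, ∀ w ∈ vert F P, G v (J i w) = 0) ↔ ∃ w, F w = v

end LinearReduction

section CurvatureEstimate

open scoped MultilinearInstances

variable {E : Type*} [NormedAddCommGroup E] [NormedSpace ℝ E]
  {W : Type*} [NormedAddCommGroup W] [NormedSpace ℝ W]
  {B : Type*} [NormedAddCommGroup B] [NormedSpace ℝ B]

/-- A hyperkähler quotient in coordinates, with the Christoffel symbols `Γ` of `g` at `f x` and
`ΓB` of `q` at `p x`. -/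
structure IsLocalHyperkahlerQuotient (g : E → E →L[ℝ] E →L[ℝ] ℝ) (q : B → B →L[ℝ] B →L[ℝ] ℝ)
    (f : W → E) (p : W → B) (h : W → B →L[ℝ] W) (x : W) (Γ : E → E → E) (ΓB : B → B → B)
    (J : Fin 3 → E →L[ℝ] E) : Prop
    extends IsLocalQuotient g q f p h x where
  christoffel : IsChristoffelAt g (f x) Γ
  christoffel_base : IsChristoffelAt q (p x) ΓB
  pos_base : ∀ v, v ≠ 0 → 0 < q (p x) v v
  reduction : IsLinearReduction (g (f x)) J (fderiv ℝ f x) (fderiv ℝ p x)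

namespace IsLocalHyperkahlerQuotient

variable {g : E → E →L[ℝ] E →L[ℝ] ℝ} {q : B → B →L[ℝ] B →L[ℝ] ℝ}
  {f : W → E} {p : W → B} {h : W → B →L[ℝ] W} {x : W} {Γ : E → E → E} {ΓB : B → B → B}
  {J : Fin 3 → E →L[ℝ] E}

theorem quatSplit (H : IsLocalHyperkahlerQuotient g q f p h x Γ ΓB J) :
    IsQuatSplit (g (f x)) J (vert (fderiv ℝ f x) (fderiv ℝ p x)) :=
  H.reduction.quatSplit

theorem horizontalLift_orthogonal (H : IsLocalHyperkahlerQuotient g q f p h x Γ ΓB J) (X : B)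
    {w : E} (hw : w ∈ vert (fderiv ℝ f x) (fderiv ℝ p x)) :
    g (f x) (horizontalLift f h X x) w = 0 := by
  obtain ⟨k, hk, rfl⟩ := mem_vert.1 hw
  exact H.metric_horizontalLift_vertical X hk

theorem exists_eq_horizontalLift (H : IsLocalHyperkahlerQuotient g q f p h x Γ ΓB J) {v : E}
    (hv : ∀ w ∈ vert (fderiv ℝ f x) (fderiv ℝ p x), g (f x) v w = 0)
    (hvJ : ∀ i, ∀ w ∈ vert (fderiv ℝ f x) (fderiv ℝ p x), g (f x) v (J i w) = 0) :
    ∃ X, v = horizontalLift f h X x := by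
  obtain ⟨w, rfl⟩ := (H.reduction.mem_tangent v).1 hvJ
  refine ⟨fderiv ℝ p x w, sub_eq_zero.1 (H.quatSplit.eq_zero_of_mem ?_ fun u hu ↦ ?_)⟩
  · refine mem_vert.2 ⟨w - h x (fderiv ℝ p x w), ?_, by rw [map_sub, horizontalLift]⟩
    rw [map_sub, H.proj_lift.self_of_nhds, sub_self]
  · rw [map_sub, sub_apply, hv u hu, H.horizontalLift_orthogonal _ hu, sub_zero]

theorem covDerivLift_horizontalLift (H : IsLocalHyperkahlerQuotient g q f p h x Γ ΓB J)
    (X Y Z : B) : g (f x) (covDerivLift f h Γ x X Y) (horizontalLift f h Z x) =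
      q (p x) (ΓB X Y) Z := by
  rw [covDerivLift, H.christoffel.apply_covDerivAlong, H.covPairing_lift_lift,
    H.christoffel_base]

theorem quatHorizontalPart_covDerivLift (H : IsLocalHyperkahlerQuotient g q f p h x Γ ΓB J)
    (X Y : B) : H.quatSplit.quatHorizontalPart (covDerivLift f h Γ x X Y) =
      horizontalLift f h (ΓB X Y) x := by
  set n := covDerivLift f h Γ x X Y with hn
  obtain ⟨T, hT⟩ := H.exists_eq_horizontalLift
    (fun w hw ↦ H.quatSplit.quatHorizontalPart_orthogonal n hw)
    (fun i w hw ↦ H.quatSplit.quatHorizontalPart_orthogonal_image n i hw)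
  rw [hT]
  congr 1
  refine eq_of_forall_apply_eq H.pos_base fun Z ↦ ?_
  have tangent (i : Fin 3) :
      g (f x) (J i (H.quatSplit.verticalPart (J i n))) (horizontalLift f h Z x) = 0 := by
    rw [H.quatSplit.symm]
    exact (H.reduction.mem_tangent _).2 ⟨_, rfl⟩ i _ (H.quatSplit.verticalPart_mem _)
  rw [← H.metric_horizontalLift, ← hT, IsQuatSplit.quatHorizontalPart, map_add, map_sub,
    add_apply, sub_apply, H.quatSplit.symm (H.quatSplit.verticalPart n),
    H.horizontalLift_orthogonal Z (H.quatSplit.verticalPart_mem n), map_sum, sum_apply,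
    Finset.sum_eq_zero fun i _ ↦ tangent i, hn, H.covDerivLift_horizontalLift, sub_zero, add_zero]

theorem verticalPart_covDerivLift_skew (H : IsLocalHyperkahlerQuotient g q f p h x Γ ΓB J)
    (X Y : B) : H.quatSplit.verticalPart (covDerivLift f h Γ x Y X) =
      -H.quatSplit.verticalPart (covDerivLift f h Γ x X Y) := by
  rw [eq_neg_iff_add_eq_zero, add_comm, ← map_add]
  refine H.quatSplit.verticalPart_eq_zero fun w hw ↦ ?_
  obtain ⟨k, hk, rfl⟩ := mem_vert.1 hw
  exact H.covDerivLift_skew_vertical H.christoffel X Y hk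

theorem covDerivLift_sub_mem (H : IsLocalHyperkahlerQuotient g q f p h x Γ ΓB J) (X Y : B) :
    covDerivLift f h Γ x X Y - covDerivLift f h Γ x Y X ∈ vert (fderiv ℝ f x) (fderiv ℝ p x) :=
  mem_vert.2 ⟨_, H.fderiv_proj_bracket X Y,
    (H.covDerivLift_sub H.christoffel H.quatSplit.pos X Y).symm⟩

theorem covDerivLift_sub_eq (H : IsLocalHyperkahlerQuotient g q f p h x Γ ΓB J) (X Y : B) :
    covDerivLift f h Γ x X Y - covDerivLift f h Γ x Y X =
      (2 : ℝ) • H.quatSplit.verticalPart (covDerivLift f h Γ x X Y) := by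
  rw [← H.quatSplit.verticalPart_of_mem (H.covDerivLift_sub_mem X Y), map_sub,
    H.verticalPart_covDerivLift_skew X Y, two_smul, sub_neg_eq_add]

theorem verticalPart_apply_covDerivLift_symm
    (H : IsLocalHyperkahlerQuotient g q f p h x Γ ΓB J) (i : Fin 3) (X Y : B) :
    H.quatSplit.verticalPart (J i (covDerivLift f h Γ x Y X)) =
      H.quatSplit.verticalPart (J i (covDerivLift f h Γ x X Y)) := by
  rw [← sub_eq_zero, ← map_sub, ← map_sub]
  exact H.quatSplit.verticalPart_eq_zero fun w hw ↦
    H.quatSplit.orthogonal_left i (H.covDerivLift_sub_mem Y X) hw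

theorem metric_covDerivLift (H : IsLocalHyperkahlerQuotient g q f p h x Γ ΓB J)
    (X Y Z T : B) :
    g (f x) (covDerivLift f h Γ x X Y) (covDerivLift f h Γ x Z T) =
      q (p x) (ΓB X Y) (ΓB Z T)
        + g (f x) (H.quatSplit.verticalPart (covDerivLift f h Γ x X Y))
            (H.quatSplit.verticalPart (covDerivLift f h Γ x Z T))
        + ∑ i, g (f x) (H.quatSplit.verticalPart (J i (covDerivLift f h Γ x X Y)))
            (H.quatSplit.verticalPart (J i (covDerivLift f h Γ x Z T))) := by
  rw [H.quatSplit.apply_eq_add_sum, H.quatHorizontalPart_covDerivLift,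
    H.quatHorizontalPart_covDerivLift, H.metric_horizontalLift]

/-- The O'Neill and Gauss equations together: the `3 |vert ∇_X Y|²` comes from the submersion, and
the `J i`-components of `∇_X Y` are the second fundamental form of the submanifold. -/
theorem curvatureForm_sub_curvatureForm_lift
    (H : IsLocalHyperkahlerQuotient g q f p h x Γ ΓB J) (X Y : B) :
    curvatureForm q (p x) ΓB X Y Y X
        - curvatureForm g (f x) Γ (horizontalLift f h X x) (horizontalLift f h Y x)
            (horizontalLift f h Y x) (horizontalLift f h X x) =
      3 * g (f x) (H.quatSplit.verticalPart (covDerivLift f h Γ x X Y))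
          (H.quatSplit.verticalPart (covDerivLift f h Γ x X Y))
      + ∑ i, (g (f x) (H.quatSplit.verticalPart (J i (covDerivLift f h Γ x Y Y)))
            (H.quatSplit.verticalPart (J i (covDerivLift f h Γ x X X)))
          - g (f x) (H.quatSplit.verticalPart (J i (covDerivLift f h Γ x X Y)))
            (H.quatSplit.verticalPart (J i (covDerivLift f h Γ x X Y)))) := by
  have diagonal (X : B) : H.quatSplit.verticalPart (covDerivLift f h Γ x X X) = 0 := by
    simpa using (H.covDerivLift_sub_eq X X).symm
  have bracket_term : g (f x) (covDerivLift f h Γ x Y X)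
      (covDerivLift f h Γ x X Y - covDerivLift f h Γ x Y X) =
      -(2 * g (f x) (H.quatSplit.verticalPart (covDerivLift f h Γ x X Y))
        (H.quatSplit.verticalPart (covDerivLift f h Γ x X Y))) := by
    rw [H.covDerivLift_sub_eq, map_smul, smul_eq_mul,
      ← H.quatSplit.apply_verticalPart _ (H.quatSplit.verticalPart_mem _),
      H.verticalPart_covDerivLift_skew X Y, map_neg, neg_apply, mul_neg]
  rw [H.curvatureForm_lift H.christoffel H.quatSplit.pos, bracket_term,
    H.metric_covDerivLift Y Y X X, H.metric_covDerivLift X Y Y X, diagonal,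
    H.verticalPart_covDerivLift_skew X Y, Finset.sum_sub_distrib, curvatureForm]
  simp only [H.verticalPart_apply_covDerivLift_symm _ X Y, map_neg, zero_apply, map_zero]
  ring

theorem abs_curvatureForm_sub_le (H : IsLocalHyperkahlerQuotient g q f p h x Γ ΓB J) {C : ℝ}
    (hC : 0 ≤ C)
    (vertical_le : ∀ X Y, X ≠ 0 → Y ≠ 0 →
      g (f x) (H.quatSplit.verticalPart (covDerivLift f h Γ x X Y))
        (H.quatSplit.verticalPart (covDerivLift f h Γ x X Y)) ≤
          C ^ 2 * (q (p x) X X * q (p x) Y Y))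
    (image_le : ∀ i X Y, X ≠ 0 → Y ≠ 0 →
      g (f x) (H.quatSplit.verticalPart (J i (covDerivLift f h Γ x X Y)))
        (H.quatSplit.verticalPart (J i (covDerivLift f h Γ x X Y))) ≤
          C ^ 2 * (q (p x) X X * q (p x) Y Y))
    {X Y : B} (hX : X ≠ 0) (hY : Y ≠ 0) :
    |curvatureForm q (p x) ΓB X Y Y X
      - curvatureForm g (f x) Γ (horizontalLift f h X x) (horizontalLift f h Y x)
          (horizontalLift f h Y x) (horizontalLift f h X x)| ≤
      9 * (C ^ 2 * (q (p x) X X * q (p x) Y Y)) := by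
  have nonneg := apply_self_nonneg H.quatSplit.pos
  have diagonal (i : Fin 3) {Z : B} (hZ : Z ≠ 0) :
      g (f x) (H.quatSplit.verticalPart (J i (covDerivLift f h Γ x Z Z)))
        (H.quatSplit.verticalPart (J i (covDerivLift f h Γ x Z Z))) ≤ (C * q (p x) Z Z) ^ 2 :=
    (image_le i Z Z hZ hZ).trans_eq (by ring)
  have summand (i : Fin 3) :
      |g (f x) (H.quatSplit.verticalPart (J i (covDerivLift f h Γ x Y Y)))
          (H.quatSplit.verticalPart (J i (covDerivLift f h Γ x X X)))
        - g (f x) (H.quatSplit.verticalPart (J i (covDerivLift f h Γ x X Y)))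
          (H.quatSplit.verticalPart (J i (covDerivLift f h Γ x X Y)))| ≤
        2 * (C ^ 2 * (q (p x) X X * q (p x) Y Y)) := by
    have mixed := abs_apply_le H.quatSplit.symm H.quatSplit.pos (diagonal i hY) (diagonal i hX)
      (mul_nonneg hC (H.pos_base Y hY).le) (mul_nonneg hC (H.pos_base X hX).le)
    refine (abs_sub _ _).trans ((add_le_add mixed
      ((abs_of_nonneg (nonneg _)).trans_le (image_le i X Y hX hY))).trans_eq (by ring))
  rw [H.curvatureForm_sub_curvatureForm_lift]
  calc
    _ ≤ 3 * (C ^ 2 * (q (p x) X X * q (p x) Y Y))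
        + ∑ _i : Fin 3, 2 * (C ^ 2 * (q (p x) X X * q (p x) Y Y)) := by
      refine (abs_add_le _ _).trans (add_le_add ?_
        ((Finset.abs_sum_le_sum_abs _ _).trans (Finset.sum_le_sum fun i _ ↦ summand i)))
      rw [abs_of_nonneg (mul_nonneg zero_le_three (nonneg _))]
      exact mul_le_mul_of_nonneg_left (vertical_le X Y hX hY) zero_le_three
    _ = 9 * (C ^ 2 * (q (p x) X X * q (p x) Y Y)) := by
      rw [Fin.sum_const]; ring

end IsLocalHyperkahlerQuotient

end CurvatureEstimate

section SectionalCurvature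

open scoped MultilinearInstances

variable {E : Type*} [NormedAddCommGroup E] [NormedSpace ℝ E]
  {W : Type*} [NormedAddCommGroup W] [NormedSpace ℝ W]
  {B : Type*} [NormedAddCommGroup B] [NormedSpace ℝ B]
  {g : E → E →L[ℝ] E →L[ℝ] ℝ} {q : B → B →L[ℝ] B →L[ℝ] ℝ}
  {f : W → E} {p : W → B} {h : W → B →L[ℝ] W} {x : W} {Γ : E → E → E} {ΓB : B → B → B}
  {J : Fin 3 → E →L[ℝ] E}

/-- The sectional curvature of the plane spanned by `a` and `b`, in coordinates. -/
noncomputable def localSectionalCurvature (g : E → E →L[ℝ] E →L[ℝ] ℝ) (y : E) (Γ : E → E → E)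
    (a b : E) : ℝ :=
  curvatureForm g y Γ a b b a / (g y a a * g y b b - g y a b ^ 2)

theorem localSectionalCurvature_eq_div {y : E} (hg : ContDiffAt ℝ 2 g y)
    (hs : ∀ v w, g y v w = g y w v) (hΓ : IsChristoffelAt g y Γ) {a b : E} {t : ℝ}
    (ha : g y a a ≠ 0) (ht : t = g y a b / g y a a) :
    localSectionalCurvature g y Γ a b = curvatureForm g y Γ a (b - t • a) (b - t • a) a /
      (g y a a * g y (b - t • a) (b - t • a)) := by
  rw [localSectionalCurvature, curvatureForm_sub_smul hg hs hΓ]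
  congr 1
  simp only [map_sub, map_smul, sub_apply, smul_apply, smul_eq_mul, hs b a, ht]
  field_simp
  ring

theorem IsLocalHyperkahlerQuotient.abs_sectionalCurvature_sub_le
    (H : IsLocalHyperkahlerQuotient g q f p h x Γ ΓB J) {C : ℝ} (hC : 0 ≤ C)
    (vertical_le : ∀ X Y, X ≠ 0 → Y ≠ 0 →
      g (f x) (H.quatSplit.verticalPart (covDerivLift f h Γ x X Y))
        (H.quatSplit.verticalPart (covDerivLift f h Γ x X Y)) ≤
          C ^ 2 * (q (p x) X X * q (p x) Y Y))
    (image_le : ∀ i X Y, X ≠ 0 → Y ≠ 0 →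
      g (f x) (H.quatSplit.verticalPart (J i (covDerivLift f h Γ x X Y)))
        (H.quatSplit.verticalPart (J i (covDerivLift f h Γ x X Y))) ≤
          C ^ 2 * (q (p x) X X * q (p x) Y Y))
    {X Y : B} (hXY : LinearIndependent ℝ ![X, Y]) :
    |localSectionalCurvature q (p x) ΓB X Y
      - localSectionalCurvature g (f x) Γ (horizontalLift f h X x) (horizontalLift f h Y x)| ≤
      9 * C ^ 2 := by
  have hX : X ≠ 0 := hXY.ne_zero 0
  set t := q (p x) X Y / q (p x) X X with ht
  have hZ : Y - t • X ≠ 0 := fun h0 ↦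
    one_ne_zero (LinearIndependent.pair_iff.1 hXY (-t) 1 (by rw [← h0]; module)).2
  have lift_sub : horizontalLift f h Y x - t • horizontalLift f h X x =
      horizontalLift f h (Y - t • X) x := by
    simp only [horizontalLift, map_sub, map_smul]
  have area_pos := mul_pos (H.pos_base X hX) (H.pos_base _ hZ)
  rw [localSectionalCurvature_eq_div H.contDiff_base H.symm_base.self_of_nhds H.christoffel_base
      (H.pos_base X hX).ne' ht,
    localSectionalCurvature_eq_div H.contDiff_metric H.symm_metric.self_of_nhds H.christoffel
      (t := t) (by rw [H.metric_horizontalLift]; exact (H.pos_base X hX).ne')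
      (by rw [H.metric_horizontalLift, H.metric_horizontalLift]),
    lift_sub, H.metric_horizontalLift, H.metric_horizontalLift, ← sub_div, abs_div,
    abs_of_pos area_pos, div_le_iff₀ area_pos, mul_assoc]
  exact H.abs_curvatureForm_sub_le hC vertical_le image_le hX hZ

end SectionalCurvature

section Chart

open scoped MultilinearInstances

variable {E : Type*} [NormedAddCommGroup E] [NormedSpace ℝ E]
  {M : Type*} [TopologicalSpace M] [ChartedSpace E M] [IsManifold 𝓘(ℝ, E) ∞ M]

variable (E) in
/-- The identification of `T_x M` with the model space given by the chart at `z`. -/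
noncomputable def toModel (z x : M) : TangentSpace 𝓘(ℝ, E) x →L[ℝ] E :=
  (trivializationAt E (TangentSpace 𝓘(ℝ, E)) z).continuousLinearMapAt ℝ x

variable (E) in
/-- The identification of the model space with `T_x M` given by the chart at `z`. -/
noncomputable def ofModel (z x : M) : E →L[ℝ] TangentSpace 𝓘(ℝ, E) x :=
  (trivializationAt E (TangentSpace 𝓘(ℝ, E)) z).symmL ℝ x

variable {z x : M}

theorem toModel_ofModel (hx : x ∈ (chartAt E z).source) (v : E) :
    toModel E z x (ofModel E z x v) = v :=
  (trivializationAt E (TangentSpace 𝓘(ℝ, E)) z).continuousLinearMapAt_symmL (R := ℝ)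
    (by simpa using hx) v

theorem ofModel_toModel (hx : x ∈ (chartAt E z).source) (v : TangentSpace 𝓘(ℝ, E) x) :
    ofModel E z x (toModel E z x v) = v :=
  (trivializationAt E (TangentSpace 𝓘(ℝ, E)) z).symmL_continuousLinearMapAt (R := ℝ)
    (by simpa using hx) v

theorem toModel_eq_mfderiv (hx : x ∈ (chartAt E z).source) :
    toModel E z x = mfderiv 𝓘(ℝ, E) 𝓘(ℝ, E) (extChartAt 𝓘(ℝ, E) z) x :=
  TangentBundle.continuousLinearMapAt_trivializationAt hx

theorem toModel_self (v : TangentSpace 𝓘(ℝ, E) z) : toModel E z z v = v := by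
  rw [toModel, TangentBundle.continuousLinearMapAt_trivializationAt_eq_core (mem_chart_source E z)]
  exact (tangentBundleCore 𝓘(ℝ, E) M).coordChange_self (achart E z) z (mem_chart_source E z) v

theorem ofModel_self (v : TangentSpace 𝓘(ℝ, E) z) : ofModel E z z v = v := by
  have h := ofModel_toModel (mem_chart_source E z) v
  rwa [toModel_self] at h

theorem toModel_eq_trivializationAt (hx : x ∈ (chartAt E z).source)
    (v : TangentSpace 𝓘(ℝ, E) x) :
    toModel E z x v = (trivializationAt E (TangentSpace 𝓘(ℝ, E)) z ⟨x, v⟩).2 := by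
  rw [toModel, Trivialization.continuousLinearMapAt_apply,
    Trivialization.coe_linearMapAt_of_mem _ (by simpa using hx)]

omit [IsManifold 𝓘(ℝ, E) ∞ M] in
theorem chart_mem_target (hx : x ∈ (chartAt E z).source) :
    extChartAt 𝓘(ℝ, E) z x ∈ (extChartAt 𝓘(ℝ, E) z).target :=
  (extChartAt 𝓘(ℝ, E) z).map_source (by simpa using hx)

theorem contMDiffAt_chart (hx : x ∈ (chartAt E z).source) :
    ContMDiffAt 𝓘(ℝ, E) 𝓘(ℝ, E) ∞ (extChartAt 𝓘(ℝ, E) z) x :=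
  contMDiffAt_extChartAt' hx

theorem contMDiffAt_chart_symm (hx : x ∈ (chartAt E z).source) :
    ContMDiffAt 𝓘(ℝ, E) 𝓘(ℝ, E) ∞ (extChartAt 𝓘(ℝ, E) z).symm (extChartAt 𝓘(ℝ, E) z x) :=
  (contMDiffOn_extChartAt_symm z).contMDiffAt (extChartAt_target_mem_nhds' (chart_mem_target hx))

omit [IsManifold 𝓘(ℝ, E) ∞ M] in
theorem eventually_nhds_extChartAt_iff {P : E → Prop} :
    (∀ᶠ y in 𝓝 (extChartAt 𝓘(ℝ, E) z z), P y) ↔ ∀ᶠ x in 𝓝 z, P (extChartAt 𝓘(ℝ, E) z x) := by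
  rw [← map_extChartAt_nhds_of_boundaryless, eventually_map]

theorem mvfderiv_ofModel {F : Type*} [NormedAddCommGroup F] [NormedSpace ℝ F] {k : M → F}
    {f : E → F} (hx : x ∈ (chartAt E z).source)
    (hk : ∀ x' ∈ (chartAt E z).source, k x' = f (extChartAt 𝓘(ℝ, E) z x'))
    (hf : DifferentiableAt ℝ f (extChartAt 𝓘(ℝ, E) z x)) (v : E) :
    mvfderiv 𝓘(ℝ, E) k x (ofModel E z x v) = fderiv ℝ f (extChartAt 𝓘(ℝ, E) z x) v := by
  have hkf : k =ᶠ[𝓝 x] f ∘ extChartAt 𝓘(ℝ, E) z :=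
    eventually_of_mem ((chartAt E z).open_source.mem_nhds hx) hk
  have hcomp := mfderiv_comp x hf.mdifferentiableAt
    ((contMDiffAt_chart hx).mdifferentiableAt (by simp))
  rw [mfderiv_eq_fderiv, ← toModel_eq_mfderiv hx] at hcomp
  rw [mvfderiv, hkf.mfderiv_eq, hcomp]
  exact congrArg (fderiv ℝ f (extChartAt 𝓘(ℝ, E) z x)) (toModel_ofModel hx v)

/-- The bilinear form field `g` read in the chart at `z`. -/
noncomputable def chartMetric (g : BilinField E M) (z : M) (y : E) : E →L[ℝ] E →L[ℝ] ℝ :=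
  ContinuousLinearMap.inCoordinates E (fun x : M ↦ TangentSpace 𝓘(ℝ, E) x) (E →L[ℝ] ℝ)
    (fun x : M ↦ TangentSpace 𝓘(ℝ, E) x →L[ℝ] ℝ) z ((extChartAt 𝓘(ℝ, E) z).symm y) z
    ((extChartAt 𝓘(ℝ, E) z).symm y) (g ((extChartAt 𝓘(ℝ, E) z).symm y))

theorem chartMetric_apply (g : BilinField E M) (hx : x ∈ (chartAt E z).source) (v w : E) :
    chartMetric g z (extChartAt 𝓘(ℝ, E) z x) v w =
      g x (ofModel E z x v) (ofModel E z x w) := by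
  rw [chartMetric, (extChartAt 𝓘(ℝ, E) z).left_inv (by simpa using hx),
    inCoordinates_apply_eq₂ (F₃ := ℝ) (E₃ := fun _ : M ↦ ℝ) (by simpa using hx)
      (by simpa using hx) (by simp), ofModel, Trivialization.symmL_apply _ (by simpa using hx),
    Trivialization.symmL_apply _ (by simpa using hx)]
  simp

theorem chartMetric_toModel (g : BilinField E M) (hx : x ∈ (chartAt E z).source)
    (v w : TangentSpace 𝓘(ℝ, E) x) :
    chartMetric g z (extChartAt 𝓘(ℝ, E) z x) (toModel E z x v) (toModel E z x w) = g x v w := by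
  rw [chartMetric_apply g hx, ofModel_toModel hx, ofModel_toModel hx]

theorem chartMetric_self (g : BilinField E M) (v w : TangentSpace 𝓘(ℝ, E) z) :
    chartMetric g z (extChartAt 𝓘(ℝ, E) z z) v w = g z v w := by
  have h := chartMetric_toModel g (mem_chart_source E z) v w
  rwa [toModel_self, toModel_self] at h

/-- The endomorphism field `J` read in the chart at `z`. -/
noncomputable def chartEndo (J : EndoField E M) (z : M) (y : E) : E →L[ℝ] E :=
  ContinuousLinearMap.inCoordinates E (fun x : M ↦ TangentSpace 𝓘(ℝ, E) x) E
    (fun x : M ↦ TangentSpace 𝓘(ℝ, E) x) z ((extChartAt 𝓘(ℝ, E) z).symm y) z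
    ((extChartAt 𝓘(ℝ, E) z).symm y) (J ((extChartAt 𝓘(ℝ, E) z).symm y))

theorem chartEndo_apply (J : EndoField E M) (hx : x ∈ (chartAt E z).source) (v : E) :
    chartEndo J z (extChartAt 𝓘(ℝ, E) z x) v = toModel E z x (J x (ofModel E z x v)) := by
  rw [chartEndo, (extChartAt 𝓘(ℝ, E) z).left_inv (by simpa using hx)]
  rfl

theorem chartEndo_toModel (J : EndoField E M) (hx : x ∈ (chartAt E z).source)
    (v : TangentSpace 𝓘(ℝ, E) x) :
    chartEndo J z (extChartAt 𝓘(ℝ, E) z x) (toModel E z x v) = toModel E z x (J x v) := by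
  rw [chartEndo_apply J hx, ofModel_toModel hx]

theorem chartEndo_self (J : EndoField E M) (v : TangentSpace 𝓘(ℝ, E) z) :
    chartEndo J z (extChartAt 𝓘(ℝ, E) z z) v = J z v := by
  have h := chartEndo_toModel J (mem_chart_source E z) v
  rwa [toModel_self, toModel_self] at h

theorem contDiffAt_chartMetric {g : BilinField E M} (hg : IsWeakMetric g)
    (hx : x ∈ (chartAt E z).source) :
    ContDiffAt ℝ ∞ (chartMetric g z) (extChartAt 𝓘(ℝ, E) z x) := by
  let _ (x : M) : ContinuousAdd (TangentSpace 𝓘(ℝ, E) x →L[ℝ] ℝ) :=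
    inferInstanceAs (ContinuousAdd (E →L[ℝ] ℝ))
  have h := ((trivializationAt (E →L[ℝ] E →L[ℝ] ℝ) (fun x : M ↦
    TangentSpace 𝓘(ℝ, E) x →L[ℝ] TangentSpace 𝓘(ℝ, E) x →L[ℝ] ℝ) z).contMDiffAt_section_iff
    (by simpa using hx)).1 (hg.smooth x)
  exact contMDiffAt_iff_contDiffAt.1 (h.comp_of_eq (contMDiffAt_chart_symm hx)
    ((extChartAt 𝓘(ℝ, E) z).left_inv (by simpa using hx)))

theorem contDiffAt_chartEndo {J : EndoField E M}
    (hJ : ContMDiff 𝓘(ℝ, E) (𝓘(ℝ, E).prod 𝓘(ℝ, E →L[ℝ] E)) ∞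
      (fun x : M ↦ TotalSpace.mk' (E →L[ℝ] E)
        (E := fun x : M ↦ TangentSpace 𝓘(ℝ, E) x →L[ℝ] TangentSpace 𝓘(ℝ, E) x) x (J x)))
    (hx : x ∈ (chartAt E z).source) :
    ContDiffAt ℝ ∞ (chartEndo J z) (extChartAt 𝓘(ℝ, E) z x) := by
  have h := ((trivializationAt (E →L[ℝ] E) (fun x : M ↦
    TangentSpace 𝓘(ℝ, E) x →L[ℝ] TangentSpace 𝓘(ℝ, E) x) z).contMDiffAt_section_iff
    (by simpa using hx)).1 (hJ x)
  exact contMDiffAt_iff_contDiffAt.1 (h.comp_of_eq (contMDiffAt_chart_symm hx)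
    ((extChartAt 𝓘(ℝ, E) z).left_inv (by simpa using hx)))

theorem IsWeakMetric.chartMetric_symm {g : BilinField E M} (hg : IsWeakMetric g)
    (hx : x ∈ (chartAt E z).source) (v w : E) :
    chartMetric g z (extChartAt 𝓘(ℝ, E) z x) v w =
      chartMetric g z (extChartAt 𝓘(ℝ, E) z x) w v := by
  rw [chartMetric_apply g hx, chartMetric_apply g hx, hg.symm]

theorem IsWeakMetric.chartMetric_pos {g : BilinField E M} (hg : IsWeakMetric g)
    (hx : x ∈ (chartAt E z).source) {v : E} (hv : v ≠ 0) :
    0 < chartMetric g z (extChartAt 𝓘(ℝ, E) z x) v v := by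
  rw [chartMetric_apply g hx]
  refine hg.pos _ _ fun h ↦ hv ?_
  rw [← toModel_ofModel hx v, h, map_zero]

/-- The vector field whose representative in the chart at `z` is `s`. -/
noncomputable def chartField (z : M) (s : E → E) (x : M) : TangentSpace 𝓘(ℝ, E) x :=
  ofModel E z x (s (extChartAt 𝓘(ℝ, E) z x))

theorem smoothFieldAt_chartField {s : E → E} (hx : x ∈ (chartAt E z).source)
    (hs : ContDiffAt ℝ ∞ s (extChartAt 𝓘(ℝ, E) z x)) : SmoothFieldAt (chartField z s) x := by
  refine ((trivializationAt E (TangentSpace 𝓘(ℝ, E)) z).contMDiffAt_section_iff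
    (by simpa using hx)).2 ?_
  refine (hs.contMDiffAt.comp x (contMDiffAt_chart hx)).congr_of_eventuallyEq ?_
  filter_upwards [(chartAt E z).open_source.mem_nhds hx] with x' hx'
  rw [← toModel_eq_trivializationAt hx']
  exact toModel_ofModel hx' _

theorem extend_eq_chartField (v : TangentSpace 𝓘(ℝ, E) z) (hx : x ∈ (chartAt E z).source) :
    FiberBundle.extend E v x = chartField (E := E) z (fun _ ↦ v) x := by
  rw [FiberBundle.extend, ← toModel_eq_trivializationAt (mem_chart_source E z), toModel_self]
  exact ((trivializationAt E (TangentSpace 𝓘(ℝ, E)) z).symmL_apply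
    (R := ℝ) (by simpa using hx) v).symm

theorem SmoothFieldAt.diffFieldAt {Y : (x : M) → TangentSpace 𝓘(ℝ, E) x}
    (hY : SmoothFieldAt Y x) : DiffFieldAt Y x :=
  ContMDiffAt.mdifferentiableAt hY (by simp)

theorem mlieBracket_const_model (v w : E) :
    VectorField.mlieBracket 𝓘(ℝ, E) (fun _ : E ↦ v) (fun _ : E ↦ w) = fun _ ↦ 0 := by
  refine (VectorField.mlieBracketWithin_univ (I := 𝓘(ℝ, E)) (V := fun _ : E ↦ v)
    (W := fun _ : E ↦ w)).symm.trans
      (VectorField.mlieBracketWithin_eq_lieBracketWithin.trans ?_)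
  funext y
  change VectorField.lieBracketWithin ℝ (fun _ : E ↦ v) (fun _ ↦ w) univ y = 0
  simp [VectorField.lieBracketWithin]

theorem chartField_const_eq_mpullback (v : E) (hx : x ∈ (chartAt E z).source) :
    chartField z (fun _ : E ↦ v) x =
      VectorField.mpullback 𝓘(ℝ, E) 𝓘(ℝ, E) (extChartAt 𝓘(ℝ, E) z) (fun _ : E ↦ v) x := by
  have hinv : (mfderiv 𝓘(ℝ, E) 𝓘(ℝ, E) (extChartAt 𝓘(ℝ, E) z) x).inverse = ofModel E z x := by
    rw [← toModel_eq_mfderiv hx]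
    exact ContinuousLinearMap.inverse_eq (ContinuousLinearMap.ext fun v ↦ toModel_ofModel hx v)
      (ContinuousLinearMap.ext fun v ↦ ofModel_toModel hx v)
  exact congrFun (congrArg DFunLike.coe hinv.symm) v

theorem mlieBracket_chartField_const [CompleteSpace E] (hx : x ∈ (chartAt E z).source) (v w : E) :
    VectorField.mlieBracket 𝓘(ℝ, E) (chartField z fun _ ↦ v) (chartField z fun _ ↦ w) x = 0 := by
  have hpull (u : E) : chartField z (fun _ ↦ u) =ᶠ[𝓝 x]
      VectorField.mpullback 𝓘(ℝ, E) 𝓘(ℝ, E) (extChartAt 𝓘(ℝ, E) z) (fun _ : E ↦ u) := by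
    filter_upwards [(chartAt E z).open_source.mem_nhds hx] with x' hx'
    exact chartField_const_eq_mpullback u hx'
  have hconst (u : E) : MDifferentiableAt 𝓘(ℝ, E) 𝓘(ℝ, E).tangent
      (fun y : E ↦ (⟨y, u⟩ : TangentBundle 𝓘(ℝ, E) E)) (extChartAt 𝓘(ℝ, E) z x) := by
    rw [mdifferentiableAt_totalSpace]
    exact ⟨mdifferentiableAt_id, by simpa using! mdifferentiableAt_const⟩
  have hmin : minSmoothness ℝ 2 ≤ (∞ : WithTop ℕ∞) := by
    rw [minSmoothness_of_isRCLikeNormedField]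
    exact WithTop.coe_le_coe.2 le_top
  have : IsManifold 𝓘(ℝ, E) (minSmoothness ℝ 2) M := IsManifold.of_le hmin
  rw [(hpull v).mlieBracket_vectorField_eq (hpull w),
    ← VectorField.mpullback_mlieBracket (hconst v) (hconst w) (contMDiffAt_chart hx) hmin,
    VectorField.mpullback_apply, mlieBracket_const_model]
  exact map_zero _

/-- The Christoffel symbols at `x` of the connection `D` in the chart at `z`. -/
noncomputable def chartChristoffel (D : Connection E M) (z x : M) (v w : E) : E :=
  toModel E z x (D (chartField z fun _ ↦ w) x (ofModel E z x v))

variable {g : BilinField E M} {D : Connection E M}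

theorem ofModel_chartChristoffel (hx : x ∈ (chartAt E z).source) (v w : E) :
    ofModel E z x (chartChristoffel D z x v w) =
      D (chartField z fun _ ↦ w) x (ofModel E z x v) :=
  ofModel_toModel hx _

namespace IsLeviCivita

theorem smoothFieldAt_apply_chartField_const (hD : IsLeviCivita g D)
    (hx : x ∈ (chartAt E z).source) (b c : E) :
    SmoothFieldAt (fun x ↦ D (chartField z fun _ ↦ c) x (ofModel E z x b)) x := by
  have h := (hD.smooth (chartAt E z).source (chartAt E z).open_source).contMDiff
    (σ := chartField z fun _ ↦ c) fun x hx ↦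
      (smoothFieldAt_chartField hx contDiffAt_const).contMDiffWithinAt
  exact ((h x hx).contMDiffAt ((chartAt E z).open_source.mem_nhds hx)).clm_bundle_apply
    (smoothFieldAt_chartField hx (contDiffAt_const (c := b)))

variable (hD : IsLeviCivita g D)

include hD

theorem fderiv_chartMetric_chartField (hg : IsWeakMetric g) (hx : x ∈ (chartAt E z).source)
    {s : E → E} (hs : ContDiffAt ℝ ∞ s (extChartAt 𝓘(ℝ, E) z x)) (a w : E) :
    fderiv ℝ (fun y ↦ chartMetric g z y (s y) w) (extChartAt 𝓘(ℝ, E) z x) a =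
      g x (D (chartField z s) x (ofModel E z x a)) (ofModel E z x w) +
        chartMetric g z (extChartAt 𝓘(ℝ, E) z x) (s (extChartAt 𝓘(ℝ, E) z x))
          (chartChristoffel D z x a w) := by
  have hdiff : DifferentiableAt ℝ (fun y ↦ chartMetric g z y (s y) w)
      (extChartAt 𝓘(ℝ, E) z x) :=
    ((((contDiffAt_chartMetric hg hx).clm_apply hs).clm_apply
      contDiffAt_const).differentiableAt (by simp))
  rw [← mvfderiv_ofModel (k := fun x ↦ g x (chartField z s x) (chartField z (fun _ ↦ w) x)) hx
      (fun x' hx' ↦ (chartMetric_apply g hx' _ _).symm) hdiff,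
    hD.metric _ _ _ _ (smoothFieldAt_chartField hx hs).diffFieldAt
      (smoothFieldAt_chartField hx contDiffAt_const).diffFieldAt,
    ← ofModel_chartChristoffel hx, chartMetric_apply g hx]
  rfl

theorem fderiv_chartMetric (hg : IsWeakMetric g) (hx : x ∈ (chartAt E z).source) (a v w : E) :
    fderiv ℝ (chartMetric g z) (extChartAt 𝓘(ℝ, E) z x) a v w =
      chartMetric g z (extChartAt 𝓘(ℝ, E) z x) (chartChristoffel D z x a v) w +
        chartMetric g z (extChartAt 𝓘(ℝ, E) z x) v (chartChristoffel D z x a w) := by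
  have hdiff := (contDiffAt_chartMetric hg hx).differentiableAt (by simp)
  have h := hD.fderiv_chartMetric_chartField hg hx (contDiffAt_const (c := v)) a w
  rw [← ofModel_chartChristoffel hx, ← chartMetric_apply g hx] at h
  rw [← h]
  have hc := (hdiff.hasFDerivAt.clm_apply (hasFDerivAt_const v _)).clm_apply
    (hasFDerivAt_const w _)
  rw [hc.fderiv]
  simp

theorem chartChristoffel_comm [CompleteSpace E] (hx : x ∈ (chartAt E z).source) (v w : E) :
    chartChristoffel D z x v w = chartChristoffel D z x w v := by
  have h := hD.torsionFree x _ _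
    (smoothFieldAt_chartField hx (contDiffAt_const (c := v))).diffFieldAt
    (smoothFieldAt_chartField hx (contDiffAt_const (c := w))).diffFieldAt
  rw [mlieBracket_chartField_const hx, sub_eq_zero] at h
  exact congrArg (toModel E z x) h

theorem isChristoffelAt [CompleteSpace E] (hg : IsWeakMetric g) (hx : x ∈ (chartAt E z).source) :
    IsChristoffelAt (chartMetric g z) (extChartAt 𝓘(ℝ, E) z x) (chartChristoffel D z x) := by
  intro v w u
  rw [christoffelFirst_apply, hD.fderiv_chartMetric hg hx, hD.fderiv_chartMetric hg hx,
    hD.fderiv_chartMetric hg hx, hD.chartChristoffel_comm hx w v, hD.chartChristoffel_comm hx u v,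
    hD.chartChristoffel_comm hx u w, hg.chartMetric_symm hx v,
    hg.chartMetric_symm hx w (chartChristoffel D z x v u)]
  ring

theorem toModel_apply_chartField (hg : IsWeakMetric g) (hx : x ∈ (chartAt E z).source) {s : E → E}
    (hs : ContDiffAt ℝ ∞ s (extChartAt 𝓘(ℝ, E) z x)) (a : E) :
    toModel E z x (D (chartField z s) x (ofModel E z x a)) =
      fderiv ℝ s (extChartAt 𝓘(ℝ, E) z x) a +
        chartChristoffel D z x a (s (extChartAt 𝓘(ℝ, E) z x)) := by
  refine eq_of_forall_apply_eq (fun v ↦ hg.chartMetric_pos hx) fun w ↦ ?_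
  have hleib := hD.fderiv_chartMetric_chartField hg hx hs a w
  have hprod := ((((contDiffAt_chartMetric hg hx).differentiableAt (by simp)).hasFDerivAt.clm_apply
    (hs.differentiableAt (by simp)).hasFDerivAt).clm_apply (hasFDerivAt_const w _)).fderiv
  have hmetric := hD.fderiv_chartMetric hg hx a (s (extChartAt 𝓘(ℝ, E) z x)) w
  rw [← ofModel_toModel hx (D _ _ _), ← chartMetric_apply g hx, hprod] at hleib
  simp only [add_apply, ContinuousLinearMap.comp_apply, ContinuousLinearMap.flip_apply,
    zero_apply, map_zero, zero_add] at hleib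
  rw [map_add, add_apply]
  linarith

theorem fderiv_christoffelFirst [CompleteSpace E] (hg : IsWeakMetric g)
    (hx : x ∈ (chartAt E z).source) (a b c d : E) :
    fderiv ℝ (christoffelFirst (chartMetric g z)) (extChartAt 𝓘(ℝ, E) z x) a b c d =
      g x (D (fun x ↦ D (chartField z fun _ ↦ c) x (ofModel E z x b)) x (ofModel E z x a))
        (ofModel E z x d) +
      chartMetric g z (extChartAt 𝓘(ℝ, E) z x) (chartChristoffel D z x b c)
        (chartChristoffel D z x a d) := by
  have hdiff := differentiableAt_christoffelFirst ((contDiffAt_chartMetric hg hx).of_le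
    (WithTop.coe_le_coe.2 le_top))
  have hconst := ((hdiff.hasFDerivAt.clm_apply (hasFDerivAt_const b _)).clm_apply
    (hasFDerivAt_const c _)).clm_apply (hasFDerivAt_const d _)
  have hmetric := hD.metric _ _ _ (ofModel E z x a)
    (hD.smoothFieldAt_apply_chartField_const hx b c).diffFieldAt
    (smoothFieldAt_chartField hx (contDiffAt_const (c := d))).diffFieldAt
  have hform (x' : M) (hx' : x' ∈ (chartAt E z).source) :
      g x' (D (chartField z fun _ ↦ c) x' (ofModel E z x' b)) (chartField z (fun _ ↦ d) x') =
        christoffelFirst (chartMetric g z) (extChartAt 𝓘(ℝ, E) z x') b c d := by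
    rw [← hD.isChristoffelAt hg hx', chartMetric_apply g hx', ofModel_chartChristoffel hx']
    rfl
  rw [mvfderiv_ofModel hx hform hconst.differentiableAt, hconst.fderiv] at hmetric
  rw [chartMetric_apply g hx, ofModel_chartChristoffel hx, ofModel_chartChristoffel hx]
  refine Eq.trans ?_ hmetric
  simp

end IsLeviCivita

theorem connection_congr (D : Connection E M) {Y Y' : (x : M) → TangentSpace 𝓘(ℝ, E) x}
    (hY : DiffFieldAt Y x) (hYY : Y =ᶠ[𝓝 x] Y') : D Y x = D Y' x :=
  D.isCovariantDerivativeOn.congr_of_eventuallyEq hY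
    (MDifferentiableAt.congr_of_eventuallyEq hY (hYY.symm.mono fun _ h ↦ by simp only [h]))
    univ_mem hYY

theorem eventually_extend_eq_chartField (v : TangentSpace 𝓘(ℝ, E) z)
    (hx : x ∈ (chartAt E z).source) :
    (FiberBundle.extend E v : (x : M) → TangentSpace 𝓘(ℝ, E) x) =ᶠ[𝓝 x]
      chartField (E := E) z (fun _ ↦ v) :=
  eventually_of_mem ((chartAt E z).open_source.mem_nhds hx) fun _ ↦ extend_eq_chartField v

namespace IsLeviCivita

theorem connection_connection_extend (hD : IsLeviCivita g D) (a b c : TangentSpace 𝓘(ℝ, E) z) :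
    D (fun x ↦ D (FiberBundle.extend E c) x (FiberBundle.extend E b x)) z
        (FiberBundle.extend E a z) =
      D (fun x ↦ D (chartField (E := E) z fun _ ↦ c) x (ofModel E z x b)) z a := by
  have hz := mem_chart_source E z
  rw [FiberBundle.extend_apply_self]
  refine DFunLike.congr_fun (connection_congr D
    (hD.smoothFieldAt_apply_chartField_const hz b c).diffFieldAt ?_).symm a
  filter_upwards [(chartAt E z).open_source.mem_nhds hz] with x hx
  rw [extend_eq_chartField b hx, connection_congr D
    (smoothFieldAt_chartField hx contDiffAt_const).diffFieldAt
    (eventually_extend_eq_chartField c hx).symm]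
  rfl

theorem metric_curvature [CompleteSpace E] (hD : IsLeviCivita g D) (hg : IsWeakMetric g)
    (a b c d : TangentSpace 𝓘(ℝ, E) z) :
    g z (curvature D a b c) d = curvatureForm (chartMetric g z) (extChartAt 𝓘(ℝ, E) z z)
      (chartChristoffel D z z) a b c d := by
  have hz := mem_chart_source E z
  have hbracket : VectorField.mlieBracket 𝓘(ℝ, E) (FiberBundle.extend E a : (x : M) → _)
      (FiberBundle.extend E b) z = 0 :=
    (Filter.EventuallyEq.mlieBracket_vectorField_eq (eventually_extend_eq_chartField a hz)
      (eventually_extend_eq_chartField b hz)).trans (mlieBracket_chartField_const (E := E) hz a b)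
  have hab := hD.fderiv_christoffelFirst hg hz a b c d
  have hba := hD.fderiv_christoffelFirst hg hz b a c d
  simp only [ofModel_self] at hab hba
  rw [curvature, curvatureField, hD.connection_connection_extend,
    hD.connection_connection_extend, hbracket, map_zero, sub_zero, map_sub, sub_apply]
  unfold curvatureForm
  linarith

theorem sectionalCurvature_eq [CompleteSpace E] (hD : IsLeviCivita g D) (hg : IsWeakMetric g)
    (a b : TangentSpace 𝓘(ℝ, E) z) :
    sectionalCurvature g D a b = localSectionalCurvature (chartMetric g z)
      (extChartAt 𝓘(ℝ, E) z z) (chartChristoffel D z z) a b := by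
  rw [sectionalCurvature, hD.metric_curvature hg, ← chartMetric_self, ← chartMetric_self,
    ← chartMetric_self]
  rfl

end IsLeviCivita

end Chart

section Inversion

variable {E : Type*} [NormedAddCommGroup E] [NormedSpace ℝ E] [CompleteSpace E]
  {F : Type*} [NormedAddCommGroup F] [NormedSpace ℝ F]

theorem contDiffAt_inverse_comp {X : Type*} [NormedAddCommGroup X] [NormedSpace ℝ X]
    {n : WithTop ℕ∞} {T : X → E →L[ℝ] F} {x : X} (hT : ContDiffAt ℝ n T x)
    (hx : (T x).IsInvertible) : ContDiffAt ℝ n (fun y ↦ (T y).inverse) x :=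
  hx.contDiffAt_map_inverse.comp x hT

theorem eventually_isInvertible {X : Type*} [TopologicalSpace X] {T : X → E →L[ℝ] F} {x : X}
    (hT : ContinuousAt T x) (hx : (T x).IsInvertible) : ∀ᶠ y in 𝓝 x, (T y).IsInvertible := by
  obtain ⟨e, he⟩ := hx
  exact hT.eventually (he ▸ e.nhds)

end Inversion

section SmoothLift

open scoped MultilinearInstances

variable {E : Type*} [NormedAddCommGroup E] [NormedSpace ℝ E]
  {W : Type*} [NormedAddCommGroup W] [NormedSpace ℝ W]
  {B : Type*} [NormedAddCommGroup B] [NormedSpace ℝ B]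
  {K : Type*} [NormedAddCommGroup K] [NormedSpace ℝ K]
  {X : Type*} [NormedAddCommGroup X] [NormedSpace ℝ X] {n : WithTop ℕ∞}

theorem exists_contDiffAt_splitting [CompleteSpace W] {P : X → W →L[ℝ] B} {x : X}
    (hP : ContDiffAt ℝ n P x) {s₀ : B →L[ℝ] W} (hs₀ : ∀ b, P x (s₀ b) = b) :
    ∃ S : X → B × LinearMap.ker (P x : W →ₗ[ℝ] B) →L[ℝ] W, ContDiffAt ℝ n S x ∧
      ∀ᶠ y in 𝓝 x, Function.Bijective (S y) ∧ ∀ b k, P y (S y (b, k)) = b := by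
  set K := LinearMap.ker (P x : W →ₗ[ℝ] B)
  let pr : W →L[ℝ] K := (ContinuousLinearMap.id ℝ W - s₀ ∘L P x).codRestrict K
    fun w ↦ by simp [K, hs₀]
  let T (y : X) : W →L[ℝ] B × K :=
    ContinuousLinearMap.inl ℝ B K ∘L P y + ContinuousLinearMap.inr ℝ B K ∘L pr
  have T_apply (y : X) (w : W) : T y w = (P y w, pr w) := by simp [T]
  have hT : ContDiffAt ℝ n T x := (contDiffAt_const.clm_comp hP).add contDiffAt_const
  have hTx : (T x).IsInvertible := by
    refine .of_inverse (g := s₀.coprod K.subtypeL) (ContinuousLinearMap.ext fun u ↦ ?_)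
      (ContinuousLinearMap.ext fun w ↦ by simp [T_apply, pr])
    have hk : P x (u.2 : W) = 0 := u.2.2
    ext <;> simp [T_apply, pr, hs₀, hk]
  refine ⟨fun y ↦ (T y).inverse, contDiffAt_inverse_comp hT hTx, ?_⟩
  filter_upwards [eventually_isInvertible hT.continuousAt hTx] with y hy
  refine ⟨hy.inverse.bijective, fun b k ↦ ?_⟩
  have := hy.self_apply_inverse (b, k)
  rw [T_apply] at this
  exact congrArg Prod.fst this

theorem exists_contDiffAt_rightInverse_ker [CompleteSpace W] {P : X → W →L[ℝ] B} {x : X}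
    (hP : ContDiffAt ℝ n P x) {s₀ : B →L[ℝ] W} (hs₀ : ∀ b, P x (s₀ b) = b) :
    ∃ (s : X → B →L[ℝ] W) (κ : X → LinearMap.ker (P x : W →ₗ[ℝ] B) →L[ℝ] W),
      ContDiffAt ℝ n s x ∧ ContDiffAt ℝ n κ x ∧
      ∀ᶠ y in 𝓝 x, (∀ b, P y (s y b) = b) ∧ (∀ k, P y (κ y k) = 0) ∧ Function.Injective (κ y) ∧
        ∀ w, P y w = 0 → ∃ k, κ y k = w := by
  obtain ⟨S, hS, hPS⟩ := exists_contDiffAt_splitting hP hs₀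
  refine ⟨fun y ↦ S y ∘L ContinuousLinearMap.inl ℝ B _,
    fun y ↦ S y ∘L ContinuousLinearMap.inr ℝ B _,
    hS.clm_comp contDiffAt_const, hS.clm_comp contDiffAt_const, ?_⟩
  filter_upwards [hPS] with y hy
  obtain ⟨⟨injective, surjective⟩, hPy⟩ := hy
  refine ⟨fun b ↦ hPy b 0, hPy 0, fun k l hkl ↦ congrArg Prod.snd (injective hkl), fun w hw ↦ ?_⟩
  obtain ⟨⟨b, k⟩, rfl⟩ := surjective w
  obtain rfl : 0 = b := hw.symm.trans (hPy b k)
  exact ⟨k, rfl⟩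

/-- The sum of the tangent space of the submanifold and of the images of the vertical space under
the complex structures, the vertical space being parametrized by `κ`. -/
noncomputable def sumMap (J : Fin 3 → E →L[ℝ] E) (F : W →L[ℝ] E) (κ : K →L[ℝ] W) :
    W × (Fin 3 → K) →L[ℝ] E :=
  F ∘L ContinuousLinearMap.fst ℝ W (Fin 3 → K) +
    ∑ i, J i ∘L F ∘L κ ∘L ContinuousLinearMap.proj i ∘L ContinuousLinearMap.snd ℝ W (Fin 3 → K)

theorem sumMap_apply (J : Fin 3 → E →L[ℝ] E) (F : W →L[ℝ] E) (κ : K →L[ℝ] W)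
    (u : W × (Fin 3 → K)) : sumMap J F κ u = F u.1 + ∑ i, J i (F (κ (u.2 i))) := by
  simp [sumMap, sum_apply]

theorem contDiffAt_sumMap {J : X → Fin 3 → E →L[ℝ] E} {F : X → W →L[ℝ] E} {κ : X → K →L[ℝ] W}
    {x : X} (hJ : ∀ i, ContDiffAt ℝ n (fun y ↦ J y i) x) (hF : ContDiffAt ℝ n F x)
    (hκ : ContDiffAt ℝ n κ x) : ContDiffAt ℝ n (fun y ↦ sumMap (J y) (F y) (κ y)) x :=
  (hF.clm_comp contDiffAt_const).add (ContDiffAt.sum fun i _ ↦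
    (hJ i).clm_comp (hF.clm_comp (hκ.clm_comp contDiffAt_const)))

namespace IsLinearReduction

variable {G : E →L[ℝ] E →L[ℝ] ℝ} {J : Fin 3 → E →L[ℝ] E} {F : W →L[ℝ] E} {P : W →L[ℝ] B}
  {κ : K →L[ℝ] W}

theorem metric_sumMap (H : IsLinearReduction G J F P) (hPκ : ∀ k, P (κ k) = 0)
    (u : W × (Fin 3 → K)) (j : Fin 3) {z : E} (hz : z ∈ vert F P) :
    G (sumMap J F κ u) (J j z) = G (F (κ (u.2 j))) z := by
  have vertical (i : Fin 3) : F (κ (u.2 i)) ∈ vert F P := mem_vert.2 ⟨_, hPκ _, rfl⟩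
  rw [sumMap_apply, map_add, add_apply, (H.mem_tangent _).2 ⟨u.1, rfl⟩ j z hz, zero_add, map_sum,
    sum_apply, Finset.sum_eq_single j
      (fun i _ hij ↦ H.quatSplit.orthogonal_of_ne hij (vertical i) hz) (by simp),
    H.quatSplit.isometry]

theorem injective_sumMap (H : IsLinearReduction G J F P) (hF : Function.Injective F)
    (hκ : Function.Injective κ) (hPκ : ∀ k, P (κ k) = 0) :
    Function.Injective (sumMap J F κ) := by
  rw [injective_iff_map_eq_zero]
  rintro ⟨w, k⟩ hu
  obtain rfl : k = 0 := by
    funext j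
    refine (map_eq_zero_iff (F ∘L κ) (hF.comp hκ)).1
      (H.quatSplit.eq_zero_of_mem (mem_vert.2 ⟨_, hPκ _, rfl⟩) fun z hz ↦ ?_)
    have := H.metric_sumMap hPκ (w, k) j hz
    rwa [hu, map_zero, zero_apply, eq_comm] at this
  simpa [sumMap_apply, map_eq_zero_iff F hF] using hu

theorem surjective_sumMap (H : IsLinearReduction G J F P) (hPκ : ∀ k, P (κ k) = 0)
    (hκ : ∀ w, P w = 0 → ∃ k, κ k = w) : Function.Surjective (sumMap J F κ) := by
  intro v
  have (i : Fin 3) : ∃ k, ∀ z ∈ vert F P, G (-J i v - F (κ k)) z = 0 := by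
    obtain ⟨z, hz, orth⟩ := H.quatSplit.split (-J i v)
    obtain ⟨w, hw, rfl⟩ := mem_vert.1 hz
    obtain ⟨k, rfl⟩ := hκ w hw
    exact ⟨k, orth⟩
  choose k hk using this
  obtain ⟨w, hw⟩ := (H.mem_tangent (v - sumMap J F κ (0, k))).1 fun j z hz ↦ by
    have := hk j z hz
    rw [map_sub, sub_apply, map_neg, neg_apply, H.quatSplit.skew, neg_neg] at this
    rwa [map_sub, sub_apply, H.metric_sumMap hPκ _ j hz]
  exact ⟨(w, k), by simpa [sumMap_apply, eq_sub_iff_add_eq] using hw⟩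

theorem metric_sub_of_sumMap_eq (H : IsLinearReduction G J F P) (hPκ : ∀ k, P (κ k) = 0) {w : W}
    {u : W × (Fin 3 → K)} {j : Fin 3} (hu : sumMap J F κ u = J j (F w)) {z : E}
    (hz : z ∈ vert F P) : G (F (w - κ (u.2 j))) z = 0 := by
  have := H.metric_sumMap hPκ u j hz
  rw [hu, H.quatSplit.isometry] at this
  rw [map_sub, map_sub, sub_apply, this, sub_self]

end IsLinearReduction

/-- The horizontal lift is `s - κ c`, where `s` is any smooth right inverse of `P` and `κ c` is the
vertical part of `s`, found by decomposing `J 0 F s` with `sumMap`. -/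
theorem exists_contDiffAt_lift [CompleteSpace E] [CompleteSpace W] {G : X → E →L[ℝ] E →L[ℝ] ℝ}
    {J : X → Fin 3 → E →L[ℝ] E} {F : X → W →L[ℝ] E} {P : X → W →L[ℝ] B} {x : X}
    (hJ : ∀ i, ContDiffAt ℝ n (fun y ↦ J y i) x) (hF : ContDiffAt ℝ n F x)
    (hP : ContDiffAt ℝ n P x) (H : ∀ᶠ y in 𝓝 x, IsLinearReduction (G y) (J y) (F y) (P y))
    (hinj : Function.Injective (F x)) {s₀ : B →L[ℝ] W} (hs₀ : ∀ b, P x (s₀ b) = b) :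
    ∃ h : X → B →L[ℝ] W, ContDiffAt ℝ n h x ∧
      ∀ᶠ y in 𝓝 x, ∀ b, P y (h y b) = b ∧ ∀ z ∈ vert (F y) (P y), G y (F y (h y b)) z = 0 := by
  obtain ⟨s, κ, hs, hκ, splitting⟩ := exists_contDiffAt_rightInverse_ker hP hs₀
  have : CompleteSpace (LinearMap.ker (P x : W →ₗ[ℝ] B)) := (P x).isClosed_ker.completeSpace_coe
  set A := fun y ↦ sumMap (J y) (F y) (κ y)
  have hA : ContDiffAt ℝ n A x := contDiffAt_sumMap hJ hF hκ
  have invertible_A : (A x).IsInvertible := by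
    obtain ⟨-, hPκ, injective, surjective⟩ := splitting.self_of_nhds
    exact ⟨ContinuousLinearEquiv.ofBijective (A x)
      (LinearMap.ker_eq_bot.2 (H.self_of_nhds.injective_sumMap hinj injective hPκ))
      (LinearMap.range_eq_top.2 (H.self_of_nhds.surjective_sumMap hPκ surjective)), rfl⟩
  let c (y : X) : B →L[ℝ] LinearMap.ker (P x : W →ₗ[ℝ] B) :=
    ContinuousLinearMap.proj (0 : Fin 3) ∘L ContinuousLinearMap.snd ℝ W _ ∘L
      (A y).inverse ∘L J y 0 ∘L F y ∘L s y
  have hc : ContDiffAt ℝ n c x := contDiffAt_const.clm_comp (contDiffAt_const.clm_comp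
    ((contDiffAt_inverse_comp hA invertible_A).clm_comp ((hJ 0).clm_comp (hF.clm_comp hs))))
  refine ⟨fun y ↦ s y - κ y ∘L c y, hs.sub (hκ.clm_comp hc), ?_⟩
  filter_upwards [H, splitting, eventually_isInvertible hA.continuousAt invertible_A]
    with y reduction hy hAy b
  obtain ⟨hPs, hPκ, -, -⟩ := hy
  refine ⟨?_, fun z hz ↦ reduction.metric_sub_of_sumMap_eq hPκ (hAy.self_apply_inverse _) hz⟩
  rw [sub_apply, map_sub, ContinuousLinearMap.comp_apply, hPκ, hPs, sub_zero]

end SmoothLift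

section LocalInverse

variable {E : Type*} [NormedAddCommGroup E] [NormedSpace ℝ E]
  {M : Type*} [TopologicalSpace M] [ChartedSpace E M]
  {E' : Type*} [NormedAddCommGroup E'] [NormedSpace ℝ E']
  {N : Type*} [TopologicalSpace N] [ChartedSpace E' N]

theorem exists_leftInverse_of_isImmersionAt {f : N → M} {x : N}
    (h : Manifold.IsImmersionAt 𝓘(ℝ, E') 𝓘(ℝ, E) ∞ f x) :
    ∃ r : M → N, ContMDiffAt 𝓘(ℝ, E) 𝓘(ℝ, E') ∞ r (f x) ∧ ∀ᶠ y in 𝓝 x, r (f y) = y := by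
  set a := h.domChart.extend 𝓘(ℝ, E') with ha
  set b := h.codChart.extend 𝓘(ℝ, E) with hb
  let fstr : E → E' := fun v ↦ (h.equiv.symm v).1
  have fstr_eq {y : N} (hy : y ∈ h.domChart.source) : fstr (b (f y)) = a y := by
    have hya : y ∈ a.source := by simpa [ha] using hy
    have written := h.writtenInCharts (a.map_source hya)
    simp only [Function.comp_apply, ← ha, ← hb, a.left_inv hya] at written
    simp [fstr, written]
  have hx := h.mem_domChart_source
  refine ⟨fun z ↦ a.symm (fstr (b z)), ?_, ?_⟩
  · have smooth_b : ContMDiffAt 𝓘(ℝ, E) 𝓘(ℝ, E) ∞ b (f x) :=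
      contMDiffAt_of_mem_maximalAtlas h.codChart_mem_maximalAtlas h.mem_codChart_source
    have smooth_fstr : ContMDiffAt 𝓘(ℝ, E) 𝓘(ℝ, E') ∞ fstr (b (f x)) :=
      (contDiff_fst.comp h.equiv.symm.contDiff).contDiffAt.contMDiffAt
    have smooth_a : ContMDiffAt 𝓘(ℝ, E') 𝓘(ℝ, E') ∞ a.symm (fstr (b (f x))) := by
      rw [fstr_eq hx]
      exact contMDiffAt_symm_of_mem_maximalAtlas h.domChart_mem_maximalAtlas
        (h.domChart.map_source hx)
    exact smooth_a.comp (f x) (smooth_fstr.comp (f x) smooth_b)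
  · filter_upwards [h.domChart.open_source.mem_nhds hx] with y hy
    rw [fstr_eq hy]
    exact a.left_inv (by simpa [ha] using hy)

theorem exists_rightInverse_of_isSubmersionAt {f : N → M} {x : N}
    (h : Manifold.IsSubmersionAt 𝓘(ℝ, E') 𝓘(ℝ, E) ∞ f x) :
    ∃ s : M → N, ContMDiffAt 𝓘(ℝ, E) 𝓘(ℝ, E') ∞ s (f x) ∧ s (f x) = x ∧
      ∀ᶠ y in 𝓝 (f x), f (s y) = y := by
  set a := h.domChart.extend 𝓘(ℝ, E') with ha
  set b := h.codChart.extend 𝓘(ℝ, E) with hb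
  let j : E → E' := fun v ↦ h.equiv.symm (v, (h.equiv (a x)).2)
  have hx := h.mem_domChart_source
  have hxa : x ∈ a.source := by simpa [ha] using hx
  have written {v : E'} (hv : v ∈ a.target) : b (f (a.symm v)) = (h.equiv v).1 :=
    h.writtenInCharts hv
  have j_eq : j (b (f x)) = a x := by
    have := written (a.map_source hxa)
    rw [a.left_inv hxa] at this
    simp [j, this]
  have smooth_j : ContMDiffAt 𝓘(ℝ, E) 𝓘(ℝ, E') ∞ (j ∘ b) (f x) :=
    (h.equiv.symm.contDiff.comp
      (contDiff_id.prodMk contDiff_const)).contDiffAt.contMDiffAt.comp (f x)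
      (contMDiffAt_of_mem_maximalAtlas h.codChart_mem_maximalAtlas h.mem_codChart_source)
  have smooth : ContMDiffAt 𝓘(ℝ, E) 𝓘(ℝ, E') ∞ (a.symm ∘ j ∘ b) (f x) := by
    refine ContMDiffAt.comp (I' := 𝓘(ℝ, E')) (f x) ?_ smooth_j
    rw [Function.comp_apply, j_eq]
    exact contMDiffAt_symm_of_mem_maximalAtlas h.domChart_mem_maximalAtlas
      (h.domChart.map_source hx)
  have fixed : (a.symm ∘ j ∘ b) (f x) = x := by simp [j_eq, a.left_inv hxa]
  refine ⟨a.symm ∘ j ∘ b, smooth, fixed, ?_⟩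
  have target_mem : a.target ∈ 𝓝 ((j ∘ b) (f x)) := by
    rw [Function.comp_apply, j_eq]
    exact h.domChart.isOpen_extend_target.mem_nhds (a.map_source hxa)
  have source_mem : h.domChart.source ∈ 𝓝 ((a.symm ∘ j ∘ b) (f x)) := by
    rw [fixed]
    exact h.domChart.open_source.mem_nhds hx
  filter_upwards [smooth_j.continuousAt.preimage_mem_nhds target_mem,
    smooth.continuousAt.preimage_mem_nhds source_mem,
    h.codChart.open_source.mem_nhds h.mem_codChart_source] with z hza hz hzb
  refine b.injOn (by simpa [hb] using h.source_subset_preimage_source hz) (by simpa [hb] using hzb)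
    ((written hza).trans ?_)
  simp [j]

end LocalInverse

section MapsInCharts

variable {E : Type*} [NormedAddCommGroup E] [NormedSpace ℝ E]
  {M : Type*} [TopologicalSpace M] [ChartedSpace E M]
  {E' : Type*} [NormedAddCommGroup E'] [NormedSpace ℝ E']
  {N : Type*} [TopologicalSpace N] [ChartedSpace E' N]
  {F : N → M} {z x : N}

theorem writtenInExtChartAt_extChartAt_of_mem (hx : x ∈ (chartAt E' z).source) :
    writtenInExtChartAt 𝓘(ℝ, E') 𝓘(ℝ, E) z F (extChartAt 𝓘(ℝ, E') z x) =
      extChartAt 𝓘(ℝ, E) (F z) (F x) := by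
  simp only [writtenInExtChartAt, Function.comp_apply,
    (extChartAt 𝓘(ℝ, E') z).left_inv (by simpa using hx)]

theorem fderiv_writtenInExtChartAt_self (hF : MDifferentiableAt 𝓘(ℝ, E') 𝓘(ℝ, E) F z) :
    fderiv ℝ (writtenInExtChartAt 𝓘(ℝ, E') 𝓘(ℝ, E) z F) (extChartAt 𝓘(ℝ, E') z z) =
      mfderiv 𝓘(ℝ, E') 𝓘(ℝ, E) F z := by
  rw [hF.mfderiv, modelWithCornersSelf_coe, range_id, fderivWithin_univ]

/-- The equality of points is a hypothesis so that the lemma applies to base points that agree only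
propositionally. -/
theorem mfderiv_comp_eq_of_eq {E'' : Type*} [NormedAddCommGroup E''] [NormedSpace ℝ E'']
    {N' : Type*} [TopologicalSpace N'] [ChartedSpace E'' N'] {f : N' → N} {y : N'}
    (hf : MDifferentiableAt 𝓘(ℝ, E'') 𝓘(ℝ, E') f y) (hyx : f y = x)
    (hF : MDifferentiableAt 𝓘(ℝ, E') 𝓘(ℝ, E) F x) :
    mfderiv 𝓘(ℝ, E'') 𝓘(ℝ, E) (F ∘ f) y =
      (mfderiv 𝓘(ℝ, E') 𝓘(ℝ, E) F x : E' →L[ℝ] E) ∘L mfderiv 𝓘(ℝ, E'') 𝓘(ℝ, E') f y := by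
  subst hyx
  exact mfderiv_comp y hF hf

theorem injective_mfderiv_of_isImmersionAt
    (h : Manifold.IsImmersionAt 𝓘(ℝ, E') 𝓘(ℝ, E) ∞ F z) :
    Function.Injective (mfderiv 𝓘(ℝ, E') 𝓘(ℝ, E) F z) := by
  obtain ⟨r, hr, hrF⟩ := exists_leftInverse_of_isImmersionAt h
  have hcomp := mfderiv_comp z (hr.mdifferentiableAt (by simp))
    (h.contMDiffAt.mdifferentiableAt (by simp))
  rw [(show r ∘ F =ᶠ[𝓝 z] id from hrF).mfderiv_eq, mfderiv_id] at hcomp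
  exact Function.LeftInverse.injective fun v ↦ (DFunLike.congr_fun hcomp v).symm

theorem exists_rightInverse_mfderiv_of_isSubmersionAt
    (h : Manifold.IsSubmersionAt 𝓘(ℝ, E') 𝓘(ℝ, E) ∞ F z) :
    ∃ s : E →L[ℝ] E', ∀ b, mfderiv 𝓘(ℝ, E') 𝓘(ℝ, E) F z (s b) = b := by
  obtain ⟨s, hs, hsz, hFs⟩ := exists_rightInverse_of_isSubmersionAt h
  have hcomp := mfderiv_comp_eq_of_eq (hs.mdifferentiableAt (by simp)) hsz
    (h.contMDiffAt.mdifferentiableAt (by simp))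
  rw [(show F ∘ s =ᶠ[𝓝 (F z)] id from hFs).mfderiv_eq, mfderiv_id] at hcomp
  exact ⟨mfderiv 𝓘(ℝ, E) 𝓘(ℝ, E') s (F z), fun b ↦ (DFunLike.congr_fun hcomp b).symm⟩

variable [IsManifold 𝓘(ℝ, E) ∞ M] [IsManifold 𝓘(ℝ, E') ∞ N]

theorem contDiffAt_writtenInExtChartAt (hx : x ∈ (chartAt E' z).source)
    (hFx : F x ∈ (chartAt E (F z)).source) (hF : ContMDiffAt 𝓘(ℝ, E') 𝓘(ℝ, E) ∞ F x) :
    ContDiffAt ℝ ∞ (writtenInExtChartAt 𝓘(ℝ, E') 𝓘(ℝ, E) z F) (extChartAt 𝓘(ℝ, E') z x) := by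
  have hinv : (extChartAt 𝓘(ℝ, E') z).symm (extChartAt 𝓘(ℝ, E') z x) = x :=
    (extChartAt 𝓘(ℝ, E') z).left_inv (by simpa using hx)
  exact contMDiffAt_iff_contDiffAt.1 ((contMDiffAt_chart hFx).comp_of_eq
    (hF.comp_of_eq (contMDiffAt_chart_symm hx) hinv) (congrArg F hinv))

theorem fderiv_writtenInExtChartAt (hx : x ∈ (chartAt E' z).source)
    (hFx : F x ∈ (chartAt E (F z)).source) (hF : ContMDiffAt 𝓘(ℝ, E') 𝓘(ℝ, E) ∞ F x) :
    fderiv ℝ (writtenInExtChartAt 𝓘(ℝ, E') 𝓘(ℝ, E) z F) (extChartAt 𝓘(ℝ, E') z x) =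
      toModel E (F z) (F x) ∘L mfderiv 𝓘(ℝ, E') 𝓘(ℝ, E) F x ∘L ofModel E' z x := by
  ext v
  rw [← mvfderiv_ofModel (k := extChartAt 𝓘(ℝ, E) (F z) ∘ F) hx
    (fun x' hx' ↦ (writtenInExtChartAt_extChartAt_of_mem hx').symm)
    ((contDiffAt_writtenInExtChartAt hx hFx hF).differentiableAt (by simp)), mvfderiv,
    mfderiv_comp x ((contMDiffAt_chart hFx).mdifferentiableAt (by simp))
      (hF.mdifferentiableAt (by simp)), toModel_eq_mfderiv hFx]
  rfl

theorem exists_leftInverse_writtenInExtChartAt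
    (h : Manifold.IsImmersionAt 𝓘(ℝ, E') 𝓘(ℝ, E) ∞ F z) :
    ∃ r : E → E', ContDiffAt ℝ ∞ r (extChartAt 𝓘(ℝ, E) (F z) (F z)) ∧
      ∀ᶠ x in 𝓝 z, r (extChartAt 𝓘(ℝ, E) (F z) (F x)) = extChartAt 𝓘(ℝ, E') z x := by
  obtain ⟨r, hr, hrF⟩ := exists_leftInverse_of_isImmersionAt h
  have hrz : r (F z) = z := hrF.self_of_nhds
  refine ⟨writtenInExtChartAt 𝓘(ℝ, E) 𝓘(ℝ, E') (F z) r,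
    contDiffAt_writtenInExtChartAt (mem_chart_source E (F z)) (mem_chart_source E' _) hr, ?_⟩
  filter_upwards [hrF, h.continuousAt.preimage_mem_nhds
    ((chartAt E (F z)).open_source.mem_nhds (mem_chart_source E (F z)))] with x hx hFx
  rw [writtenInExtChartAt_extChartAt_of_mem hFx, hx, hrz]

end MapsInCharts

section Transport

open scoped MultilinearInstances

variable {E : Type*} [NormedAddCommGroup E] [NormedSpace ℝ E]
  {E' : Type*} [NormedAddCommGroup E'] [NormedSpace ℝ E']
  {G : E →L[ℝ] E →L[ℝ] ℝ} {G' : E' →L[ℝ] E' →L[ℝ] ℝ} {J : Fin 3 → E →L[ℝ] E}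
  {J' : Fin 3 → E' →L[ℝ] E'} {T : E →L[ℝ] E'}

theorem IsQuatSplit.map {V : Submodule ℝ E} (H : IsQuatSplit G J V)
    (hT : Function.Surjective T) (hG : ∀ v w, G' (T v) (T w) = G v w)
    (hJ : ∀ i v, J' i (T v) = T (J i v)) : IsQuatSplit G' J' (V.map (T : E →ₗ[ℝ] E')) where
  symm := hT.forall₂.2 fun v w ↦ by rw [hG, hG, H.symm]
  pos := hT.forall.2 fun v hv ↦ by
    rw [hG]
    exact H.pos v fun h ↦ hv (by rw [h, map_zero])
  square i := hT.forall.2 fun v ↦ by rw [hJ, hJ, H.square, map_neg]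
  anticomm i j hij := hT.forall.2 fun v ↦ by
    simp only [hJ, H.anticomm i j hij, map_neg]
  triple := hT.forall.2 fun v ↦ by rw [hJ, hJ, hJ, H.triple, map_neg]
  isometry i := hT.forall₂.2 fun v w ↦ by rw [hJ, hJ, hG, hG, H.isometry]
  orthogonal := by
    rintro i _ ⟨v, hv, rfl⟩ _ ⟨w, hw, rfl⟩
    exact (congrArg (G' (T v)) (hJ i w)).trans ((hG _ _).trans (H.orthogonal i v hv w hw))
  split := hT.forall.2 fun v ↦ by
    obtain ⟨z, hz, orth⟩ := H.split v
    refine ⟨T z, Submodule.mem_map_of_mem hz, ?_⟩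
    rintro _ ⟨w, hw, rfl⟩
    rw [← map_sub]
    exact (hG _ _).trans (orth w hw)

variable {W : Type*} [NormedAddCommGroup W] [NormedSpace ℝ W]
  {W' : Type*} [NormedAddCommGroup W'] [NormedSpace ℝ W']
  {B : Type*} [NormedAddCommGroup B] [NormedSpace ℝ B]
  {B' : Type*} [NormedAddCommGroup B'] [NormedSpace ℝ B']
  {F : W →L[ℝ] E} {P : W →L[ℝ] B} {S : W' →L[ℝ] W} {R : B →L[ℝ] B'}

theorem vert_comp (hS : Function.Surjective S) (hR : Function.Injective R) :
    vert (T ∘L F ∘L S) (R ∘L P ∘L S) = (vert F P).map (T : E →ₗ[ℝ] E') := by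
  ext v
  simp only [Submodule.mem_map, mem_vert, ContinuousLinearMap.comp_apply, map_eq_zero_iff R hR]
  constructor
  · rintro ⟨k, hk, rfl⟩
    exact ⟨F (S k), ⟨S k, hk, rfl⟩, rfl⟩
  · rintro ⟨_, ⟨k, hk, rfl⟩, rfl⟩
    obtain ⟨k, rfl⟩ := hS k
    exact ⟨k, hk, rfl⟩

theorem IsLinearReduction.map (H : IsLinearReduction G J F P) (hT : Function.Surjective T)
    (hS : Function.Surjective S) (hR : Function.Injective R)
    (hG : ∀ v w, G' (T v) (T w) = G v w) (hJ : ∀ i v, J' i (T v) = T (J i v)) :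
    IsLinearReduction G' J' (T ∘L F ∘L S) (R ∘L P ∘L S) where
  quatSplit := by
    rw [vert_comp hS hR]
    exact H.quatSplit.map hT hG hJ
  mem_tangent := by
    have orthogonal_iff (v : E) : (∀ i, ∀ w ∈ vert (T ∘L F ∘L S) (R ∘L P ∘L S),
        G' (T v) (J' i w) = 0) ↔ ∃ w, F w = v := by
      rw [← H.mem_tangent, vert_comp hS hR]
      simp only [Submodule.mem_map, forall_exists_index, and_imp, forall_apply_eq_imp_iff₂,
        ContinuousLinearMap.coe_coe, hJ, hG]
    refine hT.forall.2 fun v ↦ ⟨fun h ↦ ?_, ?_⟩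
    · obtain ⟨w, rfl⟩ := (orthogonal_iff v).1 h
      obtain ⟨w, rfl⟩ := hS w
      exact ⟨w, rfl⟩
    · rintro ⟨w, hw⟩
      rw [← hw]
      exact (orthogonal_iff _).2 ⟨S w, rfl⟩

end Transport

section MomentMap

variable {L : Type*} [NormedAddCommGroup L] [NormedSpace ℝ L]
  {G : Type*} [TopologicalSpace G] [ChartedSpace L G] [Group G]
  {E : Type*} [NormedAddCommGroup E] [NormedSpace ℝ E]
  {M : Type*} [TopologicalSpace M] [ChartedSpace E M]
  [MulAction G M] [ContMDiffSMul 𝓘(ℝ, L) 𝓘(ℝ, E) ∞ G M]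

theorem contMDiff_smul_const (m : M) : ContMDiff 𝓘(ℝ, L) 𝓘(ℝ, E) ∞ (fun h : G ↦ h • m) :=
  contMDiff_id.smul contMDiff_const

theorem mvfderiv_fund {F : Type*} [NormedAddCommGroup F] [NormedSpace ℝ F] {f : M → F} {m : M}
    (hf : MDifferentiableAt 𝓘(ℝ, E) 𝓘(ℝ, F) f m) (ρ : L) :
    mvfderiv 𝓘(ℝ, E) f m (fund L G E m ρ) =
      mvfderiv 𝓘(ℝ, L) (fun h : G ↦ f (h • m)) 1 ρ := by
  have hcomp := mfderiv_comp_eq_of_eq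
    ((contMDiff_smul_const (G := G) (L := L) (E := E) m).mdifferentiable (by simp) 1)
    (one_smul G m) hf
  exact (DFunLike.congr_fun hcomp ρ).symm

theorem IsHyperkahlerMomentMap.metric_fund_fund {g : BilinField E M} {J : Fin 3 → EndoField E M}
    {μ : Fin 3 → M → (L →L[ℝ] ℝ)} (hμ : IsHyperkahlerMomentMap G g J μ)
    {c : Fin 3 → (L →L[ℝ] ℝ)} (hc : ∀ (h : G) (i : Fin 3), coAd h (c i) = c i) {m : M}
    (hm : m ∈ levelSet μ c) (i : Fin 3) (ρ σ : L) :
    g m (fund L G E m ρ) (J i m (fund L G E m σ)) = 0 := by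
  rw [← hμ.deriv_eq, mvfderiv_fund ((hμ.smooth i).mdifferentiable (by simp) m)]
  have constant_on_orbit : (fun h : G ↦ μ i (h • m)) = fun _ ↦ c i := by
    funext h
    rw [hμ.equivariant, hm i, hc]
  rw [constant_on_orbit, mvfderiv, mfderiv_const]
  rfl

end MomentMap

section HyperkahlerQuotient

open scoped MultilinearInstances

variable {L : Type*} [NormedAddCommGroup L] [NormedSpace ℝ L]
  {G : Type*} [TopologicalSpace G] [ChartedSpace L G] [Group G]
  {E : Type*} [NormedAddCommGroup E] [NormedSpace ℝ E]
  {M : Type*} [TopologicalSpace M] [ChartedSpace E M] [IsManifold 𝓘(ℝ, E) ∞ M]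
  [MulAction G M]
  {Ec : Type*} [NormedAddCommGroup Ec] [NormedSpace ℝ Ec]
  {EQ : Type*} [NormedAddCommGroup EQ] [NormedSpace ℝ EQ]
  {g : BilinField E M} {D : Connection E M} {J : Fin 3 → EndoField E M}
  {μ : Fin 3 → M → (L →L[ℝ] ℝ)} {c : Fin 3 → (L →L[ℝ] ℝ)}
  [ChartedSpace Ec (levelSet μ c)] [ChartedSpace EQ (Quo G μ c)]
  [IsManifold 𝓘(ℝ, EQ) ∞ (Quo G μ c)]
  {gQ : BilinField EQ (Quo G μ c)}

variable (E Ec) in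
/-- The derivative of the inclusion of the level set. -/
noncomputable abbrev dInc (x : levelSet μ c) :
    TangentSpace 𝓘(ℝ, Ec) x →L[ℝ] TangentSpace 𝓘(ℝ, E) (x : M) :=
  mfderiv 𝓘(ℝ, Ec) 𝓘(ℝ, E) (Subtype.val : levelSet μ c → M) x

variable (G Ec EQ) in
/-- The derivative of the projection to the quotient. -/
noncomputable abbrev dProj (x : levelSet μ c) :
    TangentSpace 𝓘(ℝ, Ec) x →L[ℝ] TangentSpace 𝓘(ℝ, EQ) (proj G μ c x) :=
  mfderiv 𝓘(ℝ, Ec) 𝓘(ℝ, EQ) (proj G μ c) x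

variable (Ec) in
/-- `(Quo G μ c, gQ)` is the hyperkähler quotient of `(M, g, D, J)` at the level `c`. -/
structure IsHyperkahlerQuotient (g : BilinField E M) (D : Connection E M)
    (J : Fin 3 → EndoField E M) (μ : Fin 3 → M → (L →L[ℝ] ℝ)) (c : Fin 3 → (L →L[ℝ] ℝ))
    [ChartedSpace Ec (levelSet μ c)] [ChartedSpace EQ (Quo G μ c)]
    [IsManifold 𝓘(ℝ, EQ) ∞ (Quo G μ c)] (gQ : BilinField EQ (Quo G μ c)) : Prop where
  hyperkahler : IsWeakHyperkahler g D J
  moment : IsHyperkahlerMomentMap G g J μ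
  fixed : ∀ (h : G) (i : Fin 3), coAd h (c i) = c i
  elliptic : ∀ m ∈ levelSet μ c, IsEllipticAt L G g m
  level : IsLevelSubmanifold (E := E) (Ec := Ec) μ c
  quotient : IsQuotientStructure (Ec := Ec) G g μ c gQ

namespace IsHyperkahlerQuotient

variable (H : IsHyperkahlerQuotient (G := G) Ec g D J μ c gQ) (x : levelSet μ c)

include H

theorem mdifferentiableAt_val :
    MDifferentiableAt 𝓘(ℝ, Ec) 𝓘(ℝ, E) (Subtype.val : levelSet μ c → M) x :=
  H.level.embedding.contMDiff.mdifferentiable (by simp) x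

theorem mdifferentiableAt_proj : MDifferentiableAt 𝓘(ℝ, Ec) 𝓘(ℝ, EQ) (proj G μ c) x :=
  H.quotient.submersion.contMDiff.mdifferentiable (by simp) x

theorem smul_mem_levelSet (h : G) : h • (x : M) ∈ levelSet μ c := fun i ↦ by
  rw [H.moment.equivariant, x.2 i, H.fixed]

theorem exists_dInc_eq_fund [ContMDiffSMul 𝓘(ℝ, L) 𝓘(ℝ, E) ∞ G M] (ρ : L) :
    ∃ u : TangentSpace 𝓘(ℝ, Ec) x,
      dProj G Ec EQ x u = 0 ∧ dInc E Ec x u = fund L G E (x : M) ρ := by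
  let orbit : G → levelSet μ c := fun h ↦ ⟨h • (x : M), H.smul_mem_levelSet x h⟩
  have orbit_one : orbit 1 = x := Subtype.ext (one_smul G (x : M))
  have smooth_orbit : ContMDiffAt 𝓘(ℝ, L) 𝓘(ℝ, Ec) ∞ orbit 1 :=
    (ContMDiffAt.iff_comp_isImmersionAt (φ := (Subtype.val : levelSet μ c → M))
      (H.level.embedding.isImmersion.isImmersionAt (orbit 1))).2
      ⟨((contMDiff_smul_const (L := L) (E := E) (x : M)).continuous.subtype_mk _).continuousAt,
        contMDiff_smul_const (L := L) (E := E) (x : M) 1⟩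
  have hd := smooth_orbit.mdifferentiableAt (by simp)
  have val_orbit := mfderiv_comp_eq_of_eq hd orbit_one (H.mdifferentiableAt_val x)
  have proj_orbit := mfderiv_comp_eq_of_eq hd orbit_one (H.mdifferentiableAt_proj x)
  have proj_constant : proj G μ c ∘ orbit = fun _ ↦ proj G μ c x :=
    funext fun h ↦ Quotient.sound (s := (MulAction.orbitRel G M).comap Subtype.val) ⟨h, rfl⟩
  rw [proj_constant, mfderiv_const] at proj_orbit
  exact ⟨mfderiv 𝓘(ℝ, L) 𝓘(ℝ, Ec) orbit 1 ρ, (DFunLike.congr_fun proj_orbit ρ).symm,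
    (DFunLike.congr_fun val_orbit ρ).symm⟩

theorem mem_range_dInc (v : TangentSpace 𝓘(ℝ, E) (x : M)) :
    (∃ u, dInc E Ec x u = v) ↔ ∀ i ρ, g x v (J i x (fund L G E (x : M) ρ)) = 0 := by
  refine (H.level.tangent x v).trans (forall_congr' fun i ↦ ?_)
  simp only [← H.moment.deriv_eq]
  exact ⟨fun h ρ ↦ by rw [h]; rfl, fun h ↦ ContinuousLinearMap.ext h⟩

theorem exists_isHorizontal_sub_fund (v : TangentSpace 𝓘(ℝ, E) (x : M)) :
    ∃ ρ : L, IsHorizontal L G g (v - fund L G E (x : M) ρ) := by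
  have hv : Lam L G g (x : M) v ∈ Set.range (Lam L G g (x : M)) := ⟨v, rfl⟩
  rw [H.elliptic x x.2] at hv
  obtain ⟨_, ⟨ρ, rfl⟩, hρ⟩ := hv
  refine ⟨ρ, fun σ ↦ ?_⟩
  rw [map_sub, sub_apply]
  exact sub_eq_zero.2 (DFunLike.congr_fun hρ σ).symm

theorem dInc_eq_zero {u : TangentSpace 𝓘(ℝ, Ec) x} (hu : dProj G Ec EQ x u = 0)
    (horizontal : IsHorizontal L G g (dInc E Ec x u)) : dInc E Ec x u = 0 := by
  by_contra hne
  have hpos := H.hyperkahler.isWeakMetric.pos _ _ hne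
  have hzero : gQ _ (dProj G Ec EQ x u) (dProj G Ec EQ x u) = 0 := by
    rw [hu, map_zero]
  exact hpos.ne' ((H.quotient.riemannian x u u horizontal horizontal).symm.trans hzero)

variable [ContMDiffSMul 𝓘(ℝ, L) 𝓘(ℝ, E) ∞ G M]

theorem mem_vert_iff (v : TangentSpace 𝓘(ℝ, E) (x : M)) :
    v ∈ vert (E := E) (W := Ec) (B := EQ) (dInc E Ec x) (dProj G Ec EQ x) ↔
      ∃ ρ, fund L G E (x : M) ρ = v := by
  refine (mem_vert (E := E) (W := Ec) (B := EQ)).trans ⟨?_, ?_⟩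
  · rintro ⟨(u : TangentSpace 𝓘(ℝ, Ec) x), hu, rfl⟩
    obtain ⟨ρ, hρ⟩ := H.exists_isHorizontal_sub_fund x (dInc E Ec x u)
    obtain ⟨u', hu', hρ'⟩ := H.exists_dInc_eq_fund x ρ
    rw [← hρ', ← map_sub] at hρ
    have hzero := H.dInc_eq_zero x
      ((map_sub _ _ _).trans ((congrArg₂ _ hu hu').trans (sub_zero _))) hρ
    rw [map_sub, sub_eq_zero, hρ'] at hzero
    exact ⟨ρ, hzero.symm⟩
  · rintro ⟨ρ, rfl⟩
    exact H.exists_dInc_eq_fund x ρ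

theorem metric_dProj {u : TangentSpace 𝓘(ℝ, Ec) x}
    (hu : IsHorizontal L G g (dInc E Ec x u)) (w : TangentSpace 𝓘(ℝ, Ec) x) :
    gQ (proj G μ c x) (dProj G Ec EQ x u) (dProj G Ec EQ x w) =
      g x (dInc E Ec x u) (dInc E Ec x w) := by
  obtain ⟨ρ, hρ⟩ := H.exists_isHorizontal_sub_fund x (dInc E Ec x w)
  obtain ⟨k, hk, hkρ⟩ := H.exists_dInc_eq_fund x ρ
  rw [← hkρ, ← map_sub] at hρ
  have hmetric : gQ _ (dProj G Ec EQ x u) (dProj G Ec EQ x (w - k)) =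
      g x (dInc E Ec x u) (dInc E Ec x (w - k)) := H.quotient.riemannian x u (w - k) hu hρ
  rwa [map_sub, hk, sub_zero, map_sub (dInc E Ec x), hkρ, map_sub, hu, sub_zero] at hmetric

theorem isQuatSplit :
    IsQuatSplit (E := E) (g x) (fun i ↦ J i x)
      (vert (E := E) (W := Ec) (B := EQ) (dInc E Ec x) (dProj G Ec EQ x)) where
  symm := H.hyperkahler.isWeakMetric.symm x
  pos := H.hyperkahler.isWeakMetric.pos x
  square i := H.hyperkahler.square i x
  anticomm i j hij := H.hyperkahler.anticomm i j hij x
  triple := H.hyperkahler.triple x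
  isometry i := H.hyperkahler.isometry i x
  orthogonal i v hv w hw := by
    obtain ⟨ρ, rfl⟩ := (H.mem_vert_iff x v).1 hv
    obtain ⟨σ, rfl⟩ := (H.mem_vert_iff x w).1 hw
    exact H.moment.metric_fund_fund H.fixed x.2 i ρ σ
  split v := by
    obtain ⟨ρ, hρ⟩ := H.exists_isHorizontal_sub_fund x v
    refine ⟨fund L G E (x : M) ρ, (H.mem_vert_iff x _).2 ⟨ρ, rfl⟩, fun w hw ↦ ?_⟩
    obtain ⟨σ, rfl⟩ := (H.mem_vert_iff x w).1 hw
    exact hρ σ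

theorem isLinearReduction :
    IsLinearReduction (E := E) (W := Ec) (B := EQ) (g x) (fun i ↦ J i x) (dInc E Ec x)
      (dProj G Ec EQ x) where
  quatSplit := H.isQuatSplit x
  mem_tangent v := by
    refine Iff.trans ⟨fun h i ρ ↦ h i _ ((H.mem_vert_iff x _).2 ⟨ρ, rfl⟩), fun h i w hw ↦ ?_⟩
      (H.mem_range_dInc x v).symm
    obtain ⟨ρ, rfl⟩ := (H.mem_vert_iff x w).1 hw
    exact h i ρ

end IsHyperkahlerQuotient

end HyperkahlerQuotient

section QuotientInCharts

open scoped MultilinearInstances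

variable {L : Type*} [NormedAddCommGroup L] [NormedSpace ℝ L]
  {G : Type*} [TopologicalSpace G] [ChartedSpace L G] [Group G]
  {E : Type*} [NormedAddCommGroup E] [NormedSpace ℝ E]
  {M : Type*} [TopologicalSpace M] [ChartedSpace E M] [IsManifold 𝓘(ℝ, E) ∞ M]
  [MulAction G M]
  {Ec : Type*} [NormedAddCommGroup Ec] [NormedSpace ℝ Ec]
  {EQ : Type*} [NormedAddCommGroup EQ] [NormedSpace ℝ EQ]
  {g : BilinField E M} {D : Connection E M} {J : Fin 3 → EndoField E M}
  {μ : Fin 3 → M → (L →L[ℝ] ℝ)} {c : Fin 3 → (L →L[ℝ] ℝ)}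
  [ChartedSpace Ec (levelSet μ c)] [ChartedSpace EQ (Quo G μ c)]
  [IsManifold 𝓘(ℝ, EQ) ∞ (Quo G μ c)]
  {gQ : BilinField EQ (Quo G μ c)}

variable (E Ec) in
/-- The inclusion of the level set, read in the charts at `m`. -/
noncomputable abbrev locInc (m : levelSet μ c) : Ec → E :=
  writtenInExtChartAt 𝓘(ℝ, Ec) 𝓘(ℝ, E) m (Subtype.val : levelSet μ c → M)

variable (G Ec EQ) in
/-- The projection to the quotient, read in the charts at `m`. -/
noncomputable abbrev locProj (m : levelSet μ c) : Ec → EQ :=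
  writtenInExtChartAt 𝓘(ℝ, Ec) 𝓘(ℝ, EQ) m (proj G μ c)

omit [IsManifold 𝓘(ℝ, E) ∞ M] in
theorem locInc_extChartAt {m x : levelSet μ c} (hx : x ∈ (chartAt Ec m).source) :
    locInc E Ec m (extChartAt 𝓘(ℝ, Ec) m x) = extChartAt 𝓘(ℝ, E) (m : M) (x : M) :=
  writtenInExtChartAt_extChartAt_of_mem hx

omit [TopologicalSpace G] [ChartedSpace L G] [IsManifold 𝓘(ℝ, E) ∞ M]
  [IsManifold 𝓘(ℝ, EQ) ∞ (Quo G μ c)] in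
theorem locProj_extChartAt {m x : levelSet μ c} (hx : x ∈ (chartAt Ec m).source) :
    locProj G Ec EQ m (extChartAt 𝓘(ℝ, Ec) m x) =
      extChartAt 𝓘(ℝ, EQ) (proj G μ c m) (proj G μ c x) :=
  writtenInExtChartAt_extChartAt_of_mem hx

namespace IsHyperkahlerQuotient

variable (H : IsHyperkahlerQuotient (G := G) Ec g D J μ c gQ) {m x : levelSet μ c}

include H

theorem eventually_mem_chart_source (m : levelSet μ c) :
    ∀ᶠ x in 𝓝 m, x ∈ (chartAt Ec m).source ∧ (x : M) ∈ (chartAt E (m : M)).source ∧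
      proj G μ c x ∈ (chartAt EQ (proj G μ c m)).source :=
  ((chartAt Ec m).open_source.eventually_mem (mem_chart_source Ec m)).and
    (((H.mdifferentiableAt_val m).continuousAt.eventually_mem (chart_source_mem_nhds E (m : M))).and
      ((H.mdifferentiableAt_proj m).continuousAt.eventually_mem (chart_source_mem_nhds EQ _)))

variable [IsManifold 𝓘(ℝ, Ec) ∞ (levelSet μ c)]

theorem fderiv_locInc (hx : x ∈ (chartAt Ec m).source)
    (hxM : (x : M) ∈ (chartAt E (m : M)).source) :
    fderiv ℝ (locInc E Ec m) (extChartAt 𝓘(ℝ, Ec) m x) =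
      toModel E (m : M) (x : M) ∘L dInc E Ec x ∘L ofModel Ec m x :=
  fderiv_writtenInExtChartAt hx hxM (H.level.embedding.contMDiff x)

theorem fderiv_locProj (hx : x ∈ (chartAt Ec m).source)
    (hxQ : proj G μ c x ∈ (chartAt EQ (proj G μ c m)).source) :
    fderiv ℝ (locProj G Ec EQ m) (extChartAt 𝓘(ℝ, Ec) m x) =
      toModel EQ (proj G μ c m) (proj G μ c x) ∘L dProj G Ec EQ x ∘L ofModel Ec m x :=
  fderiv_writtenInExtChartAt hx hxQ (H.quotient.submersion.contMDiff x)

theorem contDiffAt_locInc (m : levelSet μ c) :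
    ContDiffAt ℝ ∞ (locInc E Ec m) (extChartAt 𝓘(ℝ, Ec) m m) :=
  contDiffAt_writtenInExtChartAt (mem_chart_source Ec m) (mem_chart_source E (m : M))
    (H.level.embedding.contMDiff m)

theorem contDiffAt_locProj (m : levelSet μ c) :
    ContDiffAt ℝ ∞ (locProj G Ec EQ m) (extChartAt 𝓘(ℝ, Ec) m m) :=
  contDiffAt_writtenInExtChartAt (mem_chart_source Ec m) (mem_chart_source EQ _)
    (H.quotient.submersion.contMDiff m)

variable [ContMDiffSMul 𝓘(ℝ, L) 𝓘(ℝ, E) ∞ G M]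

theorem isLinearReduction_chart (hx : x ∈ (chartAt Ec m).source)
    (hxM : (x : M) ∈ (chartAt E (m : M)).source)
    (hxQ : proj G μ c x ∈ (chartAt EQ (proj G μ c m)).source) :
    IsLinearReduction (chartMetric g (m : M) (locInc E Ec m (extChartAt 𝓘(ℝ, Ec) m x)))
      (fun i ↦ chartEndo (J i) (m : M) (locInc E Ec m (extChartAt 𝓘(ℝ, Ec) m x)))
      (fderiv ℝ (locInc E Ec m) (extChartAt 𝓘(ℝ, Ec) m x))
      (fderiv ℝ (locProj G Ec EQ m) (extChartAt 𝓘(ℝ, Ec) m x)) := by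
  rw [H.fderiv_locInc hx hxM, H.fderiv_locProj hx hxQ, locInc_extChartAt hx]
  exact IsLinearReduction.map (E := E) (W := Ec) (B := EQ) (H.isLinearReduction x)
    (fun v ↦ ⟨_, toModel_ofModel hxM v⟩) (fun w ↦ ⟨_, ofModel_toModel hx w⟩)
    (Function.LeftInverse.injective fun b ↦ ofModel_toModel hxQ b)
    (chartMetric_toModel g hxM) fun i ↦ chartEndo_toModel (J i) hxM

theorem isHorizontal_dInc_ofModel (hx : x ∈ (chartAt Ec m).source)
    (hxM : (x : M) ∈ (chartAt E (m : M)).source)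
    (hxQ : proj G μ c x ∈ (chartAt EQ (proj G μ c m)).source) {a : Ec}
    (ha : ∀ z ∈ vert (fderiv ℝ (locInc E Ec m) (extChartAt 𝓘(ℝ, Ec) m x))
        (fderiv ℝ (locProj G Ec EQ m) (extChartAt 𝓘(ℝ, Ec) m x)),
      chartMetric g (m : M) (locInc E Ec m (extChartAt 𝓘(ℝ, Ec) m x))
        (fderiv ℝ (locInc E Ec m) (extChartAt 𝓘(ℝ, Ec) m x) a) z = 0) :
    IsHorizontal L G g (dInc E Ec x (ofModel Ec m x a)) := fun ρ ↦ by
  rw [H.fderiv_locInc hx hxM, H.fderiv_locProj hx hxQ, locInc_extChartAt hx] at ha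
  obtain ⟨u, hu, hρ⟩ := H.exists_dInc_eq_fund x ρ
  have vertical := ha (toModel E (m : M) x (fund L G E (x : M) ρ)) <|
    mem_vert.2 ⟨toModel Ec m x u, ?_, ?_⟩
  · exact (chartMetric_toModel g hxM _ _).symm.trans vertical
  · simp only [ContinuousLinearMap.comp_apply, ofModel_toModel hx, hu, map_zero]
  · simp only [ContinuousLinearMap.comp_apply, ofModel_toModel hx, hρ]

theorem chartMetric_fderiv_locInc (hx : x ∈ (chartAt Ec m).source)
    (hxM : (x : M) ∈ (chartAt E (m : M)).source)
    (hxQ : proj G μ c x ∈ (chartAt EQ (proj G μ c m)).source) {a : Ec}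
    (ha : ∀ z ∈ vert (fderiv ℝ (locInc E Ec m) (extChartAt 𝓘(ℝ, Ec) m x))
        (fderiv ℝ (locProj G Ec EQ m) (extChartAt 𝓘(ℝ, Ec) m x)),
      chartMetric g (m : M) (locInc E Ec m (extChartAt 𝓘(ℝ, Ec) m x))
        (fderiv ℝ (locInc E Ec m) (extChartAt 𝓘(ℝ, Ec) m x) a) z = 0) (w : Ec) :
    chartMetric g (m : M) (locInc E Ec m (extChartAt 𝓘(ℝ, Ec) m x))
        (fderiv ℝ (locInc E Ec m) (extChartAt 𝓘(ℝ, Ec) m x) a)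
        (fderiv ℝ (locInc E Ec m) (extChartAt 𝓘(ℝ, Ec) m x) w) =
      chartMetric gQ (proj G μ c m) (locProj G Ec EQ m (extChartAt 𝓘(ℝ, Ec) m x))
        (fderiv ℝ (locProj G Ec EQ m) (extChartAt 𝓘(ℝ, Ec) m x) a)
        (fderiv ℝ (locProj G Ec EQ m) (extChartAt 𝓘(ℝ, Ec) m x) w) := by
  have horizontal := H.isHorizontal_dInc_ofModel hx hxM hxQ ha
  rw [H.fderiv_locInc hx hxM, H.fderiv_locProj hx hxQ, locInc_extChartAt hx,
    locProj_extChartAt hx]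
  exact (chartMetric_toModel g hxM _ _).trans
    ((H.metric_dProj x horizontal _).symm.trans (chartMetric_toModel gQ hxQ _ _).symm)

theorem exists_contDiffAt_horizontalLift [CompleteSpace E] [CompleteSpace Ec]
    (m : levelSet μ c) :
    ∃ h : Ec → EQ →L[ℝ] Ec, ContDiffAt ℝ ∞ h (extChartAt 𝓘(ℝ, Ec) m m) ∧
      ∀ᶠ y in 𝓝 (extChartAt 𝓘(ℝ, Ec) m m), ∀ X, fderiv ℝ (locProj G Ec EQ m) y (h y X) = X ∧
        ∀ z ∈ vert (fderiv ℝ (locInc E Ec m) y) (fderiv ℝ (locProj G Ec EQ m) y),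
          chartMetric g (m : M) (locInc E Ec m y) (fderiv ℝ (locInc E Ec m) y (h y X)) z = 0 := by
  obtain ⟨s, hs⟩ := exists_rightInverse_mfderiv_of_isSubmersionAt
    (H.quotient.submersion.isSubmersionAt m)
  have contDiff_endo (i : Fin 3) : ContDiffAt ℝ ∞
      (fun y ↦ chartEndo (J i) (m : M) (locInc E Ec m y)) (extChartAt 𝓘(ℝ, Ec) m m) := by
    refine ContDiffAt.comp (g := chartEndo (J i) (m : M)) _ ?_ (H.contDiffAt_locInc m)
    rw [locInc_extChartAt (mem_chart_source Ec m)]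
    exact contDiffAt_chartEndo (H.hyperkahler.smooth i) (mem_chart_source E (m : M))
  refine exists_contDiffAt_lift (J := fun y i ↦ chartEndo (J i) (m : M) (locInc E Ec m y))
    contDiff_endo ((H.contDiffAt_locInc m).fderiv_right (by simp))
    ((H.contDiffAt_locProj m).fderiv_right (by simp)) (eventually_nhds_extChartAt_iff.2 ?_)
    ?_ (s₀ := s) fun b ↦ ?_
  · filter_upwards [H.eventually_mem_chart_source m] with x ⟨hx, hxM, hxQ⟩
    exact H.isLinearReduction_chart hx hxM hxQ
  · rw [fderiv_writtenInExtChartAt_self (H.mdifferentiableAt_val m)]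
    exact injective_mfderiv_of_isImmersionAt (H.level.embedding.isImmersion.isImmersionAt m)
  · rw [fderiv_writtenInExtChartAt_self (H.mdifferentiableAt_proj m)]
    exact hs b

theorem exists_isLocalQuotient [CompleteSpace E] [CompleteSpace Ec] (m : levelSet μ c) :
    ∃ h : Ec → EQ →L[ℝ] Ec, ContDiffAt ℝ ∞ h (extChartAt 𝓘(ℝ, Ec) m m) ∧
      IsLocalQuotient (chartMetric g (m : M)) (chartMetric gQ (proj G μ c m)) (locInc E Ec m)
        (locProj G Ec EQ m) h (extChartAt 𝓘(ℝ, Ec) m m) := by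
  obtain ⟨h, smooth_h, hh⟩ := H.exists_contDiffAt_horizontalLift m
  have two_le : (2 : ℕ∞ω) ≤ (∞ : ℕ∞ω) := WithTop.coe_le_coe.2 le_top
  have hm := mem_chart_source Ec m
  have hM := mem_chart_source E (m : M)
  have hQ := mem_chart_source EQ (proj G μ c m)
  refine ⟨h, smooth_h, ?_, ?_, (H.contDiffAt_locInc m).of_le (WithTop.coe_le_coe.2 le_top),
    (H.contDiffAt_locProj m).of_le two_le, smooth_h.of_le two_le, ?_, ?_,
    hh.mono fun y hy X ↦ (hy X).1, ?_⟩
  · rw [locInc_extChartAt hm]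
    exact (contDiffAt_chartMetric H.hyperkahler.isWeakMetric hM).of_le two_le
  · rw [locProj_extChartAt hm]
    exact (contDiffAt_chartMetric H.quotient.isWeakMetric hQ).of_le two_le
  · rw [locInc_extChartAt hm, eventually_nhds_extChartAt_iff]
    filter_upwards [chart_source_mem_nhds E (m : M)] with x hx
    exact H.hyperkahler.isWeakMetric.chartMetric_symm hx
  · rw [locProj_extChartAt hm, eventually_nhds_extChartAt_iff]
    filter_upwards [chart_source_mem_nhds EQ (proj G μ c m)] with x hx
    exact H.quotient.isWeakMetric.chartMetric_symm hx
  · rw [eventually_nhds_extChartAt_iff] at hh ⊢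
    filter_upwards [hh, H.eventually_mem_chart_source m] with x lift_x ⟨hx, hxM, hxQ⟩ X w
    rw [H.chartMetric_fderiv_locInc hx hxM hxQ (lift_x X).2, (lift_x X).1]

end IsHyperkahlerQuotient

end QuotientInCharts

section ONeill

open scoped MultilinearInstances

theorem fderiv_comp_leftInverse {E : Type*} [NormedAddCommGroup E] [NormedSpace ℝ E]
    {W : Type*} [NormedAddCommGroup W] [NormedSpace ℝ W]
    {F : Type*} [NormedAddCommGroup F] [NormedSpace ℝ F]
    {f : W → E} {r : E → W} {σ : W → F} {x : W} (hf : DifferentiableAt ℝ f x)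
    (hr : DifferentiableAt ℝ r (f x)) (hσ : DifferentiableAt ℝ σ x)
    (hrf : ∀ᶠ y in 𝓝 x, r (f y) = y) (a : W) :
    fderiv ℝ (σ ∘ r) (f x) (fderiv ℝ f x a) = fderiv ℝ σ x a := by
  have hσr : DifferentiableAt ℝ (σ ∘ r) (f x) := by
    rw [← hrf.self_of_nhds] at hσ
    exact hσ.comp _ hr
  have hcomp : (σ ∘ r) ∘ f =ᶠ[𝓝 x] σ := hrf.mono fun y hy ↦ congrArg σ hy
  rw [← hcomp.fderiv_eq, fderiv_comp _ hσr hf, ContinuousLinearMap.comp_apply]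

variable {L : Type*} [NormedAddCommGroup L] [NormedSpace ℝ L]
  {G : Type*} [TopologicalSpace G] [ChartedSpace L G] [Group G]
  {E : Type*} [NormedAddCommGroup E] [NormedSpace ℝ E]
  {M : Type*} [TopologicalSpace M] [ChartedSpace E M] [IsManifold 𝓘(ℝ, E) ∞ M]
  [MulAction G M]
  {g : BilinField E M} {D : Connection E M} {J : Fin 3 → EndoField E M}

namespace IsWeakHyperkahler

variable (hHK : IsWeakHyperkahler g D J) {x : M} {v : TangentSpace 𝓘(ℝ, E) x}

include hHK

theorem endo_ne_zero (hv : v ≠ 0) (i : Fin 3) : J i x v ≠ 0 := fun h ↦ by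
  have hsq := hHK.square i x v
  rw [h, map_zero, zero_eq_neg] at hsq
  exact hv hsq

theorem isHorizontal_endo (hv : IsQuatHorizontal L G g J v) (i : Fin 3) :
    IsHorizontal L G g (J i x v) := fun ρ ↦ by
  have hiso := hHK.isometry i x v (J i x (fund L G E x ρ))
  rwa [hv.2 i ρ, hHK.square, map_neg, neg_eq_zero] at hiso

theorem isQuatHorizontal_endo (hv : IsQuatHorizontal L G g J v) (i : Fin 3) :
    IsQuatHorizontal L G g J (J i x v) := by
  refine ⟨hHK.isHorizontal_endo hv i, fun j ρ ↦ ?_⟩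
  rcases eq_or_ne i j with rfl | hij
  · rw [hHK.isometry, hv.1]
  · obtain ⟨k, ε, hk⟩ := exists_mul_eq_smul (J := fun i ↦ J i x) (fun i v ↦ map_neg (J i x) v)
      (fun i ↦ hHK.square i x) (fun i j h ↦ hHK.anticomm i j h x) (hHK.triple x) hij
    have hiso := hHK.isometry i x v (J i x (J j x (fund L G E x ρ)))
    rwa [hHK.square, map_neg, hk, map_smul, hv.2 k ρ, smul_zero, neg_eq_zero] at hiso

theorem smoothFieldAt_endo {Y : (x : M) → TangentSpace 𝓘(ℝ, E) x} (hY : SmoothFieldAt Y x)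
    (i : Fin 3) : SmoothFieldAt (fun x ↦ J i x (Y x)) x :=
  (hHK.smooth i x).clm_bundle_apply hY

end IsWeakHyperkahler

theorem IsWeakMetric.metric_le_of_isONeill (hg : IsWeakMetric g) {S : Set M} {m : M}
    (finite : oneillNorm L G g D J S m ≠ ⊤) {X Y Z : TangentSpace 𝓘(ℝ, E) m}
    (hX : IsQuatHorizontal L G g J X) (hX₀ : X ≠ 0) (hY : IsQuatHorizontal L G g J Y)
    (hY₀ : Y ≠ 0) (hZ : IsONeill L G g D S m X Y Z) :
    g m Z Z ≤ (oneillNorm L G g D J S m).toReal ^ 2 * (g m X X * g m Y Y) := by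
  have quotient_le : ENNReal.ofReal (len g Z / (len g X * len g Y)) ≤ oneillNorm L G g D J S m :=
    le_iSup_of_le X (le_iSup_of_le Y (le_iSup_of_le Z (le_iSup_of_le ⟨hX, hX₀⟩
      (le_iSup_of_le ⟨hY, hY₀⟩ (le_iSup_of_le hZ le_rfl)))))
  have len_pos : 0 < len g X * len g Y :=
    mul_pos (Real.sqrt_pos.2 (hg.pos m X hX₀)) (Real.sqrt_pos.2 (hg.pos m Y hY₀))
  rw [ENNReal.ofReal_le_iff_le_toReal finite, div_le_iff₀ len_pos] at quotient_le
  have hZ_nonneg : 0 ≤ g m Z Z := by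
    rcases eq_or_ne Z 0 with rfl | hZ₀
    · rw [map_zero]
    · exact (hg.pos m Z hZ₀).le
  calc g m Z Z = len g Z ^ 2 := (Real.sq_sqrt hZ_nonneg).symm
    _ ≤ ((oneillNorm L G g D J S m).toReal * (len g X * len g Y)) ^ 2 :=
      pow_le_pow_left₀ (Real.sqrt_nonneg _) quotient_le 2
    _ = _ := by
      rw [mul_pow, mul_pow, len, len, Real.sq_sqrt (hg.pos m X hX₀).le,
        Real.sq_sqrt (hg.pos m Y hY₀).le]

variable {Ec : Type*} [NormedAddCommGroup Ec] [NormedSpace ℝ Ec]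
  {EQ : Type*} [NormedAddCommGroup EQ] [NormedSpace ℝ EQ]
  {μ : Fin 3 → M → (L →L[ℝ] ℝ)} {c : Fin 3 → (L →L[ℝ] ℝ)}
  [ChartedSpace Ec (levelSet μ c)] [ChartedSpace EQ (Quo G μ c)]
  [IsManifold 𝓘(ℝ, EQ) ∞ (Quo G μ c)]
  {gQ : BilinField EQ (Quo G μ c)} {DQ : Connection EQ (Quo G μ c)}

omit [TopologicalSpace G] [ChartedSpace L G] [Group G] [MulAction G M]
  [ChartedSpace EQ (Quo G μ c)] [IsManifold 𝓘(ℝ, EQ) ∞ (Quo G μ c)] in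
theorem chartMetric_locInc_self {m : levelSet μ c} (v w : TangentSpace 𝓘(ℝ, E) (m : M)) :
    chartMetric g (m : M) (locInc E Ec m (extChartAt 𝓘(ℝ, Ec) m m)) v w = g (m : M) v w := by
  rw [locInc_extChartAt (mem_chart_source Ec m)]
  exact chartMetric_self g v w

variable (E) in
/-- The horizontal lift to `T_m M` of the vector `X` tangent to the quotient, when `h` is the
horizontal lift in the charts at `m`. -/
noncomputable abbrev liftAt (h : Ec → EQ →L[ℝ] Ec) (m : levelSet μ c) (X : EQ) :
    TangentSpace 𝓘(ℝ, E) (m : M) :=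
  horizontalLift (E := E) (locInc E Ec m) h X (extChartAt 𝓘(ℝ, Ec) m m)

/-- The covariant derivative `∇_X Y` at `m` of the horizontal lifts given by `h` in the charts
at `m`. -/
noncomputable abbrev covDerivLiftAt (D : Connection E M) (h : Ec → EQ →L[ℝ] Ec)
    (m : levelSet μ c) (X Y : EQ) : TangentSpace 𝓘(ℝ, E) (m : M) :=
  covDerivLift (E := E) (locInc E Ec m) h (chartChristoffel D (m : M) (m : M))
    (extChartAt 𝓘(ℝ, Ec) m m) X Y

/-- The field on `M` that extends the horizontal lift of `Y` given by `h` in the charts at `m`,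
by means of a left inverse `r` of the inclusion of the level set. -/
noncomputable def horizontalField (h : Ec → EQ →L[ℝ] Ec) (r : E → Ec) (m : levelSet μ c)
    (Y : EQ) : (x : M) → TangentSpace 𝓘(ℝ, E) x :=
  chartField (m : M) (horizontalLift (locInc E Ec m) h Y ∘ r)

theorem horizontalField_self {h : Ec → EQ →L[ℝ] Ec} {r : E → Ec} {m : levelSet μ c}
    (hr : r (extChartAt 𝓘(ℝ, E) (m : M) (m : M)) = extChartAt 𝓘(ℝ, Ec) m m) (Y : EQ) :
    horizontalField h r m Y (m : M) = liftAt E h m Y :=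
  (ofModel_self (E := E) _).trans (congrArg (horizontalLift (locInc E Ec m) h Y) hr)

section LiftAt

omit [TopologicalSpace G] [ChartedSpace L G]

variable {m : levelSet μ c} {h : Ec → EQ →L[ℝ] Ec}
  (HL : IsLocalQuotient (chartMetric g (m : M)) (chartMetric gQ (proj G μ c m))
    (locInc E Ec m) (locProj G Ec EQ m) h (extChartAt 𝓘(ℝ, Ec) m m))

include HL

theorem metric_liftAt (X : EQ) : g (m : M) (liftAt E h m X) (liftAt E h m X) =
    chartMetric gQ (proj G μ c m) (locProj G Ec EQ m (extChartAt 𝓘(ℝ, Ec) m m)) X X := by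
  rw [← chartMetric_locInc_self (Ec := Ec), ← HL.metric_horizontalLift X X]

theorem liftAt_ne_zero {X : EQ} (hX : 0 <
    chartMetric gQ (proj G μ c m) (locProj G Ec EQ m (extChartAt 𝓘(ℝ, Ec) m m)) X X) :
    liftAt E h m X ≠ 0 := fun h₀ ↦ by
  rw [← metric_liftAt HL, h₀, map_zero] at hX
  exact hX.false

end LiftAt

namespace IsHyperkahlerQuotient

variable (H : IsHyperkahlerQuotient (G := G) Ec g D J μ c gQ) {m : levelSet μ c}
  {h : Ec → EQ →L[ℝ] Ec} {r : E → Ec}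

include H

section HorizontalField

variable [IsManifold 𝓘(ℝ, Ec) ∞ (levelSet μ c)]
  (hh : ContDiffAt ℝ ∞ h (extChartAt 𝓘(ℝ, Ec) m m))
  (hr : ContDiffAt ℝ ∞ r (extChartAt 𝓘(ℝ, E) (m : M) (m : M)))
  (hri : ∀ᶠ x : levelSet μ c in 𝓝 m,
    r (extChartAt 𝓘(ℝ, E) (m : M) (x : M)) = extChartAt 𝓘(ℝ, Ec) m x)

include hh in
theorem contDiffAt_horizontalLift (Y : EQ) :
    ContDiffAt ℝ ∞ (horizontalLift (locInc E Ec m) h Y) (extChartAt 𝓘(ℝ, Ec) m m) :=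
  ((H.contDiffAt_locInc m).fderiv_right (m := ∞) (by simp)).clm_apply
    (hh.clm_apply contDiffAt_const)

include hh hr hri

theorem contDiffAt_horizontalLift_comp (Y : EQ) :
    ContDiffAt ℝ ∞ (horizontalLift (locInc E Ec m) h Y ∘ r)
      (extChartAt 𝓘(ℝ, E) (m : M) (m : M)) := by
  refine ContDiffAt.comp _ ?_ hr
  rw [hri.self_of_nhds]
  exact H.contDiffAt_horizontalLift hh Y

theorem smoothFieldAt_horizontalField (Y : EQ) :
    SmoothFieldAt (horizontalField h r m Y) (m : M) :=
  smoothFieldAt_chartField (mem_chart_source E (m : M))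
    (H.contDiffAt_horizontalLift_comp hh hr hri Y)

theorem connection_horizontalField (X Y : EQ) :
    D (horizontalField h r m Y) (m : M) (liftAt E h m X) = covDerivLiftAt D h m X Y := by
  have hm := mem_chart_source Ec m
  have hchart := H.hyperkahler.isLeviCivita.toModel_apply_chartField H.hyperkahler.isWeakMetric
    (mem_chart_source E (m : M)) (H.contDiffAt_horizontalLift_comp hh hr hri Y) (liftAt E h m X)
  rw [toModel_self, ofModel_self] at hchart
  have hrf : ∀ᶠ y in 𝓝 (extChartAt 𝓘(ℝ, Ec) m m), r (locInc E Ec m y) = y := by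
    rw [eventually_nhds_extChartAt_iff]
    filter_upwards [hri, (chartAt Ec m).open_source.mem_nhds hm] with x hx hxm
    rw [locInc_extChartAt hxm, hx]
  have chain := fderiv_comp_leftInverse ((H.contDiffAt_locInc m).differentiableAt (by simp))
    (by rw [locInc_extChartAt hm]; exact hr.differentiableAt (by simp))
    ((H.contDiffAt_horizontalLift hh Y).differentiableAt (by simp)) hrf
    (h (extChartAt 𝓘(ℝ, Ec) m m) X)
  rw [locInc_extChartAt hm] at chain
  refine hchart.trans (congrArg₂ (· + ·) chain ?_)
  rw [Function.comp_apply, hri.self_of_nhds]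
  rfl

omit hh hr

variable [ContMDiffSMul 𝓘(ℝ, L) 𝓘(ℝ, E) ∞ G M]
  (HL : IsLocalQuotient (chartMetric g (m : M)) (chartMetric gQ (proj G μ c m)) (locInc E Ec m)
    (locProj G Ec EQ m) h (extChartAt 𝓘(ℝ, Ec) m m))

include HL

theorem eventually_isQuatHorizontal_horizontalField (Y : EQ) :
    ∀ᶠ x in 𝓝[levelSet μ c] (m : M),
      IsQuatHorizontal L G g J (horizontalField (E := E) h r m Y x) := by
  rw [nhdsWithin_eq_map_subtype_coe m.2, eventually_map]
  filter_upwards [H.eventually_mem_chart_source m, hri,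
    eventually_nhds_extChartAt_iff.1 HL.metric_lift] with x ⟨hx, hxM, hxQ⟩ hrx metric_lift
  have field_eq : horizontalField h r m Y (x : M) =
      dInc E Ec x (ofModel Ec m x (h (extChartAt 𝓘(ℝ, Ec) m x) Y)) := by
    rw [horizontalField, chartField, Function.comp_apply, hrx, horizontalLift,
      H.fderiv_locInc hx hxM]
    exact ofModel_toModel hxM _
  rw [field_eq]
  refine ⟨H.isHorizontal_dInc_ofModel hx hxM hxQ fun z hz ↦ ?_,
    (H.mem_range_dInc x _).1 ⟨_, rfl⟩⟩
  obtain ⟨k, hk, rfl⟩ := mem_vert.1 hz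
  rw [metric_lift, hk, map_zero]

end HorizontalField

theorem liftAt_eq_dInc (X : EQ) :
    liftAt E h m X = dInc E Ec m (h (extChartAt 𝓘(ℝ, Ec) m m) X) :=
  DFunLike.congr_fun (fderiv_writtenInExtChartAt_self (H.mdifferentiableAt_val m)) _

variable [ContMDiffSMul 𝓘(ℝ, L) 𝓘(ℝ, E) ∞ G M]

theorem mem_vert_locInc_iff {v : TangentSpace 𝓘(ℝ, E) (m : M)} :
    v ∈ vert (E := E) (fderiv ℝ (locInc E Ec m) (extChartAt 𝓘(ℝ, Ec) m m))
        (fderiv ℝ (locProj G Ec EQ m) (extChartAt 𝓘(ℝ, Ec) m m)) ↔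
      ∃ ρ, fund L G E (m : M) ρ = v := by
  rw [fderiv_writtenInExtChartAt_self (H.mdifferentiableAt_val m),
    fderiv_writtenInExtChartAt_self (H.mdifferentiableAt_proj m)]
  exact H.mem_vert_iff m v

theorem isHorizontal_of_vert {v : TangentSpace 𝓘(ℝ, E) (m : M)}
    (hv : ∀ w ∈ vert (fderiv ℝ (locInc E Ec m) (extChartAt 𝓘(ℝ, Ec) m m))
        (fderiv ℝ (locProj G Ec EQ m) (extChartAt 𝓘(ℝ, Ec) m m)),
      chartMetric g (m : M) (locInc E Ec m (extChartAt 𝓘(ℝ, Ec) m m)) v w = 0) :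
    IsHorizontal L G g v := fun ρ ↦
  (chartMetric_locInc_self _ _).symm.trans (hv _ (H.mem_vert_locInc_iff.2 ⟨ρ, rfl⟩))

section LocalQuotient

variable (HL : IsLocalQuotient (chartMetric g (m : M)) (chartMetric gQ (proj G μ c m))
  (locInc E Ec m) (locProj G Ec EQ m) h (extChartAt 𝓘(ℝ, Ec) m m))

include HL

theorem isQuatHorizontal_liftAt (X : EQ) : IsQuatHorizontal L G g J (liftAt E h m X) := by
  refine ⟨H.isHorizontal_of_vert fun w hw ↦ ?_, ?_⟩
  · obtain ⟨k, hk, rfl⟩ := mem_vert.1 hw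
    exact HL.metric_horizontalLift_vertical X hk
  · rw [H.liftAt_eq_dInc]
    exact (H.mem_range_dInc m _).1 ⟨_, rfl⟩

theorem dInc_eq_liftAt {X : EQ} {u : TangentSpace 𝓘(ℝ, Ec) m} (hX : dProj G Ec EQ m u = X)
    (hu : IsHorizontal L G g (dInc E Ec m u)) : dInc E Ec m u = liftAt E h m X := by
  have horizontal := (H.isQuatHorizontal_liftAt HL X).1
  rw [H.liftAt_eq_dInc] at horizontal ⊢
  obtain ⟨k, hk⟩ : ∃ k : TangentSpace 𝓘(ℝ, Ec) m, k = h (extChartAt 𝓘(ℝ, Ec) m m) X := ⟨_, rfl⟩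
  have hproj : dProj G Ec EQ m k = X := hk ▸
    (DFunLike.congr_fun (fderiv_writtenInExtChartAt_self (H.mdifferentiableAt_proj m)) _).symm.trans
      (HL.proj_lift.self_of_nhds X)
  rw [← hk] at horizontal ⊢
  rw [← sub_eq_zero, ← map_sub]
  refine H.dInc_eq_zero m ?_ fun ρ ↦ ?_
  · rw [map_sub]
    exact sub_eq_zero.2 (hX.trans hproj.symm)
  · rw [map_sub, map_sub, sub_apply, hu ρ, horizontal ρ, sub_zero]

theorem isLocalHyperkahlerQuotient [IsManifold 𝓘(ℝ, Ec) ∞ (levelSet μ c)] [CompleteSpace E]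
    [CompleteSpace EQ] (hDQ : IsLeviCivita gQ DQ) :
    IsLocalHyperkahlerQuotient (chartMetric g (m : M)) (chartMetric gQ (proj G μ c m))
      (locInc E Ec m) (locProj G Ec EQ m) h (extChartAt 𝓘(ℝ, Ec) m m)
      (chartChristoffel D (m : M) (m : M))
      (chartChristoffel DQ (proj G μ c m) (proj G μ c m)) (fun i ↦ J i (m : M)) where
  toIsLocalQuotient := HL
  christoffel := by
    rw [locInc_extChartAt (mem_chart_source Ec m)]
    exact H.hyperkahler.isLeviCivita.isChristoffelAt H.hyperkahler.isWeakMetric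
      (mem_chart_source E (m : M))
  christoffel_base := by
    rw [locProj_extChartAt (mem_chart_source Ec m)]
    exact hDQ.isChristoffelAt H.quotient.isWeakMetric (mem_chart_source EQ (proj G μ c m))
  pos_base X hX := by
    rw [locProj_extChartAt (mem_chart_source Ec m)]
    exact H.quotient.isWeakMetric.chartMetric_pos (mem_chart_source EQ (proj G μ c m)) hX
  reduction := by
    have reduction := H.isLinearReduction_chart (mem_chart_source Ec m)
      (mem_chart_source E (m : M)) (mem_chart_source EQ (proj G μ c m))
    have endo_eq : (fun i ↦ chartEndo (J i) (m : M) (locInc E Ec m (extChartAt 𝓘(ℝ, Ec) m m))) =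
        fun i ↦ J i (m : M) := by
      rw [locInc_extChartAt (mem_chart_source Ec m)]
      exact funext fun i ↦ ContinuousLinearMap.ext (chartEndo_self (J i))
    rwa [endo_eq] at reduction

end LocalQuotient

variable [IsManifold 𝓘(ℝ, Ec) ∞ (levelSet μ c)]
  (HL : IsLocalQuotient (chartMetric g (m : M)) (chartMetric gQ (proj G μ c m)) (locInc E Ec m)
    (locProj G Ec EQ m) h (extChartAt 𝓘(ℝ, Ec) m m))

include HL

theorem isONeill_liftAt (hh : ContDiffAt ℝ ∞ h (extChartAt 𝓘(ℝ, Ec) m m)) {X Y : EQ}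
    {Z : TangentSpace 𝓘(ℝ, E) (m : M)} (hZ : Z ∈ Set.range (fund L G E (m : M)))
    (vertical_eq : ∀ ρ, g (m : M) Z (fund L G E (m : M) ρ) =
      g (m : M) (covDerivLiftAt D h m X Y) (fund L G E (m : M) ρ)) :
    IsONeill L G g D (levelSet μ c) (m : M) (liftAt E h m X) (liftAt E h m Y) Z := by
  obtain ⟨r, hr, hri⟩ := exists_leftInverse_writtenInExtChartAt
    (H.level.embedding.isImmersion.isImmersionAt m)
  refine ⟨_, H.smoothFieldAt_horizontalField hh hr hri Y,
    horizontalField_self hri.self_of_nhds Y,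
    (H.eventually_isQuatHorizontal_horizontalField hri HL Y).mono fun x hx ↦ hx.1, hZ, fun ρ ↦ ?_⟩
  rw [H.connection_horizontalField hh hr hri, map_sub, sub_apply, vertical_eq, sub_self]

theorem isONeill_endo_liftAt (hh : ContDiffAt ℝ ∞ h (extChartAt 𝓘(ℝ, Ec) m m)) (i : Fin 3)
    {X Y : EQ} {Z : TangentSpace 𝓘(ℝ, E) (m : M)} (hZ : Z ∈ Set.range (fund L G E (m : M)))
    (vertical_eq : ∀ ρ, g (m : M) Z (fund L G E (m : M) ρ) =
      g (m : M) (J i (m : M) (covDerivLiftAt D h m X Y)) (fund L G E (m : M) ρ)) :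
    IsONeill L G g D (levelSet μ c) (m : M) (liftAt E h m X) (J i (m : M) (liftAt E h m Y)) Z := by
  obtain ⟨r, hr, hri⟩ := exists_leftInverse_writtenInExtChartAt
    (H.level.embedding.isImmersion.isImmersionAt m)
  have smooth_field := H.smoothFieldAt_horizontalField hh hr hri Y
  refine ⟨fun x ↦ J i x (horizontalField h r m Y x),
    H.hyperkahler.smoothFieldAt_endo smooth_field i,
    congrArg (J i m) (horizontalField_self hri.self_of_nhds Y),
    (H.eventually_isQuatHorizontal_horizontalField hri HL Y).mono
      fun x hx ↦ H.hyperkahler.isHorizontal_endo hx i, hZ, fun ρ ↦ ?_⟩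
  rw [H.hyperkahler.parallel i _ _ _ smooth_field.diffFieldAt,
    H.connection_horizontalField hh hr hri, map_sub, sub_apply, vertical_eq, sub_self]

omit HL

section ONeillBound

variable {ΓB : EQ → EQ → EQ} (hh : ContDiffAt ℝ ∞ h (extChartAt 𝓘(ℝ, Ec) m m))
  (HK : IsLocalHyperkahlerQuotient (chartMetric g (m : M)) (chartMetric gQ (proj G μ c m))
    (locInc E Ec m) (locProj G Ec EQ m) h (extChartAt 𝓘(ℝ, Ec) m m)
    (chartChristoffel D (m : M) (m : M)) ΓB (fun i ↦ J i (m : M)))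
  (finite : oneillNorm L G g D J (levelSet μ c) (m : M) ≠ ⊤)

omit [IsManifold 𝓘(ℝ, Ec) ∞ (levelSet μ c)] in
theorem verticalPart_mem_range_fund (v : TangentSpace 𝓘(ℝ, E) (m : M)) :
    HK.quatSplit.verticalPart v ∈ Set.range (fund L G E (m : M)) :=
  H.mem_vert_locInc_iff.1 (HK.quatSplit.verticalPart_mem v)

omit [IsManifold 𝓘(ℝ, Ec) ∞ (levelSet μ c)] in
theorem metric_verticalPart_fund (v : TangentSpace 𝓘(ℝ, E) (m : M)) (ρ : L) :
    g (m : M) (HK.quatSplit.verticalPart v) (fund L G E (m : M) ρ) =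
      g (m : M) v (fund L G E (m : M) ρ) :=
  (chartMetric_locInc_self (Ec := Ec) _ _).symm.trans
    ((HK.quatSplit.apply_verticalPart v (H.mem_vert_locInc_iff.2 ⟨ρ, rfl⟩)).trans
      (chartMetric_locInc_self _ _))

include hh finite

theorem metric_verticalPart_le {X Y : EQ} (hX : X ≠ 0) (hY : Y ≠ 0) :
    chartMetric g (m : M) (locInc E Ec m (extChartAt 𝓘(ℝ, Ec) m m))
        (HK.quatSplit.verticalPart (covDerivLiftAt D h m X Y))
        (HK.quatSplit.verticalPart (covDerivLiftAt D h m X Y)) ≤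
      (oneillNorm L G g D J (levelSet μ c) (m : M)).toReal ^ 2 *
        (chartMetric gQ (proj G μ c m) (locProj G Ec EQ m (extChartAt 𝓘(ℝ, Ec) m m)) X X *
          chartMetric gQ (proj G μ c m) (locProj G Ec EQ m (extChartAt 𝓘(ℝ, Ec) m m)) Y Y) := by
  have HL := HK.toIsLocalQuotient
  have bound := H.hyperkahler.isWeakMetric.metric_le_of_isONeill finite
    (H.isQuatHorizontal_liftAt HL X) (liftAt_ne_zero HL (HK.pos_base X hX))
    (H.isQuatHorizontal_liftAt HL Y) (liftAt_ne_zero HL (HK.pos_base Y hY))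
    (H.isONeill_liftAt HL hh (H.verticalPart_mem_range_fund HK _)
      (H.metric_verticalPart_fund HK _))
  rw [metric_liftAt HL, metric_liftAt HL] at bound
  exact (chartMetric_locInc_self _ _).trans_le bound

theorem metric_verticalPart_endo_le (i : Fin 3) {X Y : EQ} (hX : X ≠ 0) (hY : Y ≠ 0) :
    chartMetric g (m : M) (locInc E Ec m (extChartAt 𝓘(ℝ, Ec) m m))
        (HK.quatSplit.verticalPart (J i (m : M) (covDerivLiftAt D h m X Y)))
        (HK.quatSplit.verticalPart (J i (m : M) (covDerivLiftAt D h m X Y))) ≤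
      (oneillNorm L G g D J (levelSet μ c) (m : M)).toReal ^ 2 *
        (chartMetric gQ (proj G μ c m) (locProj G Ec EQ m (extChartAt 𝓘(ℝ, Ec) m m)) X X *
          chartMetric gQ (proj G μ c m) (locProj G Ec EQ m (extChartAt 𝓘(ℝ, Ec) m m)) Y Y) := by
  have HL := HK.toIsLocalQuotient
  have bound := H.hyperkahler.isWeakMetric.metric_le_of_isONeill finite
    (H.isQuatHorizontal_liftAt HL X) (liftAt_ne_zero HL (HK.pos_base X hX))
    (H.hyperkahler.isQuatHorizontal_endo (H.isQuatHorizontal_liftAt HL Y) i)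
    (H.hyperkahler.endo_ne_zero (liftAt_ne_zero HL (HK.pos_base Y hY)) i)
    (H.isONeill_endo_liftAt HL hh i (H.verticalPart_mem_range_fund HK _)
      (H.metric_verticalPart_fund HK _))
  rw [H.hyperkahler.isometry, metric_liftAt HL, metric_liftAt HL] at bound
  exact (chartMetric_locInc_self _ _).trans_le bound

end ONeillBound

theorem abs_sectionalCurvature_sub_le [CompleteSpace E] [CompleteSpace Ec] [CompleteSpace EQ]
    (hDQ : IsLeviCivita gQ DQ)
    (finite : oneillNorm L G g D J (levelSet μ c) (m : M) ≠ ⊤)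
    {u v : TangentSpace 𝓘(ℝ, EQ) (proj G μ c m)} (huv : LinearIndependent ℝ ![u, v])
    {u' v' : TangentSpace 𝓘(ℝ, Ec) m} (hu : dProj G Ec EQ m u' = u) (hv : dProj G Ec EQ m v' = v)
    (hu' : IsHorizontal L G g (dInc E Ec m u')) (hv' : IsHorizontal L G g (dInc E Ec m v')) :
    |sectionalCurvature gQ DQ u v -
        sectionalCurvature g D (dInc E Ec m u') (dInc E Ec m v')| ≤
      9 * (oneillNorm L G g D J (levelSet μ c) (m : M)).toReal ^ 2 := by
  obtain ⟨h, hh, HL⟩ := H.exists_isLocalQuotient m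
  have HK := H.isLocalHyperkahlerQuotient HL hDQ
  have estimate := HK.abs_sectionalCurvature_sub_le ENNReal.toReal_nonneg
    (fun _ _ ↦ H.metric_verticalPart_le hh HK finite)
    (fun i _ _ ↦ H.metric_verticalPart_endo_le hh HK finite i) (X := u) (Y := v) huv
  rw [locInc_extChartAt (mem_chart_source Ec m), locProj_extChartAt (mem_chart_source Ec m)]
    at estimate
  rwa [hDQ.sectionalCurvature_eq H.quotient.isWeakMetric,
    H.hyperkahler.isLeviCivita.sectionalCurvature_eq H.hyperkahler.isWeakMetric,
    H.dInc_eq_liftAt HL hu hu', H.dInc_eq_liftAt HL hv hv']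

end IsHyperkahlerQuotient

end ONeill

end HKQuot

theorem mainTheorem1_general
    {L : Type*} [NormedAddCommGroup L] [NormedSpace ℝ L]
    {G : Type*} [TopologicalSpace G] [ChartedSpace L G] [Group G]
    {E : Type*} [NormedAddCommGroup E] [NormedSpace ℝ E] [CompleteSpace E]
    {M : Type*} [TopologicalSpace M] [ChartedSpace E M] [IsManifold 𝓘(ℝ, E) ∞ M]
    [MulAction G M] [ContMDiffSMul 𝓘(ℝ, L) 𝓘(ℝ, E) ∞ G M]
    {g : HKQuot.BilinField E M} {D : HKQuot.Connection E M} {J : Fin 3 → HKQuot.EndoField E M}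
    {μ : Fin 3 → M → (L →L[ℝ] ℝ)} {c : Fin 3 → (L →L[ℝ] ℝ)}
    {Ec : Type*} [NormedAddCommGroup Ec] [NormedSpace ℝ Ec] [CompleteSpace Ec]
    [ChartedSpace Ec (HKQuot.levelSet μ c)] [IsManifold 𝓘(ℝ, Ec) ∞ (HKQuot.levelSet μ c)]
    {EQ : Type*} [NormedAddCommGroup EQ] [NormedSpace ℝ EQ] [CompleteSpace EQ]
    [ChartedSpace EQ (HKQuot.Quo G μ c)] [IsManifold 𝓘(ℝ, EQ) ∞ (HKQuot.Quo G μ c)]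
    {gQ : HKQuot.BilinField EQ (HKQuot.Quo G μ c)}
    (H : HKQuot.IsHyperkahlerQuotient (G := G) Ec g D J μ c gQ)
    {DQ : HKQuot.Connection EQ (HKQuot.Quo G μ c)} (hDQ : HKQuot.IsLeviCivita gQ DQ)
    {m : HKQuot.levelSet μ c} {u v : TangentSpace 𝓘(ℝ, EQ) (HKQuot.proj G μ c m)}
    (huv : LinearIndependent ℝ ![u, v]) {u' v' : TangentSpace 𝓘(ℝ, Ec) m}
    (hu : HKQuot.dProj G Ec EQ m u' = u) (hv : HKQuot.dProj G Ec EQ m v' = v)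
    (hu' : HKQuot.IsHorizontal L G g (HKQuot.dInc E Ec m u'))
    (hv' : HKQuot.IsHorizontal L G g (HKQuot.dInc E Ec m v')) :
    ENNReal.ofReal |HKQuot.sectionalCurvature gQ DQ u v -
        HKQuot.sectionalCurvature g D (HKQuot.dInc E Ec m u') (HKQuot.dInc E Ec m v')| ≤
      9 * HKQuot.oneillNorm L G g D J (HKQuot.levelSet μ c) (m : M) ^ 2 := by
  by_cases finite : HKQuot.oneillNorm L G g D J (HKQuot.levelSet μ c) (m : M) = ⊤
  · simp [finite]
  refine (ENNReal.ofReal_le_ofReal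
    (H.abs_sectionalCurvature_sub_le hDQ finite huv hu hv hu' hv')).trans_eq ?_
  rw [ENNReal.ofReal_mul (by norm_num), ENNReal.ofReal_pow ENNReal.toReal_nonneg,
    ENNReal.ofReal_toReal finite, ENNReal.ofReal_ofNat]

theorem mainTheorem1
    -- the Banach Lie group `G`, with Lie algebra `L`
    {L : Type*} [NormedAddCommGroup L] [NormedSpace ℝ L] [CompleteSpace L]
    {G : Type*} [TopologicalSpace G] [ChartedSpace L G] [Group G] [LieGroup 𝓘(ℝ, L) ∞ G]
    -- the Banach manifold `M`
    {E : Type*} [NormedAddCommGroup E] [NormedSpace ℝ E] [CompleteSpace E]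
    {M : Type*} [TopologicalSpace M] [T2Space M] [ChartedSpace E M]
    [IsManifold 𝓘(ℝ, E) ∞ M]
    -- the weak hyperkähler structure and the smooth tri-Hamiltonian action
    (g : HKQuot.BilinField E M) (D : HKQuot.Connection E M) (J : Fin 3 → HKQuot.EndoField E M)
    (hHK : HKQuot.IsWeakHyperkahler g D J)
    [MulAction G M] [ContMDiffSMul 𝓘(ℝ, L) 𝓘(ℝ, E) ∞ G M]
    (μ : Fin 3 → M → (L →L[ℝ] ℝ)) (hμ : HKQuot.IsHyperkahlerMomentMap G g J μ)
    -- the level `c`, fixed by the coadjoint action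
    (c : Fin 3 → (L →L[ℝ] ℝ)) (hc : ∀ (h : G) (i : Fin 3), HKQuot.coAd h (c i) = c i)
    (hG : HKQuot.IsGoodOnLevel G g μ c)
    -- the level set is a submanifold
    {Ec : Type*} [NormedAddCommGroup Ec] [NormedSpace ℝ Ec] [CompleteSpace Ec]
    [ChartedSpace Ec (HKQuot.levelSet μ c)] [IsManifold 𝓘(ℝ, Ec) ∞ (HKQuot.levelSet μ c)]
    (hMc : HKQuot.IsLevelSubmanifold (E := E) (Ec := Ec) μ c)
    -- the hyperkähler quotient `Q`, with its metric and its Levi-Civita connection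
    {EQ : Type*} [NormedAddCommGroup EQ] [NormedSpace ℝ EQ] [CompleteSpace EQ]
    [ChartedSpace EQ (HKQuot.Quo G μ c)]
    [IsManifold 𝓘(ℝ, EQ) ∞ (HKQuot.Quo G μ c)]
    (gQ : HKQuot.BilinField EQ (HKQuot.Quo G μ c))
    (hQ : HKQuot.IsQuotientStructure (Ec := Ec) G g μ c gQ)
    (DQ : HKQuot.Connection EQ (HKQuot.Quo G μ c)) (hDQ : HKQuot.IsLeviCivita gQ DQ)
    -- a point `m` of the level set, a plane in `T_p Q`, `p = proj m`, and its horizontal lift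
    (m : HKQuot.levelSet μ c)
    (u v : TangentSpace 𝓘(ℝ, EQ) (HKQuot.proj G μ c m)) (huv : LinearIndependent ℝ ![u, v])
    (u' v' : TangentSpace 𝓘(ℝ, Ec) m)
    (hu : mfderiv 𝓘(ℝ, Ec) 𝓘(ℝ, EQ) (HKQuot.proj G μ c) m u' = u)
    (hv : mfderiv 𝓘(ℝ, Ec) 𝓘(ℝ, EQ) (HKQuot.proj G μ c) m v' = v)
    (hu' : HKQuot.IsHorizontal L G g
      (mfderiv 𝓘(ℝ, Ec) 𝓘(ℝ, E) (Subtype.val : HKQuot.levelSet μ c → M) m u'))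
    (hv' : HKQuot.IsHorizontal L G g
      (mfderiv 𝓘(ℝ, Ec) 𝓘(ℝ, E) (Subtype.val : HKQuot.levelSet μ c → M) m v')) :
    ENNReal.ofReal |HKQuot.sectionalCurvature gQ DQ u v -
        HKQuot.sectionalCurvature g D
          (mfderiv 𝓘(ℝ, Ec) 𝓘(ℝ, E) (Subtype.val : HKQuot.levelSet μ c → M) m u')
          (mfderiv 𝓘(ℝ, Ec) 𝓘(ℝ, E) (Subtype.val : HKQuot.levelSet μ c → M) m v')| ≤
      9 * HKQuot.oneillNorm L G g D J (HKQuot.levelSet μ c) (m : M) ^ 2 :=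
  mainTheorem1_general ⟨hHK, hμ, hc, hG.elliptic, hMc, hQ⟩ hDQ huv hu hv hu' hv'
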